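/- **Setting.** Let $b_0<\dots<b_\ell$ be real numbers with multiplicities $m_0,\dots,m_\ell\ge 1$, at least one $m_\sigma\ge 2$, and let $n+1=\sum m_\sigma$. Split $x,y\in\mathbb R^{n+1}$ into blocks $x_\sigma,y_\sigma\in\mathbb R^{m_\sigma}$. The degenerate Neumann system lives on $T^*S^n=\{(x,y):\langle x,x\rangle=1,\ \langle x,y\rangle=0\}$, with Hamiltonian $H=\frac12\langle y,y\rangle+\frac12\sum_\sigma b_\sigma\|x_\sigma\|^2$ and equations of motion $\dot x_\sigma=y_\sigma$, $\dot y_\sigma=-b_\sigma x_\sigma+\bigl(\sum_\tau b_\tau\|x_\tau\|^2-\|y\|^2\bigr)x_\sigma$. The group $G=\prod_\sigma O(m_\sigma)$ acts by $g(x,y)=(gx,gy)$. Call $\sigma$ *multiple* if $m_\sigma\ge2$ and *simple* if $m_\sigma=1$; let $\tilde\ell+1\geq 1$ be the number of multiple indices. In the following $\tau$ always runs over the multiple indices. Put $\mathbf J_\tau=x_\tau y_\tau^t-y_\tau x_\tau^t\in\mathfrak{so}(m_\tau)$, $\mathbf J=(\mathbf J_\tau)_\tau$, $J_\tau=\bigl(\sum_{i<k}(\mathbf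 J_\tau)_{ik}^2\bigr)^{1/2}$, and let $\mathcal{EC}=(H,(J_\tau)_\tau):T^*S^n\to\mathbb R^{\tilde\ell+2}$ be the Energy–Casimir mapping. A value $(h,j)$ is *weakly regular* if at every point of the fibre $\mathcal F_{h,j}=\mathcal{EC}^{-1}(h,j)\subseteq T^*S^n$ the mapping is differentiable and the fibre is a submanifold whose tangent space is the kernel of the derivative. The reduction mapping is $R(x,y)=(\xi,\eta)$ with $\xi_\tau=\|x_\tau\|$, $\eta_\tau=\langle x_\tau,y_\tau\rangle/\|x_\tau\|$ for multiple $\tau$ and $\xi_\sigma=x_\sigma$, $\eta_\sigma=y_\sigma$ for simple $\sigma$. The amended potential is $V_j(\xi)=\frac12\sum_\sigma b_\sigma\xi_\sigma^2+\frac12\sum_\tau j_\tau^2/\xi_\tau^2$ on $S^\ell_+=\{\xi\in S^\ell:\xi_\tau>0\ \forall\tau\}$, and $$N_{h,j}=\Bigl\{(\xi,\eta):\ \xi\in S^\ell_+,\ \langle\xi,\eta\rangle=0,\ \tfrac12\|\eta\|^2+V_j(\xi)=h\Bigr\}.$$ $G_{k,2}$ denotes the Grassmannian of oriented $2$-planes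 in $\mathbb R^k$, embedded in $\mathfrak{so}(k)$ by sending the plane with oriented orthonormal basis $(u,v)$ to $uv^t-vu^t$. **Theorem (Energy–Casimir mapping, regular part).** (a) Let $(h,j)$ be a weakly regular value of $\mathcal{EC}$ with nonempty fibre $\mathcal F=\mathcal F_{h,j}$. For every momentum $\mu=\mathbf J(q)$, $q\in T^*\mathbb R^{n+1}$, with $J(q)=j$, one has $\mathcal F=H^{-1}(h)\cap\bigcup_{\tilde\mu\in G\cdot\mu}\mathbf J^{-1}(\tilde\mu)$ (in $T^*S^n$). The map $(P_\tau)_\tau\mapsto(j_\tau P_\tau)_\tau$ is an injection of $\prod_\tau G_{m_\tau,2}$ with image $\mathbf J(\mathcal F)$, so that $\mathbf J(\mathcal F)\cong\prod_\tau G_{m_\tau,2}$; moreover $R(\mathcal F)=N_{h,j}$, which is a smooth embedded submanifold. $\mathcal F$ is a double bundle: $R:\mathcal F\to N_{h,j}$ and $\mathbf J:\mathcal F\to\prod_\tau G_{m_\tau,2}$ are smooth locally trivial fibre bundles (each with typical fibre any one of its fibres), every fibre of $R$ is, by means of $\mathbf J$, a smooth $\mathbb T^{\tilde\ell+1}$-bundle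 over $\prod_\tau G_{m_\tau,2}$, and every fibre of $\mathbf J$ is, by means of $R$, a smooth $\mathbb T^{\tilde\ell+1}$-bundle over $N_{h,j}$. (b) Let $p\in T^*S^n$ with all $J_\tau(p)>0$, and let $R(p)=(\xi,\eta)$. Then $p$ is a relative equilibrium (the vector field at $p$ is tangent to the $G$-orbit of $p$) if and only if $\eta=0$ and $\xi$ is a critical point of the amended potential $V_{J(p)}$ on $S^\ell_+$; and this holds if and only if $p$ is a critical point of $\mathcal{EC}$. (c) Let all $j_\tau>0$ and write $\omega_\tau=\omega_\tau(\beta)=\sqrt{b_\tau-\beta}$. A point $\xi\in S^\ell_+$ is a critical point of $V_j$ if and only if there is $\beta$ such that, for all $\tau$, $\beta<b_\tau$ and $\xi_\tau^2=j_\tau/\omega_\tau$, and, for all simple $\sigma$, $\xi_\sigma=0$ or $b_\sigma=\beta$. If $m_0\ge2$, then $\xi_\sigma=0$ for all simple $\sigma$ at every critical point. (d) Let all $j_\tau>0$. There is exactly one $\beta$ with $\beta<b_\tau$ for all $\tau$ and $\sum_\tau j_\tau/\omega_\tau(\beta)=1$. With this $\beta$, $(h,j)$ is a critical value of $\mathcal{EC}$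 for $$h=\tfrac12\sum_\tau j_\tau\Bigl(\omega_\tau+\frac{b_\tau}{\omega_\tau}\Bigr).$$ The only other critical values $(h,j)$ with this $j$ are those with $$h=\tfrac12 b_\sigma\Bigl(1-\sum_\tau \frac{j_\tau}{\omega_\tau}\Bigr)+\tfrac12\sum_\tau j_\tau\Bigl(\omega_\tau+\frac{b_\tau}{\omega_\tau}\Bigr),\qquad \omega_\tau=\sqrt{b_\tau-b_\sigma},$$ where $\sigma$ is a simple index with $b_\sigma<b_\tau$ for all $\tau$ and $\sum_\tau j_\tau/\omega_\tau<1$. In particular, if $m_0\ge2$ (for instance if the indices are such that $m_0,\dots,m_{\tilde\ell}\ge2$ are the multiple ones), there are no other critical values of $\mathcal{EC}$ in the region where all $j_\tau>0$. -/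

import Mathlib

open scoped ContDiff Matrix RealInnerProductSpace

attribute [local instance] Matrix.normedAddCommGroup Matrix.normedSpace

noncomputable section

namespace DegenerateNeumann

/-! ### Submanifolds, smooth maps and smooth fibre bundles inside normed spaces -/

section Geometry

variable {E E' E'' : Type*}
  [NormedAddCommGroup E] [NormedSpace ℝ E]
  [NormedAddCommGroup E'] [NormedSpace ℝ E']
  [NormedAddCommGroup E''] [NormedSpace ℝ E'']

/-- Near its point `p`, the set `S` is a smooth embedded submanifold with tangent space `L` at `p`:
it is locally the zero set of a smooth submersion `g` and `L = ker Dg(p)`. -/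
def IsSubmanifoldAt (S : Set E) (p : E) (L : Submodule ℝ E) : Prop :=
  ∃ (k : ℕ) (g : E → Fin k → ℝ) (U : Set E), IsOpen U ∧ p ∈ U ∧ ContDiffOn ℝ ∞ g U ∧
    S ∩ U = {q ∈ U | g q = 0} ∧ Function.Surjective (fderiv ℝ g p) ∧
    LinearMap.ker (fderiv ℝ g p : E →ₗ[ℝ] (Fin k → ℝ)) = L

/-- `S` is a smooth embedded submanifold. -/
def IsSubmanifold (S : Set E) : Prop :=
  ∀ p ∈ S, ∃ L : Submodule ℝ E, IsSubmanifoldAt S p L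

/-- `f` is a smooth map on the (arbitrary) subset `S`: locally it extends to a smooth map on an
open set of the ambient space. -/
def IsSmoothOn (f : E → E') (S : Set E) : Prop :=
  ∀ p ∈ S, ∃ (U : Set E) (g : E → E'), IsOpen U ∧ p ∈ U ∧ ContDiffOn ℝ ∞ g U ∧
    Set.EqOn f g (S ∩ U)

/-- `π : A → B` is a smooth locally trivial fibre bundle with typical fibre `K`: over a
neighbourhood `U` of every point of `B` there are mutually inverse smooth maps
`a ↦ (π a, Φ a)` and `Ψ` between `A ∩ π⁻¹(U)` and `(B ∩ U) × K`. -/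
def IsSmoothFibreBundle (A : Set E) (π : E → E') (B : Set E') (K : Set E'') : Prop :=
  Set.MapsTo π A B ∧ IsSmoothOn π A ∧
  ∀ b ∈ B, ∃ (U : Set E') (Φ : E → E'') (Ψ : E' × E'' → E), IsOpen U ∧ b ∈ U ∧
    IsSmoothOn Φ (A ∩ π ⁻¹' U) ∧ IsSmoothOn Ψ ((B ∩ U) ×ˢ K) ∧
    (∀ a ∈ A ∩ π ⁻¹' U, Φ a ∈ K ∧ Ψ (π a, Φ a) = a) ∧
    (∀ c ∈ B ∩ U, ∀ k ∈ K, Ψ (c, k) ∈ A ∧ π (Ψ (c, k)) = c ∧ Φ (Ψ (c, k)) = k)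

end Geometry

/-- The torus `𝕋^ι`, as the set of `ι`-tuples of complex numbers of modulus one. -/
def torus (ι : Type*) : Set (ι → ℂ) := {t | ∀ i, ‖t i‖ = 1}

/-! ### The Grassmannian of oriented planes -/

/-- A point of the Grassmannian `G_{k,2}`: an oriented two-dimensional subspace of `ℝ^k`. -/
structure OrientedPlane (k : ℕ) where
  plane : Submodule ℝ (EuclideanSpace ℝ (Fin k))
  finrank_eq : Module.finrank ℝ plane = 2
  orientation : Orientation ℝ plane (Fin 2)

/-- The Plücker embedding `G_{k,2} → 𝔰𝔬(k)`: the `(i, l)` entry is the oriented area spanned by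
the projections of `e_i` and `e_l` to the plane. For an oriented orthonormal basis `(u, v)` of the
plane this is the matrix `u vᵗ - v uᵗ`. -/
def OrientedPlane.bivector {k : ℕ} (P : OrientedPlane k) : Matrix (Fin k) (Fin k) ℝ :=
  haveI : Fact (Module.finrank ℝ P.plane = 2) := ⟨P.finrank_eq⟩
  Matrix.of fun i l => P.orientation.areaForm
    (P.plane.orthogonalProjectionOnto (EuclideanSpace.single i 1))
    (P.plane.orthogonalProjectionOnto (EuclideanSpace.single l 1))

/-! ### The degenerate Neumann system

The distinct eigenvalues are `b 0 < ⋯ < b ℓ`, with multiplicities `m 0, …, m ℓ`. -/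

variable {ℓ : ℕ} {m : Fin (ℓ + 1) → ℕ}

/-- The configuration space `ℝ^{n+1}`, `n + 1 = ∑ m_σ`, split into the blocks `ℝ^{m_σ}`. -/
abbrev Config (m : Fin (ℓ + 1) → ℕ) : Type := ∀ σ, EuclideanSpace ℝ (Fin (m σ))

/-- `T^*ℝ^{n+1}`, with points `(x, y)`. -/
abbrev Phase (m : Fin (ℓ + 1) → ℕ) : Type := Config m × Config m

/-- The indices of the multiple eigenvalues; there are `ℓ̃ + 1` of them. -/
abbrev Mult (m : Fin (ℓ + 1) → ℕ) : Type := {σ : Fin (ℓ + 1) // 2 ≤ m σ}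

/-- `C₁ = ⟨x, x⟩`. -/
def C₁ (p : Phase m) : ℝ := ∑ σ, ⟪p.1 σ, p.1 σ⟫

/-- `C₂ = ⟨x, y⟩`. -/
def C₂ (p : Phase m) : ℝ := ∑ σ, ⟪p.1 σ, p.2 σ⟫

/-- `T^*S^n ⊆ T^*ℝ^{n+1}`. -/
def cotangentSphere (m : Fin (ℓ + 1) → ℕ) : Set (Phase m) := {p | C₁ p = 1 ∧ C₂ p = 0}

/-- The tangent space of `T^*S^n` at one of its points. -/
def tangentCotangentSphere (p : Phase m) : Submodule ℝ (Phase m) :=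
  LinearMap.ker (fderiv ℝ (fun q : Phase m => (C₁ q, C₂ q)) p : Phase m →ₗ[ℝ] ℝ × ℝ)

/-- The Hamiltonian `H = ½⟨y, y⟩ + ½⟨x, A x⟩`. -/
def energy (b : Fin (ℓ + 1) → ℝ) (p : Phase m) : ℝ :=
  (1 / 2) * ∑ σ, ‖p.2 σ‖ ^ 2 + (1 / 2) * ∑ σ, b σ * ‖p.1 σ‖ ^ 2

/-- The vector field of the Neumann system on `T^*S^n`:
`x' = y`, `y' = -∇V + (⟨x, ∇V⟩ - 2T) x` with `∇V = A x` and `2T = ⟨y, y⟩`. -/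
def neumannField (b : Fin (ℓ + 1) → ℝ) (p : Phase m) : Phase m :=
  (p.2, fun σ => -(b σ • p.1 σ) +
    (∑ τ, b τ * ‖p.1 τ‖ ^ 2 - ∑ τ, ‖p.2 τ‖ ^ 2) • p.1 σ)

/-- Values of the momentum mapping: one square matrix for each multiple eigenvalue. -/
abbrev Momentum (m : Fin (ℓ + 1) → ℕ) : Type :=
  ∀ τ : Mult m, Matrix (Fin (m τ.1)) (Fin (m τ.1)) ℝ

/-- The momentum mapping `𝐉` of `G̃`, with entries `L_{ik} = x_i y_k - x_k y_i`. -/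
def momentum (p : Phase m) : Momentum m :=
  fun τ => Matrix.of fun i k => p.1 τ.1 i * p.2 τ.1 k - p.1 τ.1 k * p.2 τ.1 i

/-- `J_σ = √W_σ`, `W_σ = ∑_{i<k} L_{ik}²`, for each multiple eigenvalue. -/
def totalMomentum (p : Phase m) (τ : Mult m) : ℝ :=
  √(∑ i, ∑ k ∈ Finset.Ioi i, momentum p τ i k ^ 2)

/-- The Energy--Casimir mapping `(H, J_0, …, J_ℓ̃)`. -/
def energyCasimir (b : Fin (ℓ + 1) → ℝ) (p : Phase m) : ℝ × (Mult m → ℝ) :=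
  (energy b p, totalMomentum p)

/-- The fibre `𝓕_{h,j}` of the Energy--Casimir mapping on `T^*S^n`. -/
def fibre (m : Fin (ℓ + 1) → ℕ) (b : Fin (ℓ + 1) → ℝ) (h : ℝ) (j : Mult m → ℝ) :
    Set (Phase m) :=
  {p ∈ cotangentSphere m | energyCasimir b p = (h, j)}

/-- `(h, j)` is a weakly regular value of the Energy--Casimir mapping on `T^*S^n`: at every point
of the fibre the mapping is differentiable, and the fibre is a submanifold whose tangent space is
the kernel of the derivative. -/
def IsWeaklyRegularValue (m : Fin (ℓ + 1) → ℕ) (b : Fin (ℓ + 1) → ℝ) (h : ℝ)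
    (j : Mult m → ℝ) : Prop :=
  ∀ p ∈ fibre m b h j, DifferentiableAt ℝ (energyCasimir b) p ∧
    IsSubmanifoldAt (fibre m b h j) p
      (tangentCotangentSphere p ⊓
        LinearMap.ker (fderiv ℝ (energyCasimir b) p : Phase m →ₗ[ℝ] ℝ × (Mult m → ℝ)))

/-- `p` is a critical point of the Energy--Casimir mapping on `T^*S^n`: it is not a point where
the mapping is differentiable with derivative of full rank on the tangent space of `T^*S^n`. -/
def IsCriticalPoint (b : Fin (ℓ + 1) → ℝ) (p : Phase m) : Prop :=
  p ∈ cotangentSphere m ∧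
  ¬ (DifferentiableAt ℝ (energyCasimir b) p ∧
      ∀ c : ℝ × (Mult m → ℝ), ∃ w ∈ tangentCotangentSphere p,
        fderiv ℝ (energyCasimir b) p w = c)

/-- `(h, j)` is a critical value of the Energy--Casimir mapping on `T^*S^n`. -/
def IsCriticalValue (m : Fin (ℓ + 1) → ℕ) (b : Fin (ℓ + 1) → ℝ) (h : ℝ)
    (j : Mult m → ℝ) : Prop :=
  ∃ p : Phase m, IsCriticalPoint b p ∧ energyCasimir b p = (h, j)

/-- The (co)adjoint orbit `G·μ`, where `(g·μ)_σ = g_σ μ_σ g_σᵗ` with `g_σ ∈ O(m_σ)`. -/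
def coadjointOrbit (μ : Momentum m) : Set (Momentum m) :=
  {ν | ∃ g : ∀ τ : Mult m, Matrix.orthogonalGroup (Fin (m τ.1)) ℝ,
    ∀ τ, ν τ = (g τ).1 * μ τ * (g τ).1ᵀ}

/-- `p` is a relative equilibrium: the vector field at `p` is tangent to the `G`-orbit of `p`, that
is, it is the infinitesimal generator at `p` of an element `Ω` of `∏ 𝔰𝔬(m_σ)`. -/
def IsRelativeEquilibrium (b : Fin (ℓ + 1) → ℝ) (p : Phase m) : Prop :=
  p ∈ cotangentSphere m ∧
  ∃ Ω : ∀ σ, Matrix (Fin (m σ)) (Fin (m σ)) ℝ, (∀ σ, (Ω σ)ᵀ = -Ω σ) ∧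
    neumannField b p =
      (fun σ => Matrix.toEuclideanLin (Ω σ) (p.1 σ),
        fun σ => Matrix.toEuclideanLin (Ω σ) (p.2 σ))

/-- The embedding of `∏ G_{m_σ,2}` in the space of momenta which sends a family of oriented planes
to the family of their bivectors, scaled to norms `j_σ`. -/
def scaledPlucker (j : Mult m → ℝ) (P : ∀ τ : Mult m, OrientedPlane (m τ.1)) : Momentum m :=
  fun τ => j τ • (P τ).bivector

/-! ### The reduced system -/

/-- `T^*ℝ^{ℓ+1}`, with points `(ξ, η)`. -/
abbrev ReducedPhase (ℓ : ℕ) : Type := (Fin (ℓ + 1) → ℝ) × (Fin (ℓ + 1) → ℝ)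

/-- The reduction mapping `R`: `ξ_σ = ‖x_σ‖`, `η_σ = ⟨x_σ, y_σ⟩ / ‖x_σ‖` if `m_σ ≥ 2`, and
`ξ_σ = x_σ`, `η_σ = y_σ` if `m_σ = 1` (then the sums below have exactly one term). -/
def reduction (p : Phase m) : ReducedPhase ℓ :=
  (fun σ => if 2 ≤ m σ then ‖p.1 σ‖ else ∑ i, p.1 σ i,
    fun σ => if 2 ≤ m σ then ⟪p.1 σ, p.2 σ⟫ / ‖p.1 σ‖ else ∑ i, p.2 σ i)

/-- The family `j` extended by `0` to the simple eigenvalues. -/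
def extendMomentum (j : Mult m → ℝ) (σ : Fin (ℓ + 1)) : ℝ :=
  if hσ : 2 ≤ m σ then j ⟨σ, hσ⟩ else 0

/-- The amended potential `V_μ(ξ) = ½ ∑ (b_σ ξ_σ² + j_σ² / ξ_σ²)`, with `j_σ = 0` if
`m_σ = 1`. -/
def amendedPotential (b : Fin (ℓ + 1) → ℝ) (j : Mult m → ℝ) (ξ : Fin (ℓ + 1) → ℝ) : ℝ :=
  (1 / 2) * ∑ σ, (b σ * ξ σ ^ 2 + extendMomentum j σ ^ 2 / ξ σ ^ 2)

/-- The reduced Hamiltonian `½ ∑ η_σ² + V_μ(ξ)`. -/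
def reducedEnergy (b : Fin (ℓ + 1) → ℝ) (j : Mult m → ℝ) (z : ReducedPhase ℓ) : ℝ :=
  (1 / 2) * ∑ σ, z.2 σ ^ 2 + amendedPotential b j z.1

/-- The open part of the sphere `S^ℓ` where `ξ_σ > 0` if `m_σ ≥ 2`. -/
def reducedSphere (m : Fin (ℓ + 1) → ℕ) : Set (Fin (ℓ + 1) → ℝ) :=
  {ξ | ∑ σ, ξ σ ^ 2 = 1 ∧ ∀ τ : Mult m, 0 < ξ τ.1}

/-- The reduced level set `N_{h,j}`, in the cotangent bundle of `reducedSphere m`. -/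
def reducedLevel (b : Fin (ℓ + 1) → ℝ) (h : ℝ) (j : Mult m → ℝ) : Set (ReducedPhase ℓ) :=
  {z | z.1 ∈ reducedSphere m ∧ ∑ σ, z.1 σ * z.2 σ = 0 ∧ reducedEnergy b j z = h}

/-- `ξ` is a critical point of the amended potential on `reducedSphere m`: the derivative vanishes
on the tangent space of the sphere. -/
def IsAmendedCriticalPoint (b : Fin (ℓ + 1) → ℝ) (j : Mult m → ℝ)
    (ξ : Fin (ℓ + 1) → ℝ) : Prop :=
  ξ ∈ reducedSphere m ∧
  ∀ w : Fin (ℓ + 1) → ℝ, ∑ σ, ξ σ * w σ = 0 → fderiv ℝ (amendedPotential b j) ξ w = 0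

/-- `ω_σ = √(b_σ - β)`. -/
def omega (b : Fin (ℓ + 1) → ℝ) (β : ℝ) (σ : Fin (ℓ + 1)) : ℝ := √(b σ - β)

/-- `½ ∑ j_σ (ω_σ + b_σ / ω_σ)`, the sum being over the multiple eigenvalues. -/
def criticalEnergy (b : Fin (ℓ + 1) → ℝ) (j : Mult m → ℝ) (β : ℝ) : ℝ :=
  (1 / 2) * ∑ τ, j τ * (omega b β τ.1 + b τ.1 / omega b β τ.1)

end DegenerateNeumann

end

open DegenerateNeumann

/-! Where all `J_τ` are positive, a phase point is the same as a triple: its reduction `z = (ξ, η)`,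
its momentum `ν`, and the unit vectors `u_τ = x_τ / ‖x_τ‖`, which lie in the oriented planes carried
by the `ν_τ`. In a multiple block `x_τ = ξ_τ u_τ`, and Gram–Schmidt gives `y_τ = η_τ u_τ - ξ_τ⁻¹ ν_τ
u_τ`; this is `reconstruct`, inverse to taking coordinates (`reconstruct_reduction`,
`reduction_reconstruct`). By Pythagoras the energy depends on `z` and `j` only, so a fibre of the
Energy–Casimir mapping is `N_{h,j}` times the set of pairs `(ν, u)` (`mem_fibre_iff`,
`reconstruct_mem_fibre`). Over a fixed `ν` the possible `u` form a torus, one circle for each plane,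
and `rotate` and `angle` are its coordinates. Hence everything over `N_{h,j}` is globally trivial,
and over the Grassmannians a local choice of a unit vector in each plane suffices (`localSection`).

Weak regularity enters twice. It forces `j_τ > 0` (`IsWeaklyRegularValue.pos`): where `J_τ = 0`,
differentiability makes the block `(x_τ, y_τ)` vanish on the whole fibre, although moving `y_τ`
alone is a kernel direction and so ought to be tangent. It also makes `N_{h,j}` smooth: its
equations can degenerate only at `η = 0` with `ξ` critical for `V_j`. There, for `ℓ > 0`, a kernel
direction `(0, a)` with `a ≠ 0` would be the velocity of a curve in `N_{h,j}`, while the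
second-order expansion of the energy gives `∑ a_σ² = 0` (`not_critical_of_curve`). For `ℓ = 0` the
level is a point.

Critical points and relative equilibria are both compared with the same reduced condition, `η = 0`
and `∇V_J(ξ) = βξ`. For the first, the differential of `H` is tested on the kernel of that of `J`;
for the second, the generator is paired with `x` and `y`. The multiplier equation decouples: `(b_τ -
β) ξ_τ⁴ = j_τ²` at multiple indices and `(b_σ - β) ξ_σ = 0` at simple ones. The condition `∑ ξ_σ² =
1` then either determines `β`, by monotonicity of `∑ j_τ / ω_τ(β)`, or leaves the missing mass to
the one simple index with `b_σ = β`. -/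

namespace DegenerateNeumann

/-! ### Bivectors and orthonormal frames in one block -/

section Block

variable {k : ℕ}

/-- The matrix `x yᵗ - y xᵗ`. -/
def wedge (x y : EuclideanSpace ℝ (Fin k)) : Matrix (Fin k) (Fin k) ℝ :=
  Matrix.of fun i l => x i * y l - x l * y i

lemma wedge_apply (x y : EuclideanSpace ℝ (Fin k)) (i l : Fin k) :
    wedge x y i l = x i * y l - x l * y i := rfl

lemma toEuclideanLin_wedge (x y w : EuclideanSpace ℝ (Fin k)) :
    Matrix.toEuclideanLin (wedge x y) w = ⟪y, w⟫ • x - ⟪x, w⟫ • y := by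
  ext i
  simp only [Matrix.toLpLin_apply, Matrix.mulVec, dotProduct, wedge_apply, PiLp.sub_apply,
    PiLp.smul_apply, smul_eq_mul, PiLp.inner_apply, RCLike.inner_apply, conj_trivial,
    Finset.sum_mul, ← Finset.sum_sub_distrib]
  exact Finset.sum_congr rfl fun l _ => by ring

lemma wedge_combination (x y : EuclideanSpace ℝ (Fin k)) (a b c d : ℝ) :
    wedge (a • x + b • y) (c • x + d • y) = (a * d - b * c) • wedge x y := by
  ext i l
  simp only [wedge_apply, PiLp.add_apply, PiLp.smul_apply, smul_eq_mul, Matrix.smul_apply]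
  ring

lemma wedge_add_smul_right (x y v : EuclideanSpace ℝ (Fin k)) (t : ℝ) :
    wedge x (y + t • v) = wedge x y + t • wedge x v := by
  ext i l
  simp only [wedge_apply, PiLp.add_apply, PiLp.smul_apply, smul_eq_mul, Matrix.smul_apply,
    Matrix.add_apply]
  ring

lemma wedge_add_smul_left (x y v : EuclideanSpace ℝ (Fin k)) (t : ℝ) :
    wedge (x + t • v) y = wedge x y + t • wedge v y := by
  ext i l
  simp only [wedge_apply, PiLp.add_apply, PiLp.smul_apply, smul_eq_mul, Matrix.smul_apply,
    Matrix.add_apply]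
  ring

/-- The sum of the squares of the entries above the diagonal. -/
def upperSq (A : Matrix (Fin k) (Fin k) ℝ) : ℝ := ∑ i, ∑ l ∈ Finset.Ioi i, A i l ^ 2

lemma upperSq_nonneg (A : Matrix (Fin k) (Fin k) ℝ) : 0 ≤ upperSq A :=
  Finset.sum_nonneg fun _ _ => Finset.sum_nonneg fun _ _ => sq_nonneg _

lemma upperSq_smul (t : ℝ) (A : Matrix (Fin k) (Fin k) ℝ) :
    upperSq (t • A) = t ^ 2 * upperSq A := by
  simp only [upperSq, Matrix.smul_apply, smul_eq_mul, mul_pow, Finset.mul_sum]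

/-- Skewness kills the diagonal and pairs each entry with its mirror image. The sum over `i < l`
thus becomes a Frobenius norm, whose orthogonal invariance is visible from the trace. -/
lemma two_mul_upperSq {A : Matrix (Fin k) (Fin k) ℝ} (hA : Aᵀ = -A) :
    2 * upperSq A = (Aᵀ * A).trace := by
  have hs : ∀ i l, A l i = -A i l := fun i l => congrFun (congrFun hA i) l
  have hd : ∀ i, A i i = 0 := fun i => by linarith [hs i i]
  have h := Finset.sum_sum_Ioi_add_eq_sum_sum_off_diag (fun i l => A i l ^ 2)
  have h1 : ∀ i : Fin k, ∑ j ∈ ({i}ᶜ : Finset (Fin k)), A j i ^ 2 = ∑ j, A j i ^ 2 := fun i => by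
    rw [← Finset.sum_compl_add_sum {i}]; simp [hd]
  simp only [h1] at h
  simp only [Matrix.trace, Matrix.diag, Matrix.mul_apply, Matrix.transpose_apply, ← sq]
  rw [← h, upperSq, Finset.mul_sum]
  refine Finset.sum_congr rfl fun i _ => ?_
  rw [Finset.mul_sum]
  refine Finset.sum_congr rfl fun l _ => ?_
  rw [hs i l]; ring

lemma wedge_transpose (x y : EuclideanSpace ℝ (Fin k)) : (wedge x y)ᵀ = -wedge x y := by
  ext i l
  simp [wedge_apply]

/-- This is Lagrange's identity. -/
lemma upperSq_wedge (x y : EuclideanSpace ℝ (Fin k)) :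
    upperSq (wedge x y) = ‖x‖ ^ 2 * ‖y‖ ^ 2 - ⟪x, y⟫ ^ 2 := by
  have h := two_mul_upperSq (wedge_transpose x y)
  have hx : ‖x‖ ^ 2 = ∑ i, x i ^ 2 := by simp [EuclideanSpace.norm_sq_eq]
  have hy : ‖y‖ ^ 2 = ∑ i, y i ^ 2 := by simp [EuclideanSpace.norm_sq_eq]
  have hxy : ⟪x, y⟫ = ∑ i, x i * y i := by simp [PiLp.inner_apply, mul_comm]
  have e : (((wedge x y)ᵀ * wedge x y).trace) = ∑ i, ∑ l, (x l * y i - x i * y l) ^ 2 := by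
    simp only [Matrix.trace, Matrix.diag, Matrix.mul_apply, Matrix.transpose_apply, ← sq]
    rfl
  have e2 : ∑ i, ∑ l, (x l * y i - x i * y l) ^ 2 =
      2 * ((∑ i, x i ^ 2) * (∑ i, y i ^ 2) - (∑ i, x i * y i) ^ 2) := by
    have : ∀ i l, (x l * y i - x i * y l) ^ 2 =
        y i ^ 2 * x l ^ 2 + x i ^ 2 * y l ^ 2 - 2 * ((x i * y i) * (x l * y l)) :=
      fun i l => by ring
    simp only [this, Finset.sum_sub_distrib, Finset.sum_add_distrib, ← Finset.mul_sum,
      ← Finset.sum_mul]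
    ring
  rw [hx, hy, hxy]
  linarith

/-- Orthonormal pairs of vectors. -/
def IsPair (u v : EuclideanSpace ℝ (Fin k)) : Prop := ‖u‖ = 1 ∧ ‖v‖ = 1 ∧ ⟪u, v⟫ = 0

/-- `A` is `j` times the bivector of an orthonormal pair whose first member is `u`. -/
def IsFrame (j : ℝ) (A : Matrix (Fin k) (Fin k) ℝ) (u : EuclideanSpace ℝ (Fin k)) : Prop :=
  ∃ v, IsPair u v ∧ A = j • wedge u v

lemma IsPair.inner_self {u v : EuclideanSpace ℝ (Fin k)} (h : IsPair u v) :
    ⟪u, u⟫ = 1 ∧ ⟪v, v⟫ = 1 ∧ ⟪u, v⟫ = 0 ∧ ⟪v, u⟫ = 0 := by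
  obtain ⟨hu, hv, huv⟩ := h
  refine ⟨?_, ?_, huv, by rw [real_inner_comm]; exact huv⟩
  · rw [real_inner_self_eq_norm_sq, hu]; norm_num
  · rw [real_inner_self_eq_norm_sq, hv]; norm_num

lemma isPair_iff {u v : EuclideanSpace ℝ (Fin k)} :
    IsPair u v ↔ ⟪u, u⟫ = 1 ∧ ⟪v, v⟫ = 1 ∧ ⟪u, v⟫ = 0 := by
  refine ⟨fun h => ⟨h.inner_self.1, h.inner_self.2.1, h.2.2⟩, fun ⟨h1, h2, h3⟩ => ⟨?_, ?_, h3⟩⟩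
  · rw [real_inner_self_eq_norm_sq] at h1
    exact (pow_eq_one_iff_of_nonneg (norm_nonneg _) two_ne_zero).1 h1
  · rw [real_inner_self_eq_norm_sq] at h2
    exact (pow_eq_one_iff_of_nonneg (norm_nonneg _) two_ne_zero).1 h2

lemma IsPair.upperSq {u v : EuclideanSpace ℝ (Fin k)} (h : IsPair u v) :
    upperSq (wedge u v) = 1 := by
  rw [upperSq_wedge, h.1, h.2.1, h.2.2]; norm_num

lemma IsFrame.upperSq {j : ℝ} {A : Matrix (Fin k) (Fin k) ℝ} {u : EuclideanSpace ℝ (Fin k)}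
    (h : IsFrame j A u) : upperSq A = j ^ 2 := by
  obtain ⟨v, h, rfl⟩ := h
  rw [upperSq_smul, h.upperSq, mul_one]

lemma toEuclideanLin_of_eq_smul_wedge {j : ℝ} {A : Matrix (Fin k) (Fin k) ℝ}
    {u v : EuclideanSpace ℝ (Fin k)} (hA : A = j • wedge u v)
    (w : EuclideanSpace ℝ (Fin k)) :
    Matrix.toEuclideanLin A w = (j * ⟪v, w⟫) • u - (j * ⟪u, w⟫) • v := by
  rw [hA, map_smul, LinearMap.smul_apply, toEuclideanLin_wedge, smul_sub, smul_smul, smul_smul]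

/-- A change of basis multiplies the bivector by its determinant, which is one for a rotation. -/
lemma IsPair.rotate {u v : EuclideanSpace ℝ (Fin k)} (h : IsPair u v) {a b : ℝ}
    (hab : a ^ 2 + b ^ 2 = 1) :
    IsPair (a • u + b • v) (-b • u + a • v) ∧
      wedge (a • u + b • v) (-b • u + a • v) = wedge u v := by
  obtain ⟨h1, h2, h3, h4⟩ := h.inner_self
  constructor
  · rw [isPair_iff]
    simp only [inner_add_left, inner_add_right, inner_smul_left, inner_smul_right, h1, h2, h3, h4,
      conj_trivial]
    refine ⟨by linarith, by linarith, by ring⟩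
  · rw [wedge_combination, show a * a - b * -b = 1 by linarith, one_smul]

/-- The vector with coordinate `t` in the oriented plane of `A`, the first basis vector being
`u`. -/
noncomputable def rotate (j : ℝ) (A : Matrix (Fin k) (Fin k) ℝ) (u : EuclideanSpace ℝ (Fin k)) (t : ℂ) :
    EuclideanSpace ℝ (Fin k) :=
  t.re • u - (t.im / j) • Matrix.toEuclideanLin A u

/-- The coordinate of `u'` in the oriented plane of `A`, the first basis vector being `u`. -/
noncomputable def angle (j : ℝ) (A : Matrix (Fin k) (Fin k) ℝ) (u u' : EuclideanSpace ℝ (Fin k)) : ℂ :=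
  ⟨⟪u, u'⟫, -⟪Matrix.toEuclideanLin A u, u'⟫ / j⟩

/-- The matrix recovers the second frame vector from the first. This is why `IsFrame` records only
`u`, and why `rotate` and `angle` are smooth expressions in `A` and `u`. -/
lemma IsFrame.toEuclideanLin_self {j : ℝ} {A : Matrix (Fin k) (Fin k) ℝ}
    {u v : EuclideanSpace ℝ (Fin k)} (h : IsPair u v) (hA : A = j • wedge u v) :
    Matrix.toEuclideanLin A u = -(j • v) := by
  rw [toEuclideanLin_of_eq_smul_wedge hA, h.inner_self.1, h.inner_self.2.2.2]
  simp

lemma rotate_eq {j : ℝ} (hj : j ≠ 0) {A : Matrix (Fin k) (Fin k) ℝ}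
    {u v : EuclideanSpace ℝ (Fin k)} (h : IsPair u v) (hA : A = j • wedge u v) (t : ℂ) :
    rotate j A u t = t.re • u + t.im • v := by
  rw [rotate, IsFrame.toEuclideanLin_self h hA, smul_neg, sub_neg_eq_add, smul_smul,
    div_mul_cancel₀ _ hj]

lemma angle_eq {j : ℝ} (hj : j ≠ 0) {A : Matrix (Fin k) (Fin k) ℝ}
    {u v : EuclideanSpace ℝ (Fin k)} (h : IsPair u v) (hA : A = j • wedge u v)
    (u' : EuclideanSpace ℝ (Fin k)) : angle j A u u' = ⟨⟪u, u'⟫, ⟪v, u'⟫⟩ := by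
  rw [angle, IsFrame.toEuclideanLin_self h hA, inner_neg_left, neg_neg, inner_smul_left]
  congr 1
  rw [conj_trivial, mul_div_cancel_left₀ _ hj]

lemma IsFrame.rotate {j : ℝ} (hj : j ≠ 0) {A : Matrix (Fin k) (Fin k) ℝ}
    {u : EuclideanSpace ℝ (Fin k)} (h : IsFrame j A u) {t : ℂ} (ht : ‖t‖ = 1) :
    IsFrame j A (rotate j A u t) := by
  obtain ⟨v, h, hA⟩ := h
  rw [rotate_eq hj h hA]
  have hab : t.re ^ 2 + t.im ^ 2 = 1 := by
    have := Complex.sq_norm t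
    rw [ht, Complex.normSq_apply] at this
    linarith
  refine ⟨_, (h.rotate hab).1, ?_⟩
  rw [(h.rotate hab).2, hA]

lemma IsFrame.angle_rotate {j : ℝ} (hj : j ≠ 0) {A : Matrix (Fin k) (Fin k) ℝ}
    {u : EuclideanSpace ℝ (Fin k)} (h : IsFrame j A u) (t : ℂ) :
    DegenerateNeumann.angle j A u (DegenerateNeumann.rotate j A u t) = t := by
  obtain ⟨v, h, hA⟩ := h
  rw [rotate_eq hj h hA, angle_eq hj h hA]
  obtain ⟨h1, h2, h3, h4⟩ := h.inner_self
  apply Complex.ext <;>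
  simp only [inner_add_right, inner_smul_right, h1, h2, h3, h4, mul_one, mul_zero, add_zero,
    zero_add]

lemma IsFrame.rotate_angle {j : ℝ} (hj : j ≠ 0) {A : Matrix (Fin k) (Fin k) ℝ}
    {u u' : EuclideanSpace ℝ (Fin k)} (h : IsFrame j A u) (h' : IsFrame j A u') :
    DegenerateNeumann.rotate j A u (DegenerateNeumann.angle j A u u') = u' ∧
      ‖DegenerateNeumann.angle j A u u'‖ = 1 := by
  obtain ⟨v, h, hA⟩ := h
  obtain ⟨v', h', hA'⟩ := h'
  rw [rotate_eq hj h hA, angle_eq hj h hA]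
  obtain ⟨h1, h2, h3, h4⟩ := h.inner_self
  obtain ⟨h1', h2', h3', h4'⟩ := h'.inner_self
  -- Applying `A` to `v'` in both representations gives `j u'` and a combination of `u` and `v`.
  have e : u' = ⟪v, v'⟫ • u - ⟪u, v'⟫ • v := by
    have e1 := toEuclideanLin_of_eq_smul_wedge hA' v'
    rw [toEuclideanLin_of_eq_smul_wedge hA, h2', h3', mul_zero, zero_smul, sub_zero, mul_one,
      mul_smul, mul_smul, ← smul_sub] at e1
    exact (smul_right_injective _ hj e1).symm
  have hu : ⟪u, u'⟫ = ⟪v, v'⟫ := by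
    rw [e, inner_sub_right, inner_smul_right, inner_smul_right, h1, h3]; ring
  have hv : ⟪v, u'⟫ = -⟪u, v'⟫ := by
    rw [e, inner_sub_right, inner_smul_right, inner_smul_right, h2, h4]; ring
  have e' : ⟪u, u'⟫ • u + ⟪v, u'⟫ • v = u' := by
    rw [hu, hv, neg_smul, ← sub_eq_add_neg]; exact e.symm
  refine ⟨e', ?_⟩
  have n := h1'
  rw [← e'] at n
  simp only [inner_add_left, inner_add_right, inner_smul_left, inner_smul_right, h1, h2, h3, h4,
      conj_trivial] at n
  rw [← pow_eq_one_iff_of_nonneg (norm_nonneg _) two_ne_zero, Complex.sq_norm,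
    Complex.normSq_apply]
  dsimp only at n ⊢
  linarith

/-- As an operator, `A` projects onto its plane, makes a quarter turn and scales by `j`. A nonzero
image vector, once normalised, is therefore a possible first frame vector. -/
lemma IsFrame.normalize {j : ℝ} {A : Matrix (Fin k) (Fin k) ℝ}
    {u w : EuclideanSpace ℝ (Fin k)} (h : IsFrame j A u)
    (hw : Matrix.toEuclideanLin A w ≠ 0) :
    IsFrame j A (‖Matrix.toEuclideanLin A w‖⁻¹ • Matrix.toEuclideanLin A w) := by
  obtain ⟨v, h, hA⟩ := h
  set r := ‖Matrix.toEuclideanLin A w‖ with hr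
  have hr0 : r ≠ 0 := norm_ne_zero_iff.2 hw
  have e := toEuclideanLin_of_eq_smul_wedge hA w
  have hsq : (j * ⟪v, w⟫) ^ 2 + (j * ⟪u, w⟫) ^ 2 = r ^ 2 := by
    rw [hr, e, ← real_inner_self_eq_norm_sq]
    obtain ⟨h1, h2, h3, h4⟩ := h.inner_self
    simp only [inner_sub_left, inner_sub_right, inner_smul_left, inner_smul_right, h1, h2, h3, h4,
      conj_trivial]
    ring
  have hab : (r⁻¹ * (j * ⟪v, w⟫)) ^ 2 + (-(r⁻¹ * (j * ⟪u, w⟫))) ^ 2 = 1 := by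
    field_simp
    linarith
  have e2 : r⁻¹ • Matrix.toEuclideanLin A w =
      (r⁻¹ * (j * ⟪v, w⟫)) • u + (-(r⁻¹ * (j * ⟪u, w⟫))) • v := by
    rw [e, smul_sub, smul_smul, smul_smul, neg_smul, sub_eq_add_neg]
  rw [e2]
  exact ⟨_, (h.rotate hab).1, by rw [(h.rotate hab).2, hA]⟩

lemma IsFrame.wedge_toEuclideanLin {j : ℝ} {A : Matrix (Fin k) (Fin k) ℝ}
    {u : EuclideanSpace ℝ (Fin k)} (h : IsFrame j A u) {a : ℝ} (ha : a ≠ 0) (c : ℝ) :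
    wedge (a • u) (c • u - a⁻¹ • Matrix.toEuclideanLin A u) = A := by
  obtain ⟨v, h, hA⟩ := h
  rw [IsFrame.toEuclideanLin_self h hA, hA]
  have := wedge_combination u v a 0 c (a⁻¹ * j)
  rw [zero_smul, add_zero, mul_smul] at this
  rw [smul_neg, sub_neg_eq_add, this]
  congr 1
  field_simp
  ring

lemma wedge_isFrame {x y : EuclideanSpace ℝ (Fin k)} {j : ℝ} (hj : 0 < j)
    (h : upperSq (wedge x y) = j ^ 2) :
    x ≠ 0 ∧ IsFrame j (wedge x y) (‖x‖⁻¹ • x) ∧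
      (⟪x, y⟫ / ‖x‖) • (‖x‖⁻¹ • x) -
        ‖x‖⁻¹ • Matrix.toEuclideanLin (wedge x y) (‖x‖⁻¹ • x) = y := by
  have hx : x ≠ 0 := by
    rintro rfl
    rw [upperSq_wedge] at h
    simp at h
    exact hj.ne' (pow_eq_zero_iff two_ne_zero |>.1 h.symm)
  have hr : ‖x‖ ≠ 0 := norm_ne_zero_iff.2 hx
  have hxx : ⟪x, x⟫ = ‖x‖ ^ 2 := real_inner_self_eq_norm_sq x
  have hyy : ⟪y, y⟫ = ‖y‖ ^ 2 := real_inner_self_eq_norm_sq y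
  have hc : ⟪y, x⟫ = ⟪x, y⟫ := real_inner_comm _ _
  rw [upperSq_wedge] at h
  -- Gram–Schmidt: the part of `y` orthogonal to `x` has length `j / ‖x‖` by Lagrange's identity.
  refine ⟨hx, ⟨(‖x‖ / j) • y + (-(⟪x, y⟫ / (‖x‖ * j))) • x, ?_, ?_⟩, ?_⟩
  · rw [isPair_iff]
    simp only [inner_add_left, inner_add_right, inner_smul_left, inner_smul_right, hxx, hyy, hc,
      conj_trivial]
    refine ⟨by field_simp, ?_, by field_simp; ring⟩
    field_simp
    linarith
  · have := wedge_combination x y ‖x‖⁻¹ 0 (-(⟪x, y⟫ / (‖x‖ * j))) (‖x‖ / j)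
    rw [zero_smul, add_zero, add_comm ((-(⟪x, y⟫ / (‖x‖ * j))) • x)] at this
    rw [this, smul_smul]
    rw [show j * (‖x‖⁻¹ * (‖x‖ / j) - 0 * -(⟪x, y⟫ / (‖x‖ * j))) = 1 by field_simp; ring,
      one_smul]
  · rw [map_smul, toEuclideanLin_wedge, hxx, hc, smul_smul, smul_smul, smul_sub, smul_smul,
      smul_smul]
    rw [show ‖x‖⁻¹ * ‖x‖⁻¹ * ‖x‖ ^ 2 = 1 by field_simp,
      show ⟪x, y⟫ / ‖x‖ * ‖x‖⁻¹ = ‖x‖⁻¹ * ‖x‖⁻¹ * ⟪x, y⟫ by field_simp]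
    simp

lemma exists_isPair (hk : 2 ≤ k) : ∃ u v : EuclideanSpace ℝ (Fin k), IsPair u v :=
  ⟨EuclideanSpace.single ⟨0, by omega⟩ 1, EuclideanSpace.single ⟨1, by omega⟩ 1,
    by simp, by simp, by simp [EuclideanSpace.inner_single_left]⟩

lemma exists_unit_inner_eq_zero (hk : 2 ≤ k) (x : EuclideanSpace ℝ (Fin k)) :
    ∃ v : EuclideanSpace ℝ (Fin k), ‖v‖ = 1 ∧ ⟪x, v⟫ = 0 := by
  by_cases hx : x = 0
  · obtain ⟨u, v, h⟩ := exists_isPair hk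
    exact ⟨u, h.1, by simp [hx]⟩
  · obtain ⟨v, hv0, hv⟩ : ∃ v : EuclideanSpace ℝ (Fin k), v ≠ 0 ∧ ⟪x, v⟫ = 0 := by
      have hne : (ℝ ∙ x)ᗮ ≠ ⊥ := by
        intro h
        have h1 := Submodule.finrank_add_finrank_orthogonal (ℝ ∙ x)
        rw [h, finrank_bot, finrank_span_singleton hx, finrank_euclideanSpace_fin] at h1
        omega
      obtain ⟨v, hv, hv0⟩ := Submodule.exists_mem_ne_zero_of_ne_bot hne
      exact ⟨v, hv0, Submodule.mem_orthogonal_singleton_iff_inner_right.1 hv⟩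
    refine ⟨‖v‖⁻¹ • v, ?_, by rw [inner_smul_right, hv, mul_zero]⟩
    rw [norm_smul, norm_inv, norm_norm, inv_mul_cancel₀ (norm_ne_zero_iff.2 hv0)]

end Block

/-! ### Orthogonal conjugation of bivectors and the Plücker embedding -/

section Plane

variable {k : ℕ}

lemma wedge_toEuclideanLin (M : Matrix (Fin k) (Fin k) ℝ) (x y : EuclideanSpace ℝ (Fin k)) :
    wedge (Matrix.toEuclideanLin M x) (Matrix.toEuclideanLin M y) = M * wedge x y * Mᵀ := by
  have h : ∀ x y : EuclideanSpace ℝ (Fin k), wedge x y =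
      Matrix.vecMulVec (WithLp.ofLp x) (WithLp.ofLp y) -
        Matrix.vecMulVec (WithLp.ofLp y) (WithLp.ofLp x) := fun x y => by
    ext i l
    simp [wedge_apply, Matrix.vecMulVec_apply, mul_comm]
  rw [h, h, Matrix.mul_sub, Matrix.sub_mul, Matrix.mul_vecMulVec, Matrix.mul_vecMulVec,
    Matrix.vecMulVec_mul, Matrix.vecMulVec_mul, Matrix.vecMul_transpose, Matrix.vecMul_transpose]
  rfl

/-- The pair extends to an orthonormal basis, and the matrix with these columns carries the standard
bivector to `wedge u v`. -/
lemma IsPair.exists_orthogonal {u v : EuclideanSpace ℝ (Fin k)} (h : IsPair u v) (hk : 2 ≤ k) :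
    ∃ P ∈ Matrix.orthogonalGroup (Fin k) ℝ,
      wedge u v = P * wedge (EuclideanSpace.single ⟨0, by omega⟩ 1)
        (EuclideanSpace.single ⟨1, by omega⟩ 1) * Pᵀ := by
  set i0 : Fin k := ⟨0, by omega⟩ with hi0
  set i1 : Fin k := ⟨1, by omega⟩ with hi1
  have h01 : i0 ≠ i1 := by simp [hi0, hi1]
  obtain ⟨B, hB⟩ := Orthonormal.exists_orthonormalBasis_extension_of_card_eq (𝕜 := ℝ)
    (E := EuclideanSpace ℝ (Fin k)) (ι := Fin k) (by simp)
    (v := fun i => if i = i0 then u else v) (s := {i0, i1}) (by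
      obtain ⟨h1, h2, h3, h4⟩ := h.inner_self
      rw [orthonormal_iff_ite]
      rintro ⟨i, rfl | rfl⟩ ⟨l, rfl | rfl⟩ <;>
      simp [Subtype.ext_iff, h01, h01.symm, h.1, h.2.1, h3, h4])
  have hu : B i0 = u := by rw [hB i0 (by simp), if_pos rfl]
  have hv : B i1 = v := by rw [hB i1 (by simp), if_neg h01.symm]
  let P : Matrix (Fin k) (Fin k) ℝ := Matrix.of fun i l => B l i
  have hP : ∀ i, Matrix.toEuclideanLin P (EuclideanSpace.single i 1) = B i := fun i => by
    ext l
    simp [Matrix.toLpLin_apply, P]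
  refine ⟨P, ?_, ?_⟩
  · rw [Matrix.mem_orthogonalGroup_iff']
    ext i l
    have := orthonormal_iff_ite.1 B.orthonormal i l
    simpa [Matrix.star_eq_conjTranspose, Matrix.mul_apply, P, Matrix.one_apply,
      PiLp.inner_apply, mul_comm] using this
  · rw [← wedge_toEuclideanLin, hP, hP, hu, hv]

lemma IsPair.exists_conj {u v u' v' : EuclideanSpace ℝ (Fin k)} (h : IsPair u v)
    (h' : IsPair u' v') (hk : 2 ≤ k) :
    ∃ g : Matrix.orthogonalGroup (Fin k) ℝ, wedge u' v' = g.1 * wedge u v * g.1ᵀ := by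
  obtain ⟨P, hP, e⟩ := h.exists_orthogonal hk
  obtain ⟨P', hP', e'⟩ := h'.exists_orthogonal hk
  refine ⟨⟨P', hP'⟩ * (⟨P, hP⟩)⁻¹, ?_⟩
  have hP2 : Pᵀ * P = 1 := (Matrix.mem_orthogonalGroup_iff' _ _).1 hP
  have hv : ((⟨P', hP'⟩ * (⟨P, hP⟩)⁻¹ : Matrix.orthogonalGroup (Fin k) ℝ)).1 = P' * Pᵀ := by
    rw [Submonoid.coe_mul]
    rfl
  rw [e, e', hv, Matrix.transpose_mul, Matrix.transpose_transpose]
  generalize wedge (k := k) _ _ = E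
  calc P' * E * P'ᵀ = P' * (Pᵀ * P) * E * (Pᵀ * P) * P'ᵀ := by rw [hP2]; simp
    _ = P' * Pᵀ * (P * E * Pᵀ) * (P * P'ᵀ) := by simp only [Matrix.mul_assoc]

lemma upperSq_conj {A : Matrix (Fin k) (Fin k) ℝ} (hA : Aᵀ = -A)
    (g : Matrix.orthogonalGroup (Fin k) ℝ) : upperSq (g.1 * A * g.1ᵀ) = upperSq A := by
  have hg : g.1ᵀ * g.1 = 1 := (Matrix.mem_orthogonalGroup_iff' _ _).1 g.2
  have hs : (g.1 * A * g.1ᵀ)ᵀ = -(g.1 * A * g.1ᵀ) := by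
    simp [Matrix.transpose_mul, hA, Matrix.mul_assoc]
  have h1 := two_mul_upperSq hs
  have h2 := two_mul_upperSq hA
  have h3 : ((g.1 * A * g.1ᵀ)ᵀ * (g.1 * A * g.1ᵀ)).trace = (Aᵀ * A).trace := by
    have : (g.1 * A * g.1ᵀ)ᵀ * (g.1 * A * g.1ᵀ) = g.1 * (Aᵀ * (g.1ᵀ * g.1) * A * g.1ᵀ) := by
      simp only [Matrix.transpose_mul, Matrix.transpose_transpose, Matrix.mul_assoc]
    rw [this, hg, Matrix.trace_mul_comm, Matrix.mul_one, Matrix.mul_assoc, hg, Matrix.mul_one]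
  linarith

/-- In an oriented orthonormal basis the area form is a determinant, and the coordinates of the
projected `e_i` are the `i`-th entries of the basis vectors. -/
lemma OrientedPlane.bivector_eq_wedge (P : OrientedPlane k) (e : OrthonormalBasis (Fin 2) ℝ P.plane)
    (he : e.toBasis.orientation = P.orientation) :
    P.bivector = wedge (e 0 : EuclideanSpace ℝ (Fin k)) (e 1) := by
  have : Fact (Module.finrank ℝ P.plane = 2) := ⟨P.finrank_eq⟩
  have hc : ∀ (a : Fin 2) (i : Fin k), ⟪e a, P.plane.orthogonalProjectionOnto
      (EuclideanSpace.single i 1)⟫ = (e a : EuclideanSpace ℝ (Fin k)) i := fun a i => by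
    rw [Submodule.inner_orthogonalProjectionOnto_eq_of_mem_left]
    simp [EuclideanSpace.inner_single_right]
  ext i l
  rw [OrientedPlane.bivector, Matrix.of_apply, Orientation.areaForm_to_volumeForm,
    P.orientation.volumeForm_robust e he, Module.Basis.det_apply, Matrix.det_fin_two]
  simp only [Module.Basis.toMatrix_apply, OrthonormalBasis.coe_toBasis_repr_apply,
    OrthonormalBasis.repr_apply_apply, Matrix.cons_val_zero, Matrix.cons_val_one, hc, wedge_apply]

lemma OrientedPlane.exists_basis (P : OrientedPlane k) :
    ∃ e : OrthonormalBasis (Fin 2) ℝ P.plane, P.bivector = wedge (e 0 : EuclideanSpace ℝ (Fin k)) (e 1) ∧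
      IsPair (e 0 : EuclideanSpace ℝ (Fin k)) (e 1) :=
  ⟨P.orientation.finOrthonormalBasis two_pos P.finrank_eq,
    P.bivector_eq_wedge _ (Orientation.finOrthonormalBasis_orientation _ _ _),
    OrthonormalBasis.norm_eq_one (𝕜 := ℝ) (E := P.plane) _ 0,
    OrthonormalBasis.norm_eq_one (𝕜 := ℝ) (E := P.plane) _ 1,
    OrthonormalBasis.inner_eq_zero (𝕜 := ℝ) (E := P.plane) _ zero_ne_one⟩

lemma IsPair.exists_orientedPlane {u v : EuclideanSpace ℝ (Fin k)} (h : IsPair u v) :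
    ∃ P : OrientedPlane k, P.bivector = wedge u v := by
  obtain ⟨h1, h2, h3, h4⟩ := h.inner_self
  have ho : Orthonormal ℝ ![u, v] := by
    rw [orthonormal_iff_ite]
    intro i l
    fin_cases i <;> fin_cases l <;> simp [h.1, h.2.1, h3, h4]
  let b := Module.Basis.span ho.linearIndependent
  have hb : ∀ i, (b i : EuclideanSpace ℝ (Fin k)) = ![u, v] i :=
    fun i => by rw [Module.Basis.span_apply]
  have hob : Orthonormal ℝ b := by
    rw [orthonormal_iff_ite] at ho ⊢
    intro i l
    rw [← ho i l, ← hb, ← hb]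
    rfl
  let e := b.toOrthonormalBasis hob
  have hee : ∀ i, e i = b i := fun i => by simp [e]
  let P : OrientedPlane k := ⟨_, by rw [Module.finrank_eq_card_basis b]; rfl,
    e.toBasis.orientation⟩
  refine ⟨P, ?_⟩
  rw [P.bivector_eq_wedge e rfl, hee, hee, hb, hb]
  rfl

/-- The plane is the range of its bivector viewed as an operator. -/
lemma OrientedPlane.plane_le_of_bivector_eq {P Q : OrientedPlane k}
    (h : P.bivector = Q.bivector) : P.plane ≤ Q.plane := by
  obtain ⟨e, he, hp⟩ := P.exists_basis
  obtain ⟨f, hf, -⟩ := Q.exists_basis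
  have hmem : ∀ w, Matrix.toEuclideanLin P.bivector w ∈ Q.plane := fun w => by
    rw [h, hf, toEuclideanLin_wedge]
    exact Q.plane.sub_mem (Q.plane.smul_mem _ (f 0).2) (Q.plane.smul_mem _ (f 1).2)
  obtain ⟨h1, h2, h3, h4⟩ := hp.inner_self
  have h0 : (e 0 : EuclideanSpace ℝ (Fin k)) ∈ Q.plane := by
    have := hmem (e 1)
    rwa [he, toEuclideanLin_wedge, h2, h3, one_smul, zero_smul, sub_zero] at this
  have h0' : (e 1 : EuclideanSpace ℝ (Fin k)) ∈ Q.plane := by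
    have := hmem (e 0)
    rwa [he, toEuclideanLin_wedge, h1, h4, one_smul, zero_smul, zero_sub, Q.plane.neg_mem_iff]
      at this
  intro x hx
  have hs := e.sum_repr ⟨x, hx⟩
  rw [Fin.sum_univ_two] at hs
  have hx2 : x = e.repr ⟨x, hx⟩ 0 • (e 0 : EuclideanSpace ℝ (Fin k)) +
      e.repr ⟨x, hx⟩ 1 • (e 1 : EuclideanSpace ℝ (Fin k)) := (congrArg Subtype.val hs).symm
  rw [hx2]
  exact Q.plane.add_mem (Q.plane.smul_mem _ h0) (Q.plane.smul_mem _ h0')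

/-- The plane is determined as a range. Reversing the orientation changes the sign of the bivector,
which is not zero. -/
lemma OrientedPlane.bivector_injective :
    Function.Injective (OrientedPlane.bivector : OrientedPlane k → _) := by
  intro P Q h
  have hpl : P.plane = Q.plane :=
    le_antisymm (plane_le_of_bivector_eq h) (plane_le_of_bivector_eq h.symm)
  obtain ⟨p, hp, o⟩ := P
  obtain ⟨q, hq, o'⟩ := Q
  obtain rfl : p = q := hpl
  have hoo : o = o' ∨ o = -o' := o.eq_or_eq_neg o' (by rw [hp]; rfl)
  rcases hoo with rfl | rfl
  · rfl
  · exfalso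
    have : Fact (Module.finrank ℝ p = 2) := ⟨hp⟩
    have hneg : (⟨p, hp, -o'⟩ : OrientedPlane k).bivector =
        -(⟨p, hq, o'⟩ : OrientedPlane k).bivector := by
      ext i l
      simp [OrientedPlane.bivector, Orientation.areaForm_neg_orientation]
    rw [hneg] at h
    obtain ⟨e, he, hpair⟩ := (⟨p, hq, o'⟩ : OrientedPlane k).exists_basis
    have h0 : (⟨p, hq, o'⟩ : OrientedPlane k).bivector = 0 := by
      ext i l
      have := congrFun (congrFun h i) l
      simp only [Matrix.neg_apply] at this
      simp only [Matrix.zero_apply]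
      linarith
    have h1 := hpair.upperSq
    rw [← he, h0] at h1
    simp [upperSq] at h1

end Plane

/-! ### Calculus of smooth maps on arbitrary subsets -/

section SmoothOn

variable {E E' E'' : Type*}
  [NormedAddCommGroup E] [NormedSpace ℝ E]
  [NormedAddCommGroup E'] [NormedSpace ℝ E']
  [NormedAddCommGroup E''] [NormedSpace ℝ E'']

lemma ContDiffOn.isSmoothOn {f : E → E'} {S U : Set E} (hf : ContDiffOn ℝ ∞ f U) (hU : IsOpen U)
    (hS : S ⊆ U) : IsSmoothOn f S :=
  fun _ hp => ⟨U, f, hU, hS hp, hf, fun _ _ => rfl⟩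

lemma ContDiff.isSmoothOn {f : E → E'} (hf : ContDiff ℝ ∞ f) (S : Set E) : IsSmoothOn f S :=
  ContDiffOn.isSmoothOn hf.contDiffOn isOpen_univ (Set.subset_univ S)

lemma IsSmoothOn.comp {g : E' → E''} {f : E → E'} {S : Set E} {T : Set E'}
    (hg : IsSmoothOn g T) (hf : IsSmoothOn f S) (hST : Set.MapsTo f S T) :
    IsSmoothOn (fun p => g (f p)) S := by
  intro p hp
  obtain ⟨U, f', hU, hpU, hf', hff'⟩ := hf p hp
  obtain ⟨V, g', hV, hpV, hg', hgg'⟩ := hg (f p) (hST hp)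
  refine ⟨U ∩ f' ⁻¹' V, fun q => g' (f' q), hf'.continuousOn.isOpen_inter_preimage hU hV,
    ⟨hpU, ?_⟩, hg'.comp (hf'.mono Set.inter_subset_left) fun q hq => hq.2, ?_⟩
  · rw [Set.mem_preimage, ← hff' ⟨hp, hpU⟩]; exact hpV
  · rintro q ⟨hqS, hqU, hqV⟩
    have e := hff' ⟨hqS, hqU⟩
    rw [Set.mem_preimage, ← e] at hqV
    dsimp only
    rw [← e]
    exact hgg' ⟨hST hqS, hqV⟩

lemma IsSmoothOn.prodMk {f : E → E'} {g : E → E''} {S : Set E} (hf : IsSmoothOn f S)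
    (hg : IsSmoothOn g S) : IsSmoothOn (fun p => (f p, g p)) S := by
  intro p hp
  obtain ⟨U, f', hU, hpU, hf', hff'⟩ := hf p hp
  obtain ⟨V, g', hV, hpV, hg', hgg'⟩ := hg p hp
  refine ⟨U ∩ V, fun q => (f' q, g' q), hU.inter hV, ⟨hpU, hpV⟩,
    (hf'.mono Set.inter_subset_left).prodMk (hg'.mono Set.inter_subset_right), ?_⟩
  rintro q ⟨hqS, hqU, hqV⟩
  exact Prod.ext (hff' ⟨hqS, hqU⟩) (hgg' ⟨hqS, hqV⟩)

lemma isSmoothOn_const (c : E') (S : Set E) : IsSmoothOn (fun _ => c) S :=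
  ContDiff.isSmoothOn contDiff_const S

lemma isSmoothOn_fst (S : Set (E × E')) : IsSmoothOn (fun q : E × E' => q.1) S :=
  ContDiff.isSmoothOn contDiff_fst S

lemma isSmoothOn_snd (S : Set (E × E')) : IsSmoothOn (fun q : E × E' => q.2) S :=
  ContDiff.isSmoothOn contDiff_snd S

end SmoothOn

/-! ### The coordinates (reduction, momentum, directions) and their smoothness -/

section Coordinates

variable {ℓ : ℕ} {m : Fin (ℓ + 1) → ℕ}

/-- Families of vectors, one in each block of a multiple eigenvalue. -/
abbrev Directions (m : Fin (ℓ + 1) → ℕ) : Type := ∀ τ : Mult m, EuclideanSpace ℝ (Fin (m τ.1))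

/-- The family of the unit vectors `x_τ / ‖x_τ‖`. -/
noncomputable def directions (p : Phase m) : Directions m := fun τ => ‖p.1 τ.1‖⁻¹ • p.1 τ.1

/-- The point of phase space with reduction `z`, momentum `ν` and directions `u`. -/
noncomputable def reconstruct (z : ReducedPhase ℓ) (ν : Momentum m) (u : Directions m) : Phase m :=
  (fun σ => if h : 2 ≤ m σ then z.1 σ • u ⟨σ, h⟩ else WithLp.toLp 2 fun _ => z.1 σ,
    fun σ => if h : 2 ≤ m σ then
      z.2 σ • u ⟨σ, h⟩ - (z.1 σ)⁻¹ • Matrix.toEuclideanLin (ν ⟨σ, h⟩) (u ⟨σ, h⟩)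
      else WithLp.toLp 2 fun _ => z.2 σ)

/-- The torus acts on the choices of unit vectors in the planes of `ν`; `angles` is the inverse of
its orbit map. -/
noncomputable def rotations (j : Mult m → ℝ) (ν : Momentum m) (u : Directions m) (t : Mult m → ℂ) :
    Directions m := fun τ => rotate (j τ) (ν τ) (u τ) (t τ)

noncomputable def angles (j : Mult m → ℝ) (ν : Momentum m) (u u' : Directions m) : Mult m → ℂ :=
  fun τ => angle (j τ) (ν τ) (u τ) (u' τ)

/-- The reference vectors `w` stay fixed while `ν` varies, which gives a unit vector in each plane
depending smoothly on `ν` as long as no `w_τ` is orthogonal to its plane. -/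
noncomputable def localSection (w : Directions m) (ν : Momentum m) : Directions m :=
  fun τ => ‖Matrix.toEuclideanLin (ν τ) (w τ)‖⁻¹ • Matrix.toEuclideanLin (ν τ) (w τ)

lemma contDiff_toEuclideanLin {E : Type*} [NormedAddCommGroup E] [NormedSpace ℝ E] {k : ℕ}
    {A : E → Matrix (Fin k) (Fin k) ℝ} {u : E → EuclideanSpace ℝ (Fin k)}
    (hA : ContDiff ℝ ∞ A) (hu : ContDiff ℝ ∞ u) :
    ContDiff ℝ ∞ fun q => Matrix.toEuclideanLin (A q) (u q) := by
  rw [contDiff_euclidean] at hu ⊢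
  intro i
  simp only [Matrix.toLpLin_apply, Matrix.mulVec, dotProduct]
  refine ContDiff.sum fun l _ => ContDiff.mul ?_ (hu l)
  exact contDiff_pi.1 (contDiff_pi.1 hA i) l

lemma contDiff_momentum : ContDiff ℝ ∞ (momentum : Phase m → Momentum m) := by
  refine contDiff_pi.2 fun τ => contDiff_pi.2 fun i => contDiff_pi.2 fun k => ?_
  have h1 : ∀ i, ContDiff ℝ ∞ fun p : Phase m => p.1 τ.1 i := fun i =>
    contDiff_euclidean.1 (contDiff_pi.1 contDiff_fst τ.1) i
  have h2 : ∀ i, ContDiff ℝ ∞ fun p : Phase m => p.2 τ.1 i := fun i =>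
    contDiff_euclidean.1 (contDiff_pi.1 contDiff_snd τ.1) i
  exact ((h1 i).mul (h2 k)).sub ((h1 k).mul (h2 i))

/-- The open set of the points at which the reduction mapping is smooth. -/
def regularSet (m : Fin (ℓ + 1) → ℕ) : Set (Phase m) := {p | ∀ τ : Mult m, p.1 τ.1 ≠ 0}

lemma isOpen_regularSet : IsOpen (regularSet m) := by
  rw [regularSet, Set.ofPred_forall]
  exact isOpen_iInter_of_finite fun τ => isOpen_ne_fun (by fun_prop) (by fun_prop)

lemma contDiffOn_reduction : ContDiffOn ℝ ∞ (reduction : Phase m → ReducedPhase ℓ)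
    (regularSet m) := by
  refine ContDiffOn.prodMk (contDiffOn_pi.2 fun σ => ?_) (contDiffOn_pi.2 fun σ => ?_)
  · by_cases h : 2 ≤ m σ
    · simp only [if_pos h]
      exact ContDiffOn.norm ℝ (contDiff_pi.1 contDiff_fst σ).contDiffOn fun p hp => hp ⟨σ, h⟩
    · simp only [if_neg h]
      exact (ContDiff.sum fun i _ =>
        contDiff_euclidean.1 (contDiff_pi.1 contDiff_fst σ) i).contDiffOn
  · by_cases h : 2 ≤ m σ
    · simp only [if_pos h]
      refine ContDiffOn.div (ContDiff.inner ℝ (contDiff_pi.1 contDiff_fst σ)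
        (contDiff_pi.1 contDiff_snd σ)).contDiffOn ?_ fun p hp => norm_ne_zero_iff.2 (hp ⟨σ, h⟩)
      exact ContDiffOn.norm ℝ (contDiff_pi.1 contDiff_fst σ).contDiffOn fun p hp => hp ⟨σ, h⟩
    · simp only [if_neg h]
      exact (ContDiff.sum fun i _ =>
        contDiff_euclidean.1 (contDiff_pi.1 contDiff_snd σ) i).contDiffOn

lemma contDiffOn_directions : ContDiffOn ℝ ∞ (directions : Phase m → Directions m)
    (regularSet m) := by
  refine contDiffOn_pi.2 fun τ => ?_
  have h : ContDiffOn ℝ ∞ (fun p : Phase m => p.1 τ.1) (regularSet m) :=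
    (contDiff_pi.1 contDiff_fst τ.1).contDiffOn
  exact ((ContDiffOn.norm ℝ h fun p hp => hp τ).inv fun p hp => norm_ne_zero_iff.2 (hp τ)).smul h

variable {E : Type*} [NormedAddCommGroup E] [NormedSpace ℝ E] {S : Set E}

lemma IsSmoothOn.reduction {f : E → Phase m} (hf : IsSmoothOn f S)
    (h : ∀ p ∈ S, f p ∈ regularSet m) :
    IsSmoothOn (fun p => DegenerateNeumann.reduction (f p)) S :=
  (ContDiffOn.isSmoothOn contDiffOn_reduction isOpen_regularSet subset_rfl).comp hf h

lemma IsSmoothOn.directions {f : E → Phase m} (hf : IsSmoothOn f S)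
    (h : ∀ p ∈ S, f p ∈ regularSet m) :
    IsSmoothOn (fun p => DegenerateNeumann.directions (f p)) S :=
  (ContDiffOn.isSmoothOn contDiffOn_directions isOpen_regularSet subset_rfl).comp hf h

lemma IsSmoothOn.momentum {f : E → Phase m} (hf : IsSmoothOn f S) :
    IsSmoothOn (fun p => DegenerateNeumann.momentum (f p)) S :=
  (ContDiff.isSmoothOn contDiff_momentum Set.univ).comp hf fun _ _ => Set.mem_univ _

lemma IsSmoothOn.reconstruct {z : E → ReducedPhase ℓ} {ν : E → Momentum m} {u : E → Directions m}
    (hz : IsSmoothOn z S) (hν : IsSmoothOn ν S) (hu : IsSmoothOn u S)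
    (h : ∀ p ∈ S, ∀ τ : Mult m, (z p).1 τ.1 ≠ 0) :
    IsSmoothOn (fun p => DegenerateNeumann.reconstruct (z p) (ν p) (u p)) S := by
  let U : Set (ReducedPhase ℓ × Momentum m × Directions m) := {q | ∀ τ : Mult m, q.1.1 τ.1 ≠ 0}
  have hU : IsOpen U := by
    simp only [U, Set.ofPred_forall]
    exact isOpen_iInter_of_finite fun τ => isOpen_ne_fun (by fun_prop) (by fun_prop)
  have hξ : ∀ σ, ContDiff ℝ ∞ fun q : ReducedPhase ℓ × Momentum m × Directions m => q.1.1 σ :=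
    fun σ => contDiff_pi.1 (contDiff_fst.comp contDiff_fst) σ
  have hη : ∀ σ, ContDiff ℝ ∞ fun q : ReducedPhase ℓ × Momentum m × Directions m => q.1.2 σ :=
    fun σ => contDiff_pi.1 (contDiff_snd.comp contDiff_fst) σ
  have hν' : ∀ τ, ContDiff ℝ ∞ fun q : ReducedPhase ℓ × Momentum m × Directions m => q.2.1 τ :=
    fun τ => contDiff_pi.1 (contDiff_fst.comp contDiff_snd) τ
  have hu' : ∀ τ, ContDiff ℝ ∞ fun q : ReducedPhase ℓ × Momentum m × Directions m => q.2.2 τ :=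
    fun τ => contDiff_pi.1 (contDiff_snd.comp contDiff_snd) τ
  have hc : ContDiffOn ℝ ∞ (fun q : ReducedPhase ℓ × Momentum m × Directions m =>
      DegenerateNeumann.reconstruct q.1 q.2.1 q.2.2) U := by
    refine ContDiffOn.prodMk (contDiffOn_pi.2 fun σ => ?_) (contDiffOn_pi.2 fun σ => ?_)
    · by_cases h : 2 ≤ m σ
      · simp only [dif_pos h]
        exact ((hξ σ).smul (hu' ⟨σ, h⟩)).contDiffOn
      · simp only [dif_neg h]
        exact (contDiff_euclidean.2 fun i => hξ σ).contDiffOn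
    · by_cases h : 2 ≤ m σ
      · simp only [dif_pos h]
        exact ((hη σ).smul (hu' ⟨σ, h⟩)).contDiffOn.sub
          (((hξ σ).contDiffOn.inv fun q (hq : q ∈ U) => hq ⟨σ, h⟩).smul
            (contDiff_toEuclideanLin (hν' ⟨σ, h⟩) (hu' ⟨σ, h⟩)).contDiffOn)
      · simp only [dif_neg h]
        exact (contDiff_euclidean.2 fun i => hη σ).contDiffOn
  exact (ContDiffOn.isSmoothOn hc hU subset_rfl).comp (hz.prodMk (hν.prodMk hu)) h

lemma IsSmoothOn.rotations {j : Mult m → ℝ} {ν : E → Momentum m} {u : E → Directions m}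
    {t : E → Mult m → ℂ} (hν : IsSmoothOn ν S) (hu : IsSmoothOn u S) (ht : IsSmoothOn t S) :
    IsSmoothOn (fun p => DegenerateNeumann.rotations j (ν p) (u p) (t p)) S := by
  have hc : ContDiff ℝ ∞ (fun q : Momentum m × Directions m × (Mult m → ℂ) =>
      DegenerateNeumann.rotations j q.1 q.2.1 q.2.2) := by
    refine contDiff_pi.2 fun τ => ?_
    have h1 : ContDiff ℝ ∞ fun q : Momentum m × Directions m × (Mult m → ℂ) => q.1 τ :=
      contDiff_pi.1 contDiff_fst τ
    have h2 : ContDiff ℝ ∞ fun q : Momentum m × Directions m × (Mult m → ℂ) => q.2.1 τ :=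
      contDiff_pi.1 (contDiff_fst.comp contDiff_snd) τ
    have h3 : ContDiff ℝ ∞ fun q : Momentum m × Directions m × (Mult m → ℂ) => q.2.2 τ :=
      contDiff_pi.1 (contDiff_snd.comp contDiff_snd) τ
    exact ((Complex.reCLM.contDiff.comp h3).smul h2).sub
      (((Complex.imCLM.contDiff.comp h3).div_const _).smul (contDiff_toEuclideanLin h1 h2))
  exact (ContDiff.isSmoothOn hc Set.univ).comp (hν.prodMk (hu.prodMk ht)) fun _ _ => Set.mem_univ _

lemma IsSmoothOn.angles {j : Mult m → ℝ} {ν : E → Momentum m} {u u' : E → Directions m}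
    (hν : IsSmoothOn ν S) (hu : IsSmoothOn u S) (hu' : IsSmoothOn u' S) :
    IsSmoothOn (fun p => DegenerateNeumann.angles j (ν p) (u p) (u' p)) S := by
  have hc : ContDiff ℝ ∞ (fun q : Momentum m × Directions m × Directions m =>
      DegenerateNeumann.angles j q.1 q.2.1 q.2.2) := by
    refine contDiff_pi.2 fun τ => ?_
    have h1 : ContDiff ℝ ∞ fun q : Momentum m × Directions m × Directions m => q.1 τ :=
      contDiff_pi.1 contDiff_fst τ
    have h2 : ContDiff ℝ ∞ fun q : Momentum m × Directions m × Directions m => q.2.1 τ :=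
      contDiff_pi.1 (contDiff_fst.comp contDiff_snd) τ
    have h3 : ContDiff ℝ ∞ fun q : Momentum m × Directions m × Directions m => q.2.2 τ :=
      contDiff_pi.1 (contDiff_snd.comp contDiff_snd) τ
    have hab : ContDiff ℝ ∞ fun q : Momentum m × Directions m × Directions m =>
        (⟪q.2.1 τ, q.2.2 τ⟫,
          -⟪Matrix.toEuclideanLin (q.1 τ) (q.2.1 τ), q.2.2 τ⟫ / j τ) :=
      (h2.inner ℝ h3).prodMk
        (((contDiff_toEuclideanLin h1 h2).inner ℝ h3).neg.div_const _)
    exact Complex.equivRealProdCLM.symm.contDiff.comp hab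
  exact (ContDiff.isSmoothOn hc Set.univ).comp (hν.prodMk (hu.prodMk hu')) fun _ _ => Set.mem_univ _

/-- The domain of the local section. -/
def sectionDomain (w : Directions m) : Set (Momentum m) :=
  {ν | ∀ τ, Matrix.toEuclideanLin (ν τ) (w τ) ≠ 0}

lemma contDiff_apply_direction (w : Directions m) (τ : Mult m) :
    ContDiff ℝ ∞ fun ν : Momentum m => Matrix.toEuclideanLin (ν τ) (w τ) :=
  contDiff_toEuclideanLin (contDiff_pi.1 contDiff_id τ) contDiff_const

lemma isOpen_sectionDomain (w : Directions m) : IsOpen (sectionDomain w) := by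
  rw [sectionDomain, Set.ofPred_forall]
  exact isOpen_iInter_of_finite fun τ =>
    isOpen_ne_fun (contDiff_apply_direction w τ).continuous continuous_const

lemma IsSmoothOn.localSection (w : Directions m) {ν : E → Momentum m} (hν : IsSmoothOn ν S)
    (h : ∀ p ∈ S, ν p ∈ sectionDomain w) :
    IsSmoothOn (fun p => DegenerateNeumann.localSection w (ν p)) S := by
  have hc : ContDiffOn ℝ ∞ (DegenerateNeumann.localSection w) (sectionDomain w) := by
    refine contDiffOn_pi.2 fun τ => ?_
    have h := (contDiff_apply_direction w τ).contDiffOn (s := sectionDomain w)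
    exact ((ContDiffOn.norm ℝ h fun ν hν => hν τ).inv fun ν hν => norm_ne_zero_iff.2 (hν τ)).smul h
  exact (ContDiffOn.isSmoothOn hc (isOpen_sectionDomain w) subset_rfl).comp hν h

end Coordinates

/-! ### Phase points as triples, and the fibre in these coordinates -/

section Reconstruction

lemma toLp_sum_of_eq_one {k : ℕ} (hk : k = 1) (x : EuclideanSpace ℝ (Fin k)) :
    (WithLp.toLp 2 fun _ => ∑ i, x i : EuclideanSpace ℝ (Fin k)) = x := by
  subst hk
  ext i
  simp [Subsingleton.elim i 0]

lemma inner_of_eq_one {k : ℕ} (hk : k = 1) (x y : EuclideanSpace ℝ (Fin k)) :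
    ⟪x, y⟫ = (∑ i, x i) * ∑ i, y i := by
  subst hk
  simp [PiLp.inner_apply, mul_comm]

variable {ℓ : ℕ} {m : Fin (ℓ + 1) → ℕ}

lemma eq_one_of_not_two_le (hm : ∀ σ, 1 ≤ m σ) {σ : Fin (ℓ + 1)} (h : ¬ 2 ≤ m σ) : m σ = 1 := by
  have := hm σ
  omega

lemma momentum_eq_wedge (p : Phase m) (τ : Mult m) :
    momentum p τ = wedge (p.1 τ.1) (p.2 τ.1) := rfl

lemma totalMomentum_sq (p : Phase m) (τ : Mult m) :
    totalMomentum p τ ^ 2 = upperSq (momentum p τ) := Real.sq_sqrt (upperSq_nonneg _)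

lemma totalMomentum_nonneg (p : Phase m) (τ : Mult m) : 0 ≤ totalMomentum p τ :=
  Real.sqrt_nonneg _

lemma totalMomentum_eq_iff {p : Phase m} {τ : Mult m} {c : ℝ} (hc : 0 ≤ c) :
    totalMomentum p τ = c ↔ upperSq (momentum p τ) = c ^ 2 := by
  rw [← totalMomentum_sq, sq_eq_sq₀ (totalMomentum_nonneg p τ) hc]

lemma isFrame_directions {p : Phase m} (h : ∀ τ, 0 < totalMomentum p τ) (τ : Mult m) :
    IsFrame (totalMomentum p τ) (momentum p τ) (directions p τ) :=
  (wedge_isFrame (h τ) (totalMomentum_sq p τ).symm).2.1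

lemma mem_regularSet {p : Phase m} (h : ∀ τ, 0 < totalMomentum p τ) : p ∈ regularSet m :=
  fun τ => (wedge_isFrame (h τ) (totalMomentum_sq p τ).symm).1

lemma reconstruct_reduction (hm : ∀ σ, 1 ≤ m σ) {p : Phase m} (h : ∀ τ, 0 < totalMomentum p τ) :
    reconstruct (reduction p) (momentum p) (directions p) = p := by
  refine Prod.ext (funext fun σ => ?_) (funext fun σ => ?_)
  · by_cases hσ : 2 ≤ m σ
    · have h0 : ‖p.1 σ‖ ≠ 0 := norm_ne_zero_iff.2 (mem_regularSet h ⟨σ, hσ⟩)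
      simp only [reconstruct, reduction, dif_pos hσ, if_pos hσ, directions, smul_smul,
        mul_inv_cancel₀ h0, one_smul]
    · simp only [reconstruct, reduction, dif_neg hσ, if_neg hσ]
      exact toLp_sum_of_eq_one (eq_one_of_not_two_le hm hσ) _
  · by_cases hσ : 2 ≤ m σ
    · simp only [reconstruct, reduction, dif_pos hσ, if_pos hσ]
      exact (wedge_isFrame (h ⟨σ, hσ⟩) (totalMomentum_sq p ⟨σ, hσ⟩).symm).2.2
    · simp only [reconstruct, reduction, dif_neg hσ, if_neg hσ]
      exact toLp_sum_of_eq_one (eq_one_of_not_two_le hm hσ) _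

/-- `u` consists of unit vectors in the planes of the momenta `ν`, which have norms `j`. -/
def IsFrameFamily (j : Mult m → ℝ) (ν : Momentum m) (u : Directions m) : Prop :=
  ∀ τ, IsFrame (j τ) (ν τ) (u τ)

section

variable {j : Mult m → ℝ} {z : ReducedPhase ℓ} {ν : Momentum m} {u : Directions m}

lemma momentum_reconstruct (hz : ∀ τ : Mult m, 0 < z.1 τ.1) (hu : IsFrameFamily j ν u) :
    momentum (reconstruct z ν u) = ν := by
  funext τ
  have hτ : 2 ≤ m τ.1 := τ.2
  rw [momentum_eq_wedge]
  simp only [reconstruct, dif_pos hτ]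
  exact (hu τ).wedge_toEuclideanLin (hz τ).ne' _

lemma directions_reconstruct (hz : ∀ τ : Mult m, 0 < z.1 τ.1) (hu : IsFrameFamily j ν u) :
    directions (reconstruct z ν u) = u := by
  funext τ
  have hτ : 2 ≤ m τ.1 := τ.2
  obtain ⟨v, hv, -⟩ := hu τ
  simp only [directions, reconstruct, dif_pos hτ, norm_smul, hv.1, mul_one, Real.norm_eq_abs,
    abs_of_pos (hz τ), smul_smul, inv_mul_cancel₀ (hz τ).ne', one_smul]

lemma reduction_reconstruct (hm : ∀ σ, 1 ≤ m σ) (hz : ∀ τ : Mult m, 0 < z.1 τ.1)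
    (hu : IsFrameFamily j ν u) : reduction (reconstruct z ν u) = z := by
  refine Prod.ext (funext fun σ => ?_) (funext fun σ => ?_)
  · by_cases hσ : 2 ≤ m σ
    · obtain ⟨v, hv, -⟩ := hu ⟨σ, hσ⟩
      simp only [reconstruct, reduction, dif_pos hσ, if_pos hσ, norm_smul, hv.1, mul_one,
        Real.norm_eq_abs]
      exact abs_of_pos (hz ⟨σ, hσ⟩)
    · simp [reconstruct, reduction, eq_one_of_not_two_le hm hσ]
  · by_cases hσ : 2 ≤ m σ
    · obtain ⟨v, hv, hν⟩ := hu ⟨σ, hσ⟩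
      have h0 := hz ⟨σ, hσ⟩
      dsimp only at h0
      simp only [reconstruct, reduction, dif_pos hσ, if_pos hσ, norm_smul, hv.1, mul_one,
        Real.norm_eq_abs, abs_of_pos h0, IsFrame.toEuclideanLin_self hv hν, inner_sub_right,
        inner_smul_left, inner_smul_right, inner_neg_right, hv.inner_self.1, hv.2.2, conj_trivial]
      field_simp
      ring
    · simp [reconstruct, reduction, eq_one_of_not_two_le hm hσ]

lemma totalMomentum_eq_of_isFrameFamily (hj : ∀ τ, 0 < j τ) {p : Phase m}
    (hu : IsFrameFamily j (momentum p) u) : totalMomentum p = j :=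
  funext fun τ => (totalMomentum_eq_iff (hj τ).le).2 (hu τ).upperSq

lemma exists_isFrameFamily (j : Mult m → ℝ) :
    ∃ (ν : Momentum m) (u : Directions m), IsFrameFamily j ν u := by
  choose u v h using fun τ : Mult m => exists_isPair τ.2
  exact ⟨fun τ => j τ • wedge (u τ) (v τ), u, fun τ => ⟨v τ, h τ, rfl⟩⟩

/-- This replaces oriented planes by frames; the bundle constructions use only the latter. -/
lemma mem_range_scaledPlucker {j : Mult m → ℝ} {ν : Momentum m} :
    ν ∈ Set.range (scaledPlucker j) ↔ ∃ u, IsFrameFamily j ν u := by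
  constructor
  · rintro ⟨P, rfl⟩
    choose e he hp using fun τ => (P τ).exists_basis
    exact ⟨fun τ => e τ 0, fun τ => ⟨e τ 1, hp τ, by rw [scaledPlucker, he]⟩⟩
  · rintro ⟨u, hu⟩
    choose v hv hν using hu
    choose P hP using fun τ => (hv τ).exists_orientedPlane
    exact ⟨P, funext fun τ => by rw [scaledPlucker, hP, hν]⟩

lemma scaledPlucker_injective {j : Mult m → ℝ} (hj : ∀ τ, 0 < j τ) :
    Function.Injective (scaledPlucker j) := fun _ _ h => funext fun τ =>
  OrientedPlane.bivector_injective (smul_right_injective _ (hj τ).ne' (congrFun h τ))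

/-- Conjugation preserves the Frobenius norm. Conversely, for positive `j` each component of either
momentum is `j_τ` times the bivector of an orthonormal pair, and the orthogonal group is transitive
on such bivectors. -/
lemma momentum_mem_coadjointOrbit_iff {j : Mult m → ℝ} (hj : ∀ τ, 0 < j τ) {p q : Phase m}
    (hq : totalMomentum q = j) :
    momentum p ∈ coadjointOrbit (momentum q) ↔ totalMomentum p = j := by
  constructor
  · rintro ⟨g, hg⟩
    funext τ
    rw [totalMomentum_eq_iff (hj τ).le, hg, momentum_eq_wedge q, upperSq_conj (wedge_transpose _ _),
      ← momentum_eq_wedge, ← totalMomentum_sq, hq]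
  · intro hp
    have h : ∀ p : Phase m, totalMomentum p = j → IsFrameFamily j (momentum p) (directions p) := by
      rintro p rfl
      exact fun τ => isFrame_directions hj τ
    choose v hv hν using h p hp
    choose v' hv' hν' using h q hq
    choose g hg using fun τ => (hv' τ).exists_conj (hv τ) τ.2
    exact ⟨g, fun τ => by rw [hν, hν', hg, Matrix.mul_smul, Matrix.smul_mul]⟩

end

lemma inner_self_block (hm : ∀ σ, 1 ≤ m σ) (p : Phase m) (σ : Fin (ℓ + 1)) :
    ⟪p.1 σ, p.1 σ⟫ = (reduction p).1 σ ^ 2 := by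
  by_cases hσ : 2 ≤ m σ
  · simp only [reduction, if_pos hσ, real_inner_self_eq_norm_sq]
  · simp only [reduction, if_neg hσ]
    rw [inner_of_eq_one (eq_one_of_not_two_le hm hσ), sq]

lemma inner_block (hm : ∀ σ, 1 ≤ m σ) (p : Phase m) (σ : Fin (ℓ + 1)) :
    ⟪p.1 σ, p.2 σ⟫ = (reduction p).1 σ * (reduction p).2 σ := by
  by_cases hσ : 2 ≤ m σ
  · simp only [reduction, if_pos hσ]
    by_cases h0 : p.1 σ = 0
    · simp [h0]
    · rw [mul_div_cancel₀ _ (norm_ne_zero_iff.2 h0)]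
  · simp only [reduction, if_neg hσ]
    exact inner_of_eq_one (eq_one_of_not_two_le hm hσ) _ _

/-- Pythagoras: in a multiple block `y` has a component `η` along `x` and an orthogonal one of
length `J / ξ`. The latter is the source of the centrifugal term in the amended potential. -/
lemma norm_sq_block (hm : ∀ σ, 1 ≤ m σ) {p : Phase m} (hp : p ∈ regularSet m) (σ : Fin (ℓ + 1)) :
    ‖p.2 σ‖ ^ 2 = (reduction p).2 σ ^ 2 +
      extendMomentum (totalMomentum p) σ ^ 2 / (reduction p).1 σ ^ 2 := by
  by_cases hσ : 2 ≤ m σ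
  · have h0 := norm_ne_zero_iff.2 (hp ⟨σ, hσ⟩)
    dsimp only at h0
    simp only [reduction, if_pos hσ, extendMomentum, dif_pos hσ, totalMomentum_sq,
      momentum_eq_wedge, upperSq_wedge]
    field_simp
    ring
  · simp only [reduction, if_neg hσ, extendMomentum, dif_neg hσ]
    rw [← real_inner_self_eq_norm_sq, inner_of_eq_one (eq_one_of_not_two_le hm hσ)]
    ring

lemma mem_cotangentSphere_iff (hm : ∀ σ, 1 ≤ m σ) (p : Phase m) : p ∈ cotangentSphere m ↔
    ∑ σ, (reduction p).1 σ ^ 2 = 1 ∧ ∑ σ, (reduction p).1 σ * (reduction p).2 σ = 0 := by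
  simp only [cotangentSphere, Set.mem_ofPred_eq, C₁, C₂, inner_self_block hm, inner_block hm]

lemma energy_eq_reducedEnergy (hm : ∀ σ, 1 ≤ m σ) (b : Fin (ℓ + 1) → ℝ) {p : Phase m} (hp : p ∈ regularSet m) :
    energy b p = reducedEnergy b (totalMomentum p) (reduction p) := by
  simp only [energy, reducedEnergy, amendedPotential, norm_sq_block hm hp,
    ← real_inner_self_eq_norm_sq (p.1 _), inner_self_block hm, Finset.sum_add_distrib]
  ring

lemma mem_fibre_iff (hm : ∀ σ, 1 ≤ m σ) {b : Fin (ℓ + 1) → ℝ} {h : ℝ} {j : Mult m → ℝ} (hj : ∀ τ, 0 < j τ)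
    {p : Phase m} :
    p ∈ fibre m b h j ↔ totalMomentum p = j ∧ reduction p ∈ reducedLevel b h j := by
  simp only [fibre, reducedLevel, reducedSphere, Set.mem_ofPred_eq, mem_cotangentSphere_iff hm,
    energyCasimir, Prod.mk.injEq]
  constructor
  · rintro ⟨⟨h1, h2⟩, h3, rfl⟩
    have hp := mem_regularSet hj
    refine ⟨rfl, ⟨h1, fun τ => ?_⟩, h2, by rw [← energy_eq_reducedEnergy hm b hp, h3]⟩
    simp only [reduction, if_pos τ.2]
    exact norm_pos_iff.2 (hp τ)
  · rintro ⟨rfl, ⟨h1, -⟩, h2, h3⟩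
    exact ⟨⟨h1, h2⟩, by rw [energy_eq_reducedEnergy hm b (mem_regularSet hj), h3], rfl⟩

lemma reconstruct_mem_fibre (hm : ∀ σ, 1 ≤ m σ) {b : Fin (ℓ + 1) → ℝ} {h : ℝ} {j : Mult m → ℝ} (hj : ∀ τ, 0 < j τ)
    {z : ReducedPhase ℓ} {ν : Momentum m} {u : Directions m} (hz : z ∈ reducedLevel b h j)
    (hu : IsFrameFamily j ν u) : reconstruct z ν u ∈ fibre m b h j := by
  have hν := momentum_reconstruct hz.1.2 hu
  refine (mem_fibre_iff hm hj).2 ⟨?_, ?_⟩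
  · exact totalMomentum_eq_of_isFrameFamily (u := u) hj (by rwa [hν])
  · rwa [reduction_reconstruct hm hz.1.2 hu]

end Reconstruction

/-! ### The two fibrations and their torus bundles -/

section Bundles

variable {ℓ : ℕ} {m : Fin (ℓ + 1) → ℕ} {b : Fin (ℓ + 1) → ℝ} {h : ℝ} {j : Mult m → ℝ}
  {ν : Momentum m} {u u' : Directions m}

lemma IsFrameFamily.rotations (hj : ∀ τ, 0 < j τ) (hu : IsFrameFamily j ν u) {t : Mult m → ℂ}
    (ht : t ∈ torus (Mult m)) :
    IsFrameFamily j ν (DegenerateNeumann.rotations j ν u t) :=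
  fun τ => (hu τ).rotate (hj τ).ne' (ht τ)

lemma IsFrameFamily.angles_rotations (hj : ∀ τ, 0 < j τ) (hu : IsFrameFamily j ν u)
    (t : Mult m → ℂ) : angles j ν u (DegenerateNeumann.rotations j ν u t) = t :=
  funext fun τ => (hu τ).angle_rotate (hj τ).ne' (t τ)

lemma IsFrameFamily.rotations_angles (hj : ∀ τ, 0 < j τ) (hu : IsFrameFamily j ν u)
    (hu' : IsFrameFamily j ν u') :
    DegenerateNeumann.rotations j ν u (angles j ν u u') = u' :=
  funext fun τ => ((hu τ).rotate_angle (hj τ).ne' (hu' τ)).1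

lemma IsFrameFamily.angles_mem_torus (hj : ∀ τ, 0 < j τ) (hu : IsFrameFamily j ν u)
    (hu' : IsFrameFamily j ν u') : angles j ν u u' ∈ torus (Mult m) :=
  fun τ => ((hu τ).rotate_angle (hj τ).ne' (hu' τ)).2

lemma IsFrameFamily.localSection (hu : IsFrameFamily j ν u) {w : Directions m}
    (hw : ν ∈ sectionDomain w) : IsFrameFamily j ν (DegenerateNeumann.localSection w ν) :=
  fun τ => (hu τ).normalize (hw τ)

lemma IsFrameFamily.mem_sectionDomain (hj : ∀ τ, 0 < j τ) (hu : IsFrameFamily j ν u) :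
    ν ∈ sectionDomain u := fun τ => by
  obtain ⟨v, hv, hν⟩ := hu τ
  rw [IsFrame.toEuclideanLin_self hv hν, neg_ne_zero, smul_ne_zero_iff]
  exact ⟨(hj τ).ne', fun h0 => by simpa [h0] using hv.2.1⟩

lemma isFrameFamily_of_mem_fibre (hj : ∀ τ, 0 < j τ) {p : Phase m} (hp : p ∈ fibre m b h j) :
    IsFrameFamily j (momentum p) (directions p) := by
  obtain ⟨-, hp⟩ := hp
  obtain rfl : totalMomentum p = j := congrArg Prod.snd hp
  exact fun τ => isFrame_directions hj τ

lemma fibre_subset_regularSet (hj : ∀ τ, 0 < j τ) : fibre m b h j ⊆ regularSet m := by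
  rintro p ⟨-, hp⟩
  obtain rfl : totalMomentum p = j := congrArg Prod.snd hp
  exact mem_regularSet hj

lemma reconstruct_of_mem_fibre (hm : ∀ σ, 1 ≤ m σ) (hj : ∀ τ, 0 < j τ) {p : Phase m}
    (hp : p ∈ fibre m b h j) : reconstruct (reduction p) (momentum p) (directions p) = p := by
  obtain ⟨-, hp⟩ := hp
  obtain rfl : totalMomentum p = j := congrArg Prod.snd hp
  exact reconstruct_reduction hm hj

lemma reduction_mem_reducedLevel (hm : ∀ σ, 1 ≤ m σ) (hj : ∀ τ, 0 < j τ) {p : Phase m}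
    (hp : p ∈ fibre m b h j) : reduction p ∈ reducedLevel b h j := ((mem_fibre_iff hm hj).1 hp).2

lemma momentum_mem_range (hj : ∀ τ, 0 < j τ) {p : Phase m}
    (hp : p ∈ fibre m b h j) : momentum p ∈ Set.range (scaledPlucker j) :=
  mem_range_scaledPlucker.2 ⟨_, isFrameFamily_of_mem_fibre hj hp⟩

lemma fibre_eq (hj : ∀ τ, 0 < j τ) {q : Phase m} (hq : totalMomentum q = j) :
    fibre m b h j = {p ∈ cotangentSphere m |
      energy b p = h ∧ momentum p ∈ coadjointOrbit (momentum q)} := by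
  ext p
  simp only [fibre, energyCasimir, Prod.mk.injEq, Set.mem_ofPred_eq,
    momentum_mem_coadjointOrbit_iff hj hq]

lemma momentum_image_fibre (hm : ∀ σ, 1 ≤ m σ) (hj : ∀ τ, 0 < j τ)
    (hne : (fibre m b h j).Nonempty) :
    momentum '' fibre m b h j = Set.range (scaledPlucker j) := by
  ext ν
  constructor
  · rintro ⟨p, hp, rfl⟩
    exact momentum_mem_range hj hp
  · intro hν
    obtain ⟨u, hu⟩ := mem_range_scaledPlucker.1 hν
    obtain ⟨p, hp⟩ := hne
    have hz := reduction_mem_reducedLevel hm hj hp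
    exact ⟨_, reconstruct_mem_fibre hm hj hz hu, momentum_reconstruct hz.1.2 hu⟩

lemma reduction_image_fibre (hm : ∀ σ, 1 ≤ m σ) (hj : ∀ τ, 0 < j τ) :
    reduction '' fibre m b h j = reducedLevel b h j := by
  ext z
  constructor
  · rintro ⟨p, hp, rfl⟩
    exact reduction_mem_reducedLevel hm hj hp
  · intro hz
    obtain ⟨ν, u, hu⟩ := exists_isFrameFamily j
    exact ⟨_, reconstruct_mem_fibre hm hj hz hu, reduction_reconstruct hm hz.1.2 hu⟩

/-- The coordinates `(z, ν, u)` vary independently, so exchanging `z` while keeping `ν` and `u`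
trivialises the bundle globally. -/
lemma reduction_isSmoothFibreBundle (hm : ∀ σ, 1 ≤ m σ) (hj : ∀ τ, 0 < j τ) {z : ReducedPhase ℓ}
    (hz : z ∈ reducedLevel b h j) :
    IsSmoothFibreBundle (fibre m b h j) reduction (reducedLevel b h j)
      {p ∈ fibre m b h j | reduction p = z} := by
  have hid := fun S : Set (Phase m) => ContDiff.isSmoothOn contDiff_id S
  refine ⟨fun p hp => reduction_mem_reducedLevel hm hj hp,
    (hid _).reduction fun p hp => fibre_subset_regularSet hj hp, fun z₀ hz₀ =>
    ⟨Set.univ, fun p => reconstruct z (momentum p) (directions p),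
      fun q => reconstruct q.1 (momentum q.2) (directions q.2), isOpen_univ, Set.mem_univ _,
      ?_, ?_, ?_, ?_⟩⟩
  · exact (isSmoothOn_const z _).reconstruct (hid _).momentum
      ((hid _).directions fun p hp => fibre_subset_regularSet hj hp.1)
      fun p hp τ => (hz.1.2 τ).ne'
  · exact (isSmoothOn_fst _).reconstruct (isSmoothOn_snd _).momentum
      ((isSmoothOn_snd _).directions fun q hq => fibre_subset_regularSet hj hq.2.1)
      fun q hq τ => (hq.1.1.1.2 τ).ne'
  · rintro p ⟨hp, -⟩
    have hu := isFrameFamily_of_mem_fibre hj hp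
    refine ⟨⟨reconstruct_mem_fibre hm hj hz hu, reduction_reconstruct hm hz.1.2 hu⟩, ?_⟩
    dsimp only
    rw [momentum_reconstruct hz.1.2 hu, directions_reconstruct hz.1.2 hu,
      reconstruct_of_mem_fibre hm hj hp]
  · rintro c ⟨hc, -⟩ p ⟨hp, hpz⟩
    have hu := isFrameFamily_of_mem_fibre hj hp
    refine ⟨reconstruct_mem_fibre hm hj hc hu, reduction_reconstruct hm hc.1.2 hu, ?_⟩
    dsimp only
    rw [momentum_reconstruct hc.1.2 hu, directions_reconstruct hc.1.2 hu, ← hpz,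
      reconstruct_of_mem_fibre hm hj hp]

/-- With `z` fixed only `(ν, u)` remains. The torus coordinate is the tuple of angles from the local
section to `u`. -/
lemma momentum_reductionFibre_isSmoothFibreBundle (hm : ∀ σ, 1 ≤ m σ) (hj : ∀ τ, 0 < j τ)
    {z : ReducedPhase ℓ} (hz : z ∈ reducedLevel b h j) :
    IsSmoothFibreBundle {p ∈ fibre m b h j | reduction p = z} momentum
      (Set.range (scaledPlucker j)) (torus (Mult m)) := by
  have hid := fun S : Set (Phase m) => ContDiff.isSmoothOn contDiff_id S
  refine ⟨fun p hp => momentum_mem_range hj hp.1, (hid _).momentum, fun ν₀ hν₀ => ?_⟩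
  obtain ⟨w, hw⟩ := mem_range_scaledPlucker.1 hν₀
  refine ⟨sectionDomain w,
    fun p => angles j (momentum p) (localSection w (momentum p)) (directions p),
    fun q => reconstruct z q.1 (rotations j q.1 (localSection w q.1) q.2),
    isOpen_sectionDomain w, hw.mem_sectionDomain hj, ?_, ?_, ?_, ?_⟩
  · exact (hid _).momentum.angles ((hid _).momentum.localSection w fun p hp => hp.2)
      ((hid _).directions fun p hp => fibre_subset_regularSet hj hp.1.1)
  · exact (isSmoothOn_const z _).reconstruct (isSmoothOn_fst _) ((isSmoothOn_fst _).rotations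
      ((isSmoothOn_fst _).localSection w fun q hq => hq.1.2) (isSmoothOn_snd _))
      fun q hq τ => (hz.1.2 τ).ne'
  · rintro p ⟨⟨hp, hpz⟩, hpw⟩
    have hu := isFrameFamily_of_mem_fibre hj hp
    have hs := hu.localSection hpw
    refine ⟨hs.angles_mem_torus hj hu, ?_⟩
    dsimp only
    rw [hs.rotations_angles hj hu, ← hpz, reconstruct_of_mem_fibre hm hj hp]
  · rintro ν ⟨hν, hνw⟩ t ht
    obtain ⟨u, hu⟩ := mem_range_scaledPlucker.1 hν
    have hs := hu.localSection hνw
    have hr := hs.rotations hj ht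
    refine ⟨⟨reconstruct_mem_fibre hm hj hz hr, reduction_reconstruct hm hz.1.2 hr⟩,
      momentum_reconstruct hz.1.2 hr, ?_⟩
    dsimp only
    rw [momentum_reconstruct hz.1.2 hr, directions_reconstruct hz.1.2 hr, hs.angles_rotations hj]

/-- Fibres over different momenta are identified by keeping `z` and the angles, measured from the
local section over the varying momentum and from a fixed `u` over `ν`. -/
lemma momentum_isSmoothFibreBundle (hm : ∀ σ, 1 ≤ m σ) (hj : ∀ τ, 0 < j τ)
    (hν : ν ∈ Set.range (scaledPlucker j)) :
    IsSmoothFibreBundle (fibre m b h j) momentum (Set.range (scaledPlucker j))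
      {p ∈ fibre m b h j | momentum p = ν} := by
  have hid := fun S : Set (Phase m) => ContDiff.isSmoothOn contDiff_id S
  refine ⟨fun p hp => momentum_mem_range hj hp, (hid _).momentum, fun ν₀ hν₀ => ?_⟩
  obtain ⟨w, hw⟩ := mem_range_scaledPlucker.1 hν₀
  obtain ⟨u, hu⟩ := mem_range_scaledPlucker.1 hν
  refine ⟨sectionDomain w,
    fun p => reconstruct (reduction p) ν (rotations j ν u
      (angles j (momentum p) (localSection w (momentum p)) (directions p))),
    fun q => reconstruct (reduction q.2) q.1 (rotations j q.1 (localSection w q.1)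
      (angles j ν u (directions q.2))),
    isOpen_sectionDomain w, hw.mem_sectionDomain hj, ?_, ?_, ?_, ?_⟩
  · exact ((hid _).reduction fun p hp => fibre_subset_regularSet hj hp.1).reconstruct
      (isSmoothOn_const ν _) ((isSmoothOn_const ν _).rotations (isSmoothOn_const u _)
        ((hid _).momentum.angles ((hid _).momentum.localSection w fun p hp => hp.2)
          ((hid _).directions fun p hp => fibre_subset_regularSet hj hp.1)))
      fun p hp τ => ((reduction_mem_reducedLevel hm hj hp.1).1.2 τ).ne'
  · exact ((isSmoothOn_snd _).reduction fun q hq => fibre_subset_regularSet hj hq.2.1).reconstruct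
      (isSmoothOn_fst _) ((isSmoothOn_fst _).rotations
        ((isSmoothOn_fst _).localSection w fun q hq => hq.1.2)
        ((isSmoothOn_const ν _).angles (isSmoothOn_const u _)
          ((isSmoothOn_snd _).directions fun q hq => fibre_subset_regularSet hj hq.2.1)))
      fun q hq τ => ((reduction_mem_reducedLevel hm hj hq.2.1).1.2 τ).ne'
  · rintro p ⟨hp, hpw⟩
    have hd := isFrameFamily_of_mem_fibre hj hp
    have hs := hd.localSection hpw
    have hz := reduction_mem_reducedLevel hm hj hp
    have hr := hu.rotations hj (hs.angles_mem_torus hj hd)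
    refine ⟨⟨reconstruct_mem_fibre hm hj hz hr, momentum_reconstruct hz.1.2 hr⟩, ?_⟩
    dsimp only
    rw [reduction_reconstruct hm hz.1.2 hr, directions_reconstruct hz.1.2 hr,
      hu.angles_rotations hj, hs.rotations_angles hj hd, reconstruct_of_mem_fibre hm hj hp]
  · rintro ν' ⟨hν', hνw⟩ p ⟨hp, hpν⟩
    obtain ⟨u', hu'⟩ := mem_range_scaledPlucker.1 hν'
    have hd := isFrameFamily_of_mem_fibre hj hp
    rw [hpν] at hd
    have hs := hu'.localSection hνw
    have hz := reduction_mem_reducedLevel hm hj hp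
    have hr := hs.rotations hj (hu.angles_mem_torus hj hd)
    refine ⟨reconstruct_mem_fibre hm hj hz hr, momentum_reconstruct hz.1.2 hr, ?_⟩
    dsimp only
    rw [reduction_reconstruct hm hz.1.2 hr, momentum_reconstruct hz.1.2 hr,
      directions_reconstruct hz.1.2 hr, hs.angles_rotations hj, hu.rotations_angles hj hd, ← hpν,
      reconstruct_of_mem_fibre hm hj hp]

/-- With `ν` fixed, one frame family serves as origin of the angles for every `z`, so this torus
bundle is trivial. -/
lemma reduction_momentumFibre_isSmoothFibreBundle (hm : ∀ σ, 1 ≤ m σ) (hj : ∀ τ, 0 < j τ)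
    (hν : ν ∈ Set.range (scaledPlucker j)) :
    IsSmoothFibreBundle {p ∈ fibre m b h j | momentum p = ν} reduction
      (reducedLevel b h j) (torus (Mult m)) := by
  have hid := fun S : Set (Phase m) => ContDiff.isSmoothOn contDiff_id S
  obtain ⟨u, hu⟩ := mem_range_scaledPlucker.1 hν
  refine ⟨fun p hp => reduction_mem_reducedLevel hm hj hp.1,
    (hid _).reduction fun p hp => fibre_subset_regularSet hj hp.1, fun z₀ hz₀ =>
    ⟨Set.univ, fun p => angles j ν u (directions p),
      fun q => reconstruct q.1 ν (rotations j ν u q.2), isOpen_univ, Set.mem_univ _,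
      ?_, ?_, ?_, ?_⟩⟩
  · exact (isSmoothOn_const ν _).angles (isSmoothOn_const u _)
      ((hid _).directions fun p hp => fibre_subset_regularSet hj hp.1.1)
  · exact (isSmoothOn_fst _).reconstruct (isSmoothOn_const ν _)
      ((isSmoothOn_const ν _).rotations (isSmoothOn_const u _) (isSmoothOn_snd _))
      fun q hq τ => (hq.1.1.1.2 τ).ne'
  · rintro p ⟨⟨hp, hpν⟩, -⟩
    have hd := isFrameFamily_of_mem_fibre hj hp
    rw [hpν] at hd
    refine ⟨hu.angles_mem_torus hj hd, ?_⟩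
    dsimp only
    rw [hu.rotations_angles hj hd, ← hpν, reconstruct_of_mem_fibre hm hj hp]
  · rintro z ⟨hz, -⟩ t ht
    have hr := hu.rotations hj ht
    refine ⟨⟨reconstruct_mem_fibre hm hj hz hr, momentum_reconstruct hz.1.2 hr⟩,
      reduction_reconstruct hm hz.1.2 hr, ?_⟩
    dsimp only
    rw [directions_reconstruct hz.1.2 hr, hu.angles_rotations hj]

end Bundles

/-- Once differentiability is known, differentials can be computed along straight lines. -/
lemma fderiv_apply_eq_of_hasDerivAt {E F : Type*} [NormedAddCommGroup E] [NormedSpace ℝ E]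
    [NormedAddCommGroup F] [NormedSpace ℝ F] {f : E → F} {p w : E} {c : F}
    (hf : DifferentiableAt ℝ f p) (h : HasDerivAt (fun t : ℝ => f (p + t • w)) c 0) :
    fderiv ℝ f p w = c := by
  have hl : HasDerivAt (fun t : ℝ => p + t • w) w 0 := by
    simpa using ((hasDerivAt_id (0 : ℝ)).smul_const w).const_add p
  have hf' : HasFDerivAt f (fderiv ℝ f p) (p + (0 : ℝ) • w) := by
    simpa using hf.hasFDerivAt
  exact (hf'.comp_hasDerivAt (0 : ℝ) hl).unique h

/-! ### Critical points of the amended potential -/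

section Amended

variable {ℓ : ℕ} {m : Fin (ℓ + 1) → ℕ} {b : Fin (ℓ + 1) → ℝ} {j : Mult m → ℝ}
  {ξ : Fin (ℓ + 1) → ℝ}

lemma extendMomentum_mult (j : Mult m → ℝ) (τ : Mult m) : extendMomentum j τ.1 = j τ := by
  simp [extendMomentum, τ.2]

lemma extendMomentum_simple (j : Mult m → ℝ) {σ : Fin (ℓ + 1)} (hσ : ¬ 2 ≤ m σ) :
    extendMomentum j σ = 0 := by
  simp [extendMomentum, hσ]

/-- The gradient of the amended potential. -/
noncomputable def amendedGradient (b : Fin (ℓ + 1) → ℝ) (j : Mult m → ℝ) (ξ : Fin (ℓ + 1) → ℝ)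
    (σ : Fin (ℓ + 1)) : ℝ := b σ * ξ σ - extendMomentum j σ ^ 2 / ξ σ ^ 3

/-- Simple coordinates may vanish: there the centrifugal numerator is zero, so the term is
constantly zero, also by the convention `0 / 0 = 0`. -/
lemma contDiffAt_amendedPotential (hξ : ∀ τ : Mult m, ξ τ.1 ≠ 0) :
    ContDiffAt ℝ ∞ (amendedPotential b j) ξ := by
  refine ContDiffAt.mul contDiffAt_const (ContDiffAt.sum fun σ _ => ?_)
  have h : ContDiffAt ℝ ∞ (fun ξ : Fin (ℓ + 1) → ℝ => ξ σ) ξ :=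
    (contDiff_pi.1 contDiff_id σ).contDiffAt
  refine (contDiffAt_const.mul (h.pow 2)).add ?_
  by_cases hσ : 2 ≤ m σ
  · exact contDiffAt_const.div (h.pow 2) (pow_ne_zero 2 (hξ ⟨σ, hσ⟩))
  · simp only [extendMomentum_simple j hσ, ne_eq, OfNat.ofNat_ne_zero, not_false_eq_true,
      zero_pow, zero_div]
    exact contDiffAt_const

lemma fderiv_amendedPotential (hξ : ∀ τ : Mult m, ξ τ.1 ≠ 0) (w : Fin (ℓ + 1) → ℝ) :
    fderiv ℝ (amendedPotential b j) ξ w = ∑ σ, amendedGradient b j ξ σ * w σ := by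
  refine fderiv_apply_eq_of_hasDerivAt
    ((contDiffAt_amendedPotential hξ).differentiableAt (by simp)) ?_
  have key : ∀ σ, HasDerivAt (fun t : ℝ => b σ * (ξ σ + t * w σ) ^ 2 +
      extendMomentum j σ ^ 2 / (ξ σ + t * w σ) ^ 2) (2 * (amendedGradient b j ξ σ * w σ)) 0 := by
    intro σ
    have h0 : HasDerivAt (fun t : ℝ => ξ σ + t * w σ) (w σ) 0 := by
      simpa using ((hasDerivAt_id (0 : ℝ)).mul_const (w σ)).const_add (ξ σ)
    by_cases hσ : 2 ≤ m σ
    · have hne : ξ σ ≠ 0 := hξ ⟨σ, hσ⟩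
      have h2 := ((h0.pow 2).const_mul (b σ)).add
        ((hasDerivAt_const (0 : ℝ) (extendMomentum j σ ^ 2)).div (h0.pow 2) (by simpa using hne))
      refine h2.congr_deriv ?_
      simp only [amendedGradient, zero_mul, add_zero, Pi.pow_apply]
      push_cast
      field_simp
      ring
    · simp only [extendMomentum_simple j hσ, amendedGradient]
      have h2 := (h0.pow 2).const_mul (b σ)
      simp only [zero_pow two_ne_zero, zero_div, add_zero, sub_zero]
      refine h2.congr_deriv ?_
      simp only [zero_mul, add_zero]
      push_cast
      ring
  have hs := (HasDerivAt.fun_sum (u := Finset.univ) fun σ _ => key σ).const_mul (1 / 2 : ℝ)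
  refine hs.congr_deriv ?_
  rw [← Finset.mul_sum]
  ring

lemma isAmendedCriticalPoint_iff_exists_multiplier :
    IsAmendedCriticalPoint b j ξ ↔
      ξ ∈ reducedSphere m ∧ ∃ β, ∀ σ, amendedGradient b j ξ σ = β * ξ σ := by
  refine and_congr_right fun hξ => ?_
  have h0 : ∀ τ : Mult m, ξ τ.1 ≠ 0 := fun τ => (hξ.2 τ).ne'
  simp only [fderiv_amendedPotential h0]
  constructor
  · intro h
    set G := amendedGradient b j ξ
    -- Pairing `G = βξ` with the unit vector `ξ` forces this value. The tangent vector used as a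
    -- test is then `G - βξ` itself, whose squared norm comes out as zero.
    set β := ∑ σ, G σ * ξ σ with hβ
    have hw : ∑ σ, ξ σ * (G σ - β * ξ σ) = 0 := by
      have : ∀ σ, ξ σ * (G σ - β * ξ σ) = G σ * ξ σ - β * ξ σ ^ 2 := fun σ => by ring
      simp only [this, Finset.sum_sub_distrib, ← Finset.mul_sum, hξ.1]
      rw [hβ]; ring
    have h1 := h _ hw
    have h2 : ∑ σ, (G σ - β * ξ σ) ^ 2 = 0 := by
      have : ∀ σ, (G σ - β * ξ σ) ^ 2 =
          G σ * (G σ - β * ξ σ) - β * (ξ σ * (G σ - β * ξ σ)) := fun σ => by ring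
      simp only [this, Finset.sum_sub_distrib, ← Finset.mul_sum, hw, h1]
      ring
    rw [Finset.sum_eq_zero_iff_of_nonneg fun _ _ => sq_nonneg _] at h2
    exact ⟨β, fun σ => by linarith [pow_eq_zero_iff two_ne_zero |>.1 (h2 σ (Finset.mem_univ _))]⟩
  · rintro ⟨β, hβ⟩ w hw
    simp only [hβ, mul_assoc, ← Finset.mul_sum, hw, mul_zero]

/-- Clearing denominators gives `(b - β) ξ⁴ = j²`; since `j` is not zero, `b - β` is positive and
the positive square root can be taken. -/
lemma multiplier_equation_iff {b j β ξ : ℝ} (hj : 0 < j) (hξ : 0 < ξ) :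
    b * ξ - j ^ 2 / ξ ^ 3 = β * ξ ↔ β < b ∧ ξ ^ 2 = j / √(b - β) := by
  have e : b * ξ - j ^ 2 / ξ ^ 3 = β * ξ ↔ (b - β) * (ξ ^ 2) ^ 2 = j ^ 2 := by
    rw [sub_eq_iff_eq_add, ← sub_eq_iff_eq_add', eq_div_iff (by positivity)]
    constructor <;> intro h <;> linarith
  rw [e]
  constructor
  · intro h
    have hpos : 0 < b - β := by
      by_contra hn
      nlinarith [sq_nonneg (ξ ^ 2), sq_pos_of_pos hj]
    have hs := Real.sqrt_pos.2 hpos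
    refine ⟨by linarith, ?_⟩
    rw [eq_div_iff hs.ne']
    have h2 : (ξ ^ 2 * √(b - β)) ^ 2 = j ^ 2 := by
      rw [mul_pow, Real.sq_sqrt hpos.le]; linarith
    exact (sq_eq_sq₀ (by positivity) hj.le).1 h2
  · rintro ⟨hlt, h⟩
    have hpos : 0 < b - β := by linarith
    have hs := Real.sqrt_pos.2 hpos
    have h2 := Real.sq_sqrt hpos.le
    rw [h]
    field_simp
    linarith

lemma isAmendedCriticalPoint_iff (hm : ∀ σ, 1 ≤ m σ) (hj : ∀ τ, 0 < j τ) :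
    IsAmendedCriticalPoint b j ξ ↔
      ξ ∈ reducedSphere m ∧ ∃ β : ℝ,
        (∀ τ : Mult m, β < b τ.1 ∧ ξ τ.1 ^ 2 = j τ / omega b β τ.1) ∧
        (∀ σ, m σ = 1 → ξ σ = 0 ∨ b σ = β) := by
  rw [isAmendedCriticalPoint_iff_exists_multiplier]
  refine and_congr_right fun hξ => exists_congr fun β => ?_
  have hmult : ∀ τ : Mult m, amendedGradient b j ξ τ.1 = β * ξ τ.1 ↔
      β < b τ.1 ∧ ξ τ.1 ^ 2 = j τ / omega b β τ.1 := fun τ => by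
    rw [amendedGradient, extendMomentum_mult, omega, multiplier_equation_iff (hj τ) (hξ.2 τ)]
  have hsimple : ∀ σ, ¬ 2 ≤ m σ → (amendedGradient b j ξ σ = β * ξ σ ↔ ξ σ = 0 ∨ b σ = β) :=
    fun σ hσ => by
    rw [amendedGradient, extendMomentum_simple j hσ, zero_pow two_ne_zero, zero_div, sub_zero,
      mul_eq_mul_right_iff, or_comm]
  constructor
  · exact fun h => ⟨fun τ => (hmult τ).1 (h _), fun σ hσ => (hsimple σ (by omega)).1 (h σ)⟩
  · intro h σ
    by_cases hσ : 2 ≤ m σ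
    · exact (hmult ⟨σ, hσ⟩).2 (h.1 ⟨σ, hσ⟩)
    · exact (hsimple σ hσ).2 (h.2 σ (eq_one_of_not_two_le hm hσ))

/-- The multiplier lies below `b 0`, hence below every `b σ`, so the alternative `b σ = β` is
excluded. -/
lemma IsAmendedCriticalPoint.eq_zero (hm : ∀ σ, 1 ≤ m σ) (hb : StrictMono b) (hj : ∀ τ, 0 < j τ)
    (h0 : 2 ≤ m 0) (h : IsAmendedCriticalPoint b j ξ) (σ : Fin (ℓ + 1)) (hσ : m σ = 1) :
    ξ σ = 0 := by
  obtain ⟨-, β, h1, h2⟩ := (isAmendedCriticalPoint_iff hm hj).1 h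
  refine (h2 σ hσ).resolve_right fun hβ => ?_
  have := (h1 ⟨0, h0⟩).1
  have h3 := hb.monotone (Fin.zero_le σ)
  dsimp only at this
  linarith

lemma omega_pos {β : ℝ} {σ : Fin (ℓ + 1)} (h : β < b σ) : 0 < omega b β σ :=
  Real.sqrt_pos.2 (by linarith)

lemma sum_div_omega_strictMono (hdeg : ∃ σ, 2 ≤ m σ) (hj : ∀ τ, 0 < j τ) {β β' : ℝ}
    (h : β < β') (hβ' : ∀ τ : Mult m, β' < b τ.1) :
    ∑ τ : Mult m, j τ / omega b β τ.1 < ∑ τ : Mult m, j τ / omega b β' τ.1 := by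
  obtain ⟨σ, hσ⟩ := hdeg
  refine Finset.sum_lt_sum_of_nonempty ⟨⟨σ, hσ⟩, Finset.mem_univ _⟩ fun τ _ => ?_
  refine div_lt_div_of_pos_left (hj τ) (omega_pos (hβ' τ)) (Real.sqrt_lt_sqrt ?_ ?_) <;>
  linarith [hβ' τ]

lemma existsUnique_multiplier (hdeg : ∃ σ, 2 ≤ m σ) (hj : ∀ τ, 0 < j τ) :
    ∃! β : ℝ, (∀ τ : Mult m, β < b τ.1) ∧ ∑ τ : Mult m, j τ / omega b β τ.1 = 1 := by
  have : Nonempty (Mult m) := hdeg.elim fun σ hσ => ⟨⟨σ, hσ⟩⟩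
  obtain ⟨τ₀, hτ₀⟩ := Finite.exists_min fun τ : Mult m => b τ.1
  set s := ∑ τ, j τ with hs
  have hjs : j τ₀ ≤ s := Finset.single_le_sum (fun τ _ => (hj τ).le) (Finset.mem_univ τ₀)
  have hj0 := hj τ₀
  have hs0 : 0 < s := hj0.trans_le hjs
  -- The intermediate value theorem is applied between these two points. At the left one every `ω_τ`
  -- is at least `s = ∑ j_τ`, so the sum is at most one; at the right one the term of `τ₀` alone
  -- equals one.
  have hle : b τ₀.1 - s ^ 2 ≤ b τ₀.1 - j τ₀ ^ 2 := by nlinarith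
  have hlt : ∀ β ≤ b τ₀.1 - j τ₀ ^ 2, ∀ τ : Mult m, β < b τ.1 := fun β hβ τ => by
    nlinarith [hτ₀ τ]
  have hcont : ContinuousOn (fun β => ∑ τ : Mult m, j τ / omega b β τ.1)
      (Set.Icc (b τ₀.1 - s ^ 2) (b τ₀.1 - j τ₀ ^ 2)) := by
    refine continuousOn_finsetSum _ fun τ _ => ContinuousOn.div continuousOn_const
      (Continuous.continuousOn ?_) fun β hβ => (omega_pos (hlt β hβ.2 τ)).ne'
    unfold omega
    fun_prop
  have h1 : ∑ τ : Mult m, j τ / omega b (b τ₀.1 - s ^ 2) τ.1 ≤ 1 := by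
    calc ∑ τ : Mult m, j τ / omega b (b τ₀.1 - s ^ 2) τ.1 ≤ ∑ τ : Mult m, j τ / s := by
          refine Finset.sum_le_sum fun τ _ => div_le_div_of_nonneg_left (hj τ).le hs0 ?_
          exact Real.le_sqrt_of_sq_le (by linarith [hτ₀ τ])
      _ = 1 := by rw [← Finset.sum_div, div_self hs0.ne']
  have h2 : 1 ≤ ∑ τ : Mult m, j τ / omega b (b τ₀.1 - j τ₀ ^ 2) τ.1 := by
    have e : j τ₀ / omega b (b τ₀.1 - j τ₀ ^ 2) τ₀.1 = 1 := by
      rw [omega, sub_sub_cancel, Real.sqrt_sq hj0.le, div_self hj0.ne']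
    rw [← e]
    exact Finset.single_le_sum (f := fun τ : Mult m => j τ / omega b (b τ₀.1 - j τ₀ ^ 2) τ.1)
      (fun τ _ => div_nonneg (hj τ).le (Real.sqrt_nonneg _)) (Finset.mem_univ τ₀)
  obtain ⟨β, hβ, hβ1⟩ := intermediate_value_Icc hle hcont ⟨h1, h2⟩
  refine ⟨β, ⟨hlt β hβ.2, hβ1⟩, fun β' ⟨h3, h4⟩ => ?_⟩
  dsimp only at hβ1
  rcases lt_trichotomy β' β with h | h | h
  · have := sum_div_omega_strictMono hdeg hj h (hlt β hβ.2)
    linarith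
  · exact h
  · have := sum_div_omega_strictMono hdeg hj h h3
    linarith

lemma amendedPotential_of_multiplier {β : ℝ} (hj : ∀ τ, 0 < j τ)
    (h : ∀ τ : Mult m, β < b τ.1 ∧ ξ τ.1 ^ 2 = j τ / omega b β τ.1) :
    amendedPotential b j ξ = criticalEnergy b j β +
      (1 / 2) * ∑ σ : {σ // ¬ 2 ≤ m σ}, b σ.1 * ξ σ.1 ^ 2 := by
  rw [amendedPotential, ← Fintype.sum_subtype_add_sum_subtype (fun σ => 2 ≤ m σ), mul_add,
    criticalEnergy]
  congr 2
  · refine Finset.sum_congr rfl fun τ _ => ?_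
    have h1 := omega_pos (h τ).1
    have h2 := hj τ
    rw [(h τ).2, extendMomentum_mult]
    field_simp
    ring
  · exact Finset.sum_congr rfl fun σ _ => by simp [extendMomentum_simple j σ.2]

lemma sum_sq_of_multiplier {β : ℝ}
    (h : ∀ τ : Mult m, β < b τ.1 ∧ ξ τ.1 ^ 2 = j τ / omega b β τ.1) :
    ∑ σ, ξ σ ^ 2 = ∑ τ : Mult m, j τ / omega b β τ.1 +
      ∑ σ : {σ // ¬ 2 ≤ m σ}, ξ σ.1 ^ 2 := by
  rw [← Fintype.sum_subtype_add_sum_subtype (fun σ => 2 ≤ m σ)]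
  congr 1
  exact Finset.sum_congr rfl fun τ _ => (h τ).2

/-- Since `b` is injective, at most one simple coordinate is nonzero, and its square is the mass `1
- ∑ j_τ / ω_τ` left by the multiple ones. If there is none, the constraint fixes `β`. -/
lemma exists_isAmendedCriticalPoint_iff (hm : ∀ σ, 1 ≤ m σ) (hb : StrictMono b)
    (hj : ∀ τ, 0 < j τ) (h : ℝ) :
    (∃ ξ, IsAmendedCriticalPoint b j ξ ∧ amendedPotential b j ξ = h) ↔
      (∃ β : ℝ, (∀ τ : Mult m, β < b τ.1) ∧ ∑ τ : Mult m, j τ / omega b β τ.1 = 1 ∧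
        h = criticalEnergy b j β) ∨
      (∃ σ, m σ = 1 ∧ (∀ τ : Mult m, b σ < b τ.1) ∧
        ∑ τ : Mult m, j τ / omega b (b σ) τ.1 < 1 ∧
        h = (1 / 2) * b σ * (1 - ∑ τ : Mult m, j τ / omega b (b σ) τ.1) +
          criticalEnergy b j (b σ)) := by
  constructor
  · rintro ⟨ξ, hξ, rfl⟩
    obtain ⟨hS, β, h1, h2⟩ := (isAmendedCriticalPoint_iff hm hj).1 hξ
    have hV := amendedPotential_of_multiplier hj h1
    have hsum := sum_sq_of_multiplier h1
    rw [hS.1] at hsum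
    by_cases hz : ∀ σ : {σ // ¬ 2 ≤ m σ}, ξ σ.1 = 0
    · left
      simp only [hz, ne_eq, OfNat.ofNat_ne_zero, not_false_eq_true, zero_pow, mul_zero,
        Finset.sum_const_zero, add_zero] at hV hsum
      exact ⟨β, fun τ => (h1 τ).1, hsum.symm, hV⟩
    · right
      push Not at hz
      obtain ⟨σ, hσ⟩ := hz
      have hβ : b σ.1 = β := (h2 σ.1 (eq_one_of_not_two_le hm σ.2)).resolve_left hσ
      have hz : ∀ σ' : {σ // ¬ 2 ≤ m σ}, σ' ≠ σ → ξ σ'.1 = 0 := fun σ' hne =>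
        (h2 σ'.1 (eq_one_of_not_two_le hm σ'.2)).resolve_right fun hβ' =>
          hne (Subtype.ext (hb.injective (hβ'.trans hβ.symm)))
      rw [Finset.sum_eq_single σ (fun σ' _ hne => by rw [hz σ' hne]; ring) (by simp)] at hV hsum
      subst hβ
      have hpos : 0 < ξ σ.1 ^ 2 := by positivity
      refine ⟨σ.1, eq_one_of_not_two_le hm σ.2, fun τ => (h1 τ).1, by linarith, ?_⟩
      rw [hV, show ξ σ.1 ^ 2 = 1 - ∑ τ : Mult m, j τ / omega b (b σ.1) τ.1 by linarith]
      ring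
  · have hpos : ∀ β : ℝ, (∀ τ : Mult m, β < b τ.1) → ∀ τ : Mult m, 0 < j τ / omega b β τ.1 :=
      fun β hβ τ => div_pos (hj τ) (omega_pos (hβ τ))
    -- Here `c` prescribes the simple coordinates; it is zero in the first case and supported at `σ`
    -- in the second. The multiple coordinates are forced by `β`.
    have key : ∀ (β : ℝ) (c : Fin (ℓ + 1) → ℝ), (∀ τ : Mult m, β < b τ.1) →
        (∀ σ, m σ = 1 → c σ = 0 ∨ b σ = β) →
        (∑ τ : Mult m, j τ / omega b β τ.1 + ∑ σ : {σ // ¬ 2 ≤ m σ}, c σ.1 ^ 2 = 1) →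
        h = criticalEnergy b j β + (1 / 2) * ∑ σ : {σ // ¬ 2 ≤ m σ}, b σ.1 * c σ.1 ^ 2 →
        ∃ ξ, IsAmendedCriticalPoint b j ξ ∧ amendedPotential b j ξ = h := by
      intro β c hβ hc hsum hh
      let ξ : Fin (ℓ + 1) → ℝ := fun σ => if hσ : 2 ≤ m σ then √(j ⟨σ, hσ⟩ / omega b β σ) else c σ
      have hξτ : ∀ τ : Mult m, ξ τ.1 = √(j τ / omega b β τ.1) := fun τ => dif_pos τ.2
      have hξσ : ∀ σ : {σ // ¬ 2 ≤ m σ}, ξ σ.1 = c σ.1 := fun σ => dif_neg σ.2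
      have h1 : ∀ τ : Mult m, β < b τ.1 ∧ ξ τ.1 ^ 2 = j τ / omega b β τ.1 := fun τ =>
        ⟨hβ τ, by rw [hξτ, Real.sq_sqrt (hpos β hβ τ).le]⟩
      refine ⟨ξ, (isAmendedCriticalPoint_iff hm hj).2 ⟨⟨?_, fun τ => ?_⟩, β, h1, fun σ hσ => ?_⟩, ?_⟩
      · rw [sum_sq_of_multiplier h1]
        simpa only [hξσ] using hsum
      · rw [hξτ]
        exact Real.sqrt_pos.2 (hpos β hβ τ)
      · rw [hξσ ⟨σ, by omega⟩]
        exact hc σ hσ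
      · rw [amendedPotential_of_multiplier hj h1, hh]
        simp only [hξσ]
    rintro (⟨β, hβ, hsum, hh⟩ | ⟨σ, hσ, hβ, hlt, hh⟩)
    · exact key β 0 hβ (fun σ _ => Or.inl rfl) (by simpa using hsum) (by simpa using hh)
    · have hr : 0 ≤ 1 - ∑ τ : Mult m, j τ / omega b (b σ) τ.1 := by linarith
      have hc : ∀ σ' : {σ // ¬ 2 ≤ m σ}, σ' ≠ ⟨σ, by omega⟩ →
          (Pi.single σ √(1 - ∑ τ : Mult m, j τ / omega b (b σ) τ.1) :
            Fin (ℓ + 1) → ℝ) σ'.1 = 0 := fun σ' hne =>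
        Pi.single_eq_of_ne (fun e => hne (Subtype.ext e)) _
      refine key (b σ) (Pi.single σ √(1 - ∑ τ : Mult m, j τ / omega b (b σ) τ.1)) hβ
        (fun σ' _ => ?_) ?_ ?_
      · by_cases h : σ' = σ
        · exact Or.inr (by rw [h])
        · exact Or.inl (Pi.single_eq_of_ne h _)
      · rw [Finset.sum_eq_single (⟨σ, by omega⟩ : {σ // ¬ 2 ≤ m σ})
            (fun σ' _ hne => by rw [hc σ' hne]; ring) (by simp),
          Pi.single_eq_same, Real.sq_sqrt hr]
        ring
      · rw [Finset.sum_eq_single (⟨σ, by omega⟩ : {σ // ¬ 2 ≤ m σ})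
            (fun σ' _ hne => by rw [hc σ' hne]; ring) (by simp),
          Pi.single_eq_same, Real.sq_sqrt hr, hh]
        ring

end Amended

/-! ### Differentials of the constraints, the energy and the Casimirs -/

section Derivatives

variable {ℓ : ℕ} {m : Fin (ℓ + 1) → ℕ} {b : Fin (ℓ + 1) → ℝ}

lemma hasDerivAt_line_inner {k : ℕ} (x y v w : EuclideanSpace ℝ (Fin k)) :
    HasDerivAt (fun t : ℝ => ⟪x + t • v, y + t • w⟫) (⟪x, w⟫ + ⟪v, y⟫) 0 := by
  have h : ∀ x v : EuclideanSpace ℝ (Fin k), HasDerivAt (fun t : ℝ => x + t • v) v 0 :=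
    fun x v => by simpa using ((hasDerivAt_id (0 : ℝ)).smul_const v).const_add x
  simpa using (h x v).inner ℝ (h y w)

lemma differentiable_C₁ : Differentiable ℝ (C₁ : Phase m → ℝ) := by
  exact Differentiable.fun_sum fun σ _ => Differentiable.inner ℝ (by fun_prop) (by fun_prop)

lemma differentiable_C₂ : Differentiable ℝ (C₂ : Phase m → ℝ) := by
  exact Differentiable.fun_sum fun σ _ => Differentiable.inner ℝ (by fun_prop) (by fun_prop)

lemma mem_tangentCotangentSphere {p w : Phase m} : w ∈ tangentCotangentSphere p ↔
    ∑ σ, ⟪p.1 σ, w.1 σ⟫ = 0 ∧ ∑ σ, (⟪p.1 σ, w.2 σ⟫ + ⟪w.1 σ, p.2 σ⟫) = 0 := by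
  have h1 : HasDerivAt (fun t : ℝ => C₁ (p + t • w))
      (∑ σ, (⟪p.1 σ, w.1 σ⟫ + ⟪w.1 σ, p.1 σ⟫)) 0 :=
    HasDerivAt.fun_sum fun σ _ => hasDerivAt_line_inner _ _ _ _
  have h2 : HasDerivAt (fun t : ℝ => C₂ (p + t • w))
      (∑ σ, (⟪p.1 σ, w.2 σ⟫ + ⟪w.1 σ, p.2 σ⟫)) 0 :=
    HasDerivAt.fun_sum fun σ _ => hasDerivAt_line_inner _ _ _ _
  have h := fderiv_apply_eq_of_hasDerivAt (f := fun q : Phase m => (C₁ q, C₂ q))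
    ((differentiable_C₁ p).prodMk (differentiable_C₂ p)) (h1.prodMk h2)
  rw [tangentCotangentSphere, LinearMap.mem_ker, ContinuousLinearMap.coe_coe, h, Prod.mk_eq_zero]
  refine and_congr_left' ?_
  have e : ∀ σ, ⟪p.1 σ, w.1 σ⟫ + ⟪w.1 σ, p.1 σ⟫ = 2 * ⟪p.1 σ, w.1 σ⟫ := fun σ => by
    rw [real_inner_comm (p.1 σ)]; ring
  simp only [e, ← Finset.mul_sum, mul_eq_zero, OfNat.ofNat_ne_zero, false_or]

/-- The derivative of the energy at `p` in the direction `w`. -/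
noncomputable def energyDeriv (b : Fin (ℓ + 1) → ℝ) (p w : Phase m) : ℝ :=
  ∑ σ, (⟪p.2 σ, w.2 σ⟫ + b σ * ⟪p.1 σ, w.1 σ⟫)

/-- Half the derivative of `J_τ²` at `p` in the direction `w`. -/
noncomputable def casimirDeriv (p w : Phase m) (τ : Mult m) : ℝ :=
  ⟪p.1 τ.1, w.1 τ.1⟫ * ‖p.2 τ.1‖ ^ 2 + ‖p.1 τ.1‖ ^ 2 * ⟪p.2 τ.1, w.2 τ.1⟫ -
    ⟪p.1 τ.1, p.2 τ.1⟫ * (⟪p.1 τ.1, w.2 τ.1⟫ + ⟪w.1 τ.1, p.2 τ.1⟫)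

lemma energy_eq (p : Phase m) : energy b p =
    (1 / 2) * ∑ σ, (⟪p.2 σ, p.2 σ⟫ + b σ * ⟪p.1 σ, p.1 σ⟫) := by
  simp only [energy, real_inner_self_eq_norm_sq, Finset.sum_add_distrib]
  ring

lemma totalMomentum_eq (p : Phase m) (τ : Mult m) : totalMomentum p τ =
    √(⟪p.1 τ.1, p.1 τ.1⟫ * ⟪p.2 τ.1, p.2 τ.1⟫ - ⟪p.1 τ.1, p.2 τ.1⟫ ^ 2) := by
  rw [real_inner_self_eq_norm_sq, real_inner_self_eq_norm_sq, ← upperSq_wedge]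
  rfl

lemma differentiable_energy : Differentiable ℝ (energy b : Phase m → ℝ) := by
  simp only [funext (energy_eq (b := b) (m := m))]
  refine (Differentiable.fun_sum fun σ _ => ?_).const_mul _
  exact (Differentiable.inner ℝ (by fun_prop) (by fun_prop)).add
    ((Differentiable.inner ℝ (by fun_prop) (by fun_prop)).const_mul _)

lemma hasDerivAt_energy (p w : Phase m) :
    HasDerivAt (fun t : ℝ => energy b (p + t • w)) (energyDeriv b p w) 0 := by
  simp only [energy_eq]
  have h := (HasDerivAt.fun_sum (u := Finset.univ) fun σ _ =>
    (hasDerivAt_line_inner (p.2 σ) (p.2 σ) (w.2 σ) (w.2 σ)).add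
      ((hasDerivAt_line_inner (p.1 σ) (p.1 σ) (w.1 σ) (w.1 σ)).const_mul (b σ))).const_mul
    (1 / 2 : ℝ)
  refine h.congr_deriv ?_
  rw [energyDeriv, Finset.mul_sum]
  refine Finset.sum_congr rfl fun σ _ => ?_
  rw [real_inner_comm (p.2 σ), real_inner_comm (p.1 σ)]
  ring

lemma differentiableAt_totalMomentum {p : Phase m} {τ : Mult m} (h : 0 < totalMomentum p τ) :
    DifferentiableAt ℝ (fun p : Phase m => totalMomentum p τ) p := by
  simp only [totalMomentum_eq] at h ⊢
  refine DifferentiableAt.sqrt (DifferentiableAt.sub (DifferentiableAt.mul ?_ ?_)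
    (DifferentiableAt.pow ?_ 2)) (Real.sqrt_pos.1 h).ne' <;>
  exact DifferentiableAt.inner ℝ (by fun_prop) (by fun_prop)

lemma hasDerivAt_totalMomentum {p : Phase m} {τ : Mult m} (h : 0 < totalMomentum p τ)
    (w : Phase m) : HasDerivAt (fun t : ℝ => totalMomentum (p + t • w) τ)
      (casimirDeriv p w τ / totalMomentum p τ) 0 := by
  have hl := fun (f g : Phase m → EuclideanSpace ℝ (Fin (m τ.1))) =>
    hasDerivAt_line_inner (f p) (g p) (f w) (g w)
  have h1 := ((hl (fun q => q.1 τ.1) (fun q => q.1 τ.1)).mul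
    (hl (fun q => q.2 τ.1) (fun q => q.2 τ.1))).sub
      ((hl (fun q => q.1 τ.1) (fun q => q.2 τ.1)).pow 2)
  have h0 := h
  simp only [totalMomentum_eq] at h0 ⊢
  have h2 := h1.sqrt (by simpa using (Real.sqrt_pos.1 h0).ne')
  refine h2.congr_deriv ?_
  simp only [Pi.sub_apply, Pi.mul_apply, Pi.pow_apply, zero_smul, add_zero, casimirDeriv]
  rw [real_inner_comm (p.1 τ.1) (w.1 τ.1), real_inner_comm (p.2 τ.1) (w.2 τ.1),
    real_inner_self_eq_norm_sq, real_inner_self_eq_norm_sq] at *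
  push_cast
  field_simp
  ring

lemma differentiableAt_energyCasimir {p : Phase m} (h : ∀ τ, 0 < totalMomentum p τ) :
    DifferentiableAt ℝ (energyCasimir b) p :=
  (differentiable_energy p).prodMk
    (differentiableAt_pi.2 fun τ => differentiableAt_totalMomentum (h τ))

lemma fderiv_energyCasimir {p : Phase m} (h : ∀ τ, 0 < totalMomentum p τ) (w : Phase m) :
    fderiv ℝ (energyCasimir b) p w =
      (energyDeriv b p w, fun τ => casimirDeriv p w τ / totalMomentum p τ) :=
  fderiv_apply_eq_of_hasDerivAt (differentiableAt_energyCasimir h)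
    ((hasDerivAt_energy p w).prodMk
      (hasDerivAt_pi.2 fun τ => hasDerivAt_totalMomentum (h τ) w))

/-- Where all `J_τ` are positive, their differentials are already jointly onto on the tangent space.
Full rank therefore means that the energy has a nonzero derivative somewhere on their common kernel.
-/
lemma isCriticalPoint_iff {p : Phase m} (hp : p ∈ cotangentSphere m)
    (h : ∀ τ, 0 < totalMomentum p τ) :
    IsCriticalPoint b p ↔ ∀ w ∈ tangentCotangentSphere p,
      (∀ τ, casimirDeriv p w τ = 0) → energyDeriv b p w = 0 := by
  simp only [IsCriticalPoint, hp, true_and, differentiableAt_energyCasimir h]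
  constructor
  · intro hc w hw hw0
    by_contra hE
    refine hc fun c => ?_
    -- Stretching the part of `y_τ` orthogonal to `x_τ` preserves both constraints. Its squared
    -- length is `J_τ² / ‖x_τ‖²`, so the factor `c_τ / J_τ` gives `J_τ` the derivative `c_τ`.
    let e : Phase m := (0, fun σ => if hσ : 2 ≤ m σ then
      (c.2 ⟨σ, hσ⟩ / totalMomentum p ⟨σ, hσ⟩) • (p.2 σ - (⟪p.1 σ, p.2 σ⟫ / ‖p.1 σ‖ ^ 2) • p.1 σ)
      else 0)
    have hx : ∀ τ : Mult m, ‖p.1 τ.1‖ ≠ 0 := fun τ => norm_ne_zero_iff.2 (mem_regularSet h τ)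
    have he2 : ∀ τ : Mult m, e.2 τ.1 = (c.2 τ / totalMomentum p τ) •
        (p.2 τ.1 - (⟪p.1 τ.1, p.2 τ.1⟫ / ‖p.1 τ.1‖ ^ 2) • p.1 τ.1) := fun τ => dif_pos τ.2
    have hxe : ∀ σ, ⟪p.1 σ, e.2 σ⟫ = 0 := fun σ => by
      by_cases hσ : 2 ≤ m σ
      · have := hx ⟨σ, hσ⟩
        dsimp only at this
        rw [he2 ⟨σ, hσ⟩, inner_smul_right, inner_sub_right, inner_smul_right,
          real_inner_self_eq_norm_sq, div_mul_cancel₀ _ (pow_ne_zero 2 this), sub_self, mul_zero]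
      · simp [e, hσ]
    have he : e ∈ tangentCotangentSphere p := by
      rw [mem_tangentCotangentSphere]
      simp only [hxe]
      simp [e]
    have heJ : ∀ τ, casimirDeriv p e τ / totalMomentum p τ = c.2 τ := fun τ => by
      have hJ := (h τ).ne'
      have h1 := hx τ
      have hW := totalMomentum_sq p τ
      rw [momentum_eq_wedge, upperSq_wedge] at hW
      have e1 : e.1 τ.1 = 0 := rfl
      rw [casimirDeriv, e1, hxe, he2, inner_smul_right, inner_sub_right, inner_smul_right,
        real_inner_self_eq_norm_sq, real_inner_comm (p.1 τ.1) (p.2 τ.1)]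
      simp only [inner_zero_right, inner_zero_left, zero_mul, add_zero, mul_zero, zero_add,
        sub_zero]
      field_simp
      linear_combination (-c.2 τ) * hW
    -- The multiple of `w` corrects the energy component without disturbing the Casimirs.
    refine ⟨e + ((c.1 - energyDeriv b p e) / energyDeriv b p w) • w,
      Submodule.add_mem _ he (Submodule.smul_mem _ _ hw), ?_⟩
    rw [map_add, map_smul, fderiv_energyCasimir h, fderiv_energyCasimir h]
    refine Prod.ext ?_ (funext fun τ => ?_)
    · simp only [Prod.fst_add, Prod.smul_fst, smul_eq_mul, div_mul_cancel₀ _ hE]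
      ring
    · simp only [Prod.snd_add, Prod.smul_snd, Pi.add_apply, Pi.smul_apply, smul_eq_mul, hw0,
        zero_div, mul_zero, add_zero, heJ]
  · intro hK hs
    obtain ⟨w, hw, hc⟩ := hs (1, 0)
    rw [fderiv_energyCasimir h, Prod.mk.injEq] at hc
    have h0 : ∀ τ, casimirDeriv p w τ = 0 := fun τ => by
      have := congrFun hc.2 τ
      simpa [(h τ).ne'] using this
    have := hK w hw h0
    rw [hc.1] at this
    exact one_ne_zero this

end Derivatives

/-! ### Critical points and relative equilibria in reduced terms -/

section Equilibria

variable {ℓ : ℕ} {m : Fin (ℓ + 1) → ℕ} {b : Fin (ℓ + 1) → ℝ} {p : Phase m}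

/-- The direction in configuration space at `p` with components `a` along the reduced
coordinates. -/
noncomputable def radial (p : Phase m) (a : Fin (ℓ + 1) → ℝ) : Config m := fun σ =>
  if 2 ≤ m σ then (a σ / (reduction p).1 σ) • p.1 σ else WithLp.toLp 2 fun _ => a σ

lemma reduction_fst_pos (h : p ∈ regularSet m) (τ : Mult m) : 0 < (reduction p).1 τ.1 := by
  simp only [reduction, if_pos τ.2]
  exact norm_pos_iff.2 (h τ)

lemma inner_radial (hm : ∀ σ, 1 ≤ m σ) (h : p ∈ regularSet m) (a : Fin (ℓ + 1) → ℝ)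
    (σ : Fin (ℓ + 1)) : ⟪p.1 σ, radial p a σ⟫ = (reduction p).1 σ * a σ := by
  by_cases hσ : 2 ≤ m σ
  · have := (reduction_fst_pos h ⟨σ, hσ⟩).ne'
    dsimp only at this
    rw [radial, if_pos hσ, inner_smul_right, inner_self_block hm]
    field_simp
  · have h1 := eq_one_of_not_two_le hm hσ
    rw [radial, if_neg hσ, inner_of_eq_one h1]
    simp only [reduction, if_neg hσ]
    simp [h1]

lemma inner_radial_snd (hm : ∀ σ, 1 ≤ m σ) (h : p ∈ regularSet m) (a : Fin (ℓ + 1) → ℝ)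
    (σ : Fin (ℓ + 1)) : ⟪p.2 σ, radial p a σ⟫ = (reduction p).2 σ * a σ := by
  by_cases hσ : 2 ≤ m σ
  · have := (reduction_fst_pos h ⟨σ, hσ⟩).ne'
    dsimp only at this
    rw [radial, if_pos hσ, inner_smul_right, real_inner_comm, inner_block hm]
    field_simp
  · have h1 := eq_one_of_not_two_le hm hσ
    rw [radial, if_neg hσ, inner_of_eq_one h1]
    simp only [reduction, if_neg hσ]
    simp [h1]

/-- Adding to `y_τ` a multiple of `x_τ` does not change `x_τ ∧ y_τ`; such directions only move `η`.
-/
lemma radial_momentum_mem_kernel (hm : ∀ σ, 1 ≤ m σ) (h : p ∈ regularSet m)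
    {a : Fin (ℓ + 1) → ℝ} (ha : ∑ σ, (reduction p).1 σ * a σ = 0) :
    ((0, radial p a) : Phase m) ∈ tangentCotangentSphere p ∧
      (∀ τ, casimirDeriv p (0, radial p a) τ = 0) ∧
      energyDeriv b p (0, radial p a) = ∑ σ, (reduction p).2 σ * a σ := by
  refine ⟨?_, fun τ => ?_, ?_⟩
  · rw [mem_tangentCotangentSphere]
    simp [inner_radial hm h, ha]
  · simp only [casimirDeriv, inner_radial hm h, inner_radial_snd hm h, inner_block hm,
      ← real_inner_self_eq_norm_sq (p.1 _), inner_self_block hm]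
    simp only [Pi.zero_apply, inner_zero_right, inner_zero_left]
    ring
  · simp [energyDeriv, inner_radial_snd hm h]

/-- The condition on `p` in the reduced coordinates which characterises relative equilibria. -/
def IsReducedEquilibrium (b : Fin (ℓ + 1) → ℝ) (p : Phase m) : Prop :=
  (reduction p).2 = 0 ∧ IsAmendedCriticalPoint b (totalMomentum p) (reduction p).1

lemma reduction_mem_reducedSphere (hm : ∀ σ, 1 ≤ m σ) (hp : p ∈ cotangentSphere m)
    (h : p ∈ regularSet m) : (reduction p).1 ∈ reducedSphere m :=
  ⟨((mem_cotangentSphere_iff hm p).1 hp).1, reduction_fst_pos h⟩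

lemma snd_eq_zero_of_simple (hm : ∀ σ, 1 ≤ m σ) (hη : (reduction p).2 = 0) {σ : Fin (ℓ + 1)}
    (hσ : ¬ 2 ≤ m σ) : p.2 σ = 0 := by
  have := congrFun hη σ
  simp only [reduction, if_neg hσ, Pi.zero_apply] at this
  rw [← toLp_sum_of_eq_one (eq_one_of_not_two_le hm hσ) (p.2 σ)]
  simp only [this]
  rfl

lemma isCriticalPoint_iff_isReducedEquilibrium (hm : ∀ σ, 1 ≤ m σ) (hp : p ∈ cotangentSphere m)
    (hJ : ∀ τ, 0 < totalMomentum p τ) : IsCriticalPoint b p ↔ IsReducedEquilibrium b p := by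
  have h := mem_regularSet hJ
  have hsph := (mem_cotangentSphere_iff hm p).1 hp
  have hS := reduction_mem_reducedSphere hm hp h
  have hpos := reduction_fst_pos h
  have hny := norm_sq_block hm h
  rw [isCriticalPoint_iff hp hJ, IsReducedEquilibrium]
  constructor
  · intro hK
    have hη : (reduction p).2 = 0 := by
      -- The test direction is `a = η`, along which the energy has derivative `∑ η_σ²`.
      obtain ⟨h1, h2, h3⟩ := radial_momentum_mem_kernel (b := b) hm h hsph.2
      have h4 := hK _ h1 h2
      rw [h3] at h4
      have h5 := (Finset.sum_eq_zero_iff_of_nonneg fun σ _ =>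
        mul_self_nonneg ((reduction p).2 σ)).1 h4
      exact funext fun σ => mul_self_eq_zero.1 (h5 σ (Finset.mem_univ _))
    have hxy : ∀ σ, ⟪p.1 σ, p.2 σ⟫ = 0 := fun σ => by
      rw [inner_block hm, hη, Pi.zero_apply, mul_zero]
    refine ⟨hη, hS, fun a ha => ?_⟩
    rw [fderiv_amendedPotential fun τ => (hpos τ).ne']
    -- Scaling `x_τ` up and `y_τ` down at the same rate keeps `x_τ ∧ y_τ` to first order. The energy
    -- derivative along this direction is that of `V_J` along `a`.
    let w : Phase m := (radial p a, fun σ =>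
      if 2 ≤ m σ then (-(a σ / (reduction p).1 σ)) • p.2 σ else 0)
    have hw2 : ∀ σ, 2 ≤ m σ → w.2 σ = (-(a σ / (reduction p).1 σ)) • p.2 σ := fun σ hσ => if_pos hσ
    have hxw : ∀ σ, ⟪p.1 σ, w.2 σ⟫ = 0 := fun σ => by
      by_cases hσ : 2 ≤ m σ
      · rw [hw2 σ hσ, inner_smul_right, hxy, mul_zero]
      · simp [w, hσ]
    have hwy : ∀ σ, ⟪w.1 σ, p.2 σ⟫ = 0 := fun σ => by
      rw [real_inner_comm, inner_radial_snd hm h, hη, Pi.zero_apply, zero_mul]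
    have hxw1 : ∀ σ, ⟪p.1 σ, w.1 σ⟫ = (reduction p).1 σ * a σ := inner_radial hm h a
    have h1 : w ∈ tangentCotangentSphere p := by
      rw [mem_tangentCotangentSphere]
      simp [hxw1, hxw, hwy, ha]
    have h2 : ∀ τ, casimirDeriv p w τ = 0 := fun τ => by
      have := (hpos τ).ne'
      rw [casimirDeriv, hxy, hxw1, hw2 _ τ.2, inner_smul_right, real_inner_self_eq_norm_sq,
        ← real_inner_self_eq_norm_sq (p.1 _), inner_self_block hm]
      field_simp
      ring
    rw [← hK w h1 h2, energyDeriv]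
    refine Finset.sum_congr rfl fun σ _ => ?_
    rw [amendedGradient, hxw1]
    by_cases hσ : 2 ≤ m σ
    · have := (hpos ⟨σ, hσ⟩).ne'
      dsimp only at this
      rw [hw2 σ hσ, inner_smul_right, real_inner_self_eq_norm_sq, hny, hη, Pi.zero_apply]
      field_simp
      ring
    · rw [extendMomentum_simple _ hσ, snd_eq_zero_of_simple hm hη hσ, inner_zero_left]
      ring
  · rintro ⟨hη, hcrit⟩ w hw hw0
    obtain ⟨-, β, hβ⟩ := isAmendedCriticalPoint_iff_exists_multiplier.1 hcrit
    have hxy : ∀ σ, ⟪p.1 σ, p.2 σ⟫ = 0 := fun σ => by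
      rw [inner_block hm, hη, Pi.zero_apply, mul_zero]
    -- With `⟨x, y⟩ = 0`, stationarity of `J_τ` gives `⟨y, w₂⟩ = -(J² / ξ⁴) ⟨x, w₁⟩`, and the
    -- multiplier equation turns the sum into `β ⟨x, w₁⟩`. Tangency to the sphere kills the total.
    have key : ∀ σ, ⟪p.2 σ, w.2 σ⟫ + b σ * ⟪p.1 σ, w.1 σ⟫ = β * ⟪p.1 σ, w.1 σ⟫ := fun σ => by
      have hg := hβ σ
      rw [amendedGradient] at hg
      by_cases hσ : 2 ≤ m σ
      · have h0 := (hpos ⟨σ, hσ⟩).ne'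
        have h1 := hw0 ⟨σ, hσ⟩
        dsimp only at h0
        rw [casimirDeriv, hxy, hny, hη, ← real_inner_self_eq_norm_sq (p.1 _),
          inner_self_block hm] at h1
        simp only [Pi.zero_apply] at h1
        set ξ := (reduction p).1 σ
        set J := extendMomentum (totalMomentum p) σ
        field_simp at hg h1
        have h4 : ξ ^ 4 ≠ 0 := pow_ne_zero 4 h0
        apply mul_left_cancel₀ h4
        linear_combination h1 + ⟪p.1 σ, w.1 σ⟫ * hg
      · rw [extendMomentum_simple _ hσ] at hg
        rw [snd_eq_zero_of_simple hm hη hσ, inner_zero_left, zero_add,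
          inner_of_eq_one (eq_one_of_not_two_le hm hσ)]
        simp only [reduction, if_neg hσ] at hg
        linear_combination (∑ i, w.1 σ i) * hg
    rw [energyDeriv]
    simp only [key, ← Finset.mul_sum, (mem_tangentCotangentSphere.1 hw).1, mul_zero]

lemma inner_toEuclideanLin_skew {k : ℕ} {Ω : Matrix (Fin k) (Fin k) ℝ} (hΩ : Ωᵀ = -Ω)
    (x y : EuclideanSpace ℝ (Fin k)) :
    ⟪Matrix.toEuclideanLin Ω x, y⟫ = -⟪x, Matrix.toEuclideanLin Ω y⟫ := by
  have h : Ωᴴ = -Ω := by rw [Matrix.conjTranspose_eq_transpose_of_trivial, hΩ]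
  have h2 := LinearMap.adjoint_inner_right (Matrix.toEuclideanLin Ω) x y
  rw [← Matrix.toEuclideanLin_conjTranspose_eq_adjoint, h, map_neg, LinearMap.neg_apply,
    inner_neg_right] at h2
  linarith

lemma toEuclideanLin_skew_of_eq_one {k : ℕ} (hk : k = 1) {Ω : Matrix (Fin k) (Fin k) ℝ}
    (hΩ : Ωᵀ = -Ω) : Ω = 0 := by
  subst hk
  ext i l
  have := congrFun (congrFun hΩ i) l
  rw [Subsingleton.elim l i] at this ⊢
  simp only [Matrix.transpose_apply, Matrix.neg_apply, Matrix.zero_apply] at this ⊢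
  linarith

lemma isRelativeEquilibrium_iff_isReducedEquilibrium (hm : ∀ σ, 1 ≤ m σ)
    (hp : p ∈ cotangentSphere m) (hJ : ∀ τ, 0 < totalMomentum p τ) :
    IsRelativeEquilibrium b p ↔ IsReducedEquilibrium b p := by
  have h := mem_regularSet hJ
  have hsph := (mem_cotangentSphere_iff hm p).1 hp
  have hS := reduction_mem_reducedSphere hm hp h
  have hpos := reduction_fst_pos h
  have hny := norm_sq_block hm h
  have hxx : ∀ σ, ‖p.1 σ‖ ^ 2 = (reduction p).1 σ ^ 2 := fun σ => by
    rw [← real_inner_self_eq_norm_sq, inner_self_block hm]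
  rw [IsRelativeEquilibrium, IsReducedEquilibrium]
  constructor
  · rintro ⟨-, Ω, hΩ, hf⟩
    rw [neumannField, Prod.mk.injEq] at hf
    set c := ∑ τ, b τ * ‖p.1 τ‖ ^ 2 - ∑ τ, ‖p.2 τ‖ ^ 2
    have hy : ∀ σ, p.2 σ = Matrix.toEuclideanLin (Ω σ) (p.1 σ) := fun σ => congrFun hf.1 σ
    have hx : ∀ σ, -(b σ • p.1 σ) + c • p.1 σ = Matrix.toEuclideanLin (Ω σ) (p.2 σ) :=
      fun σ => congrFun hf.2 σ
    have hη : (reduction p).2 = 0 := funext fun σ => by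
      by_cases hσ : 2 ≤ m σ
      · have h1 := inner_toEuclideanLin_skew (hΩ σ) (p.1 σ) (p.1 σ)
        rw [← hy, real_inner_comm, inner_block hm] at h1
        have h2 : (reduction p).1 σ * (reduction p).2 σ = 0 := by linarith
        exact (mul_eq_zero.1 h2).resolve_left (hpos ⟨σ, hσ⟩).ne'
      · have := hy σ
        rw [toEuclideanLin_skew_of_eq_one (eq_one_of_not_two_le hm hσ) (hΩ σ), map_zero] at this
        simp [reduction, hσ, this]
    refine ⟨hη, isAmendedCriticalPoint_iff_exists_multiplier.2 ⟨hS, c, fun σ => ?_⟩⟩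
    by_cases hσ : 2 ≤ m σ
    · have h0 := (hpos ⟨σ, hσ⟩).ne'
      -- Pairing `Ωy` with `x` gives `(c - b) ξ² = -‖y‖² = -J² / ξ²`, the multiplier equation with
      -- `β = c`.
      have h1 := inner_toEuclideanLin_skew (hΩ σ) (p.2 σ) (p.1 σ)
      rw [← hy, ← hx, real_inner_self_eq_norm_sq, hny, inner_add_left, inner_neg_left,
        inner_smul_left, inner_smul_left, real_inner_self_eq_norm_sq, hxx, hη] at h1
      simp only [conj_trivial, Pi.zero_apply] at h1
      dsimp only at h0
      rw [amendedGradient]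
      field_simp at h1 ⊢
      linear_combination -h1
    · have := hx σ
      rw [toEuclideanLin_skew_of_eq_one (eq_one_of_not_two_le hm hσ) (hΩ σ), map_zero] at this
      have h2 := congrArg (fun v : EuclideanSpace ℝ (Fin (m σ)) => ∑ i, v i) this
      simp only [PiLp.add_apply, PiLp.neg_apply, PiLp.smul_apply, smul_eq_mul,
        Finset.sum_add_distrib, Finset.sum_neg_distrib, ← Finset.mul_sum, LinearMap.zero_apply,
        PiLp.zero_apply, Finset.sum_const_zero] at h2
      rw [amendedGradient, extendMomentum_simple _ hσ]
      simp only [reduction, if_neg hσ]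
      linear_combination -h2
  · rintro ⟨hη, hcrit⟩
    obtain ⟨-, β, hβ⟩ := isAmendedCriticalPoint_iff_exists_multiplier.1 hcrit
    have hxy : ∀ σ, ⟪p.1 σ, p.2 σ⟫ = 0 := fun σ => by
      rw [inner_block hm, hη, Pi.zero_apply, mul_zero]
    -- Multiply the multiplier equation by `ξ_σ` and sum over the unit sphere.
    have hc : ∑ τ, b τ * ‖p.1 τ‖ ^ 2 - ∑ τ, ‖p.2 τ‖ ^ 2 = β := by
      have h1 : ∀ σ, b σ * ‖p.1 σ‖ ^ 2 - ‖p.2 σ‖ ^ 2 = β * (reduction p).1 σ ^ 2 := fun σ => by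
        have h2 := hβ σ
        rw [hxx, hny, hη, Pi.zero_apply, sq ((reduction p).1 σ), ← mul_assoc β, ← h2,
          amendedGradient]
        by_cases h0 : (reduction p).1 σ = 0
        · simp [h0]
        · field_simp
          ring
      rw [← Finset.sum_sub_distrib]
      simp only [h1, ← Finset.mul_sum, hsph.1, mul_one]
    -- The generator rotates the plane of `x` and `y` so that `x` moves with velocity `y`. In a
    -- simple block `y` vanishes and so does the generator, whatever the inverse of `ξ²` is.
    refine ⟨hp, fun σ => ((reduction p).1 σ ^ 2)⁻¹ • wedge (p.2 σ) (p.1 σ), fun σ => ?_, ?_⟩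
    · rw [Matrix.transpose_smul, wedge_transpose, smul_neg]
    · rw [neumannField, hc]
      refine Prod.ext (funext fun σ => ?_) (funext fun σ => ?_)
      · dsimp only
        rw [map_smul, LinearMap.smul_apply, toEuclideanLin_wedge, real_inner_comm (p.1 σ) (p.2 σ), hxy,
          inner_self_block hm, zero_smul, sub_zero, smul_smul]
        by_cases hσ : 2 ≤ m σ
        · rw [inv_mul_cancel₀ (pow_ne_zero 2 (hpos ⟨σ, hσ⟩).ne'), one_smul]
        · rw [snd_eq_zero_of_simple hm hη hσ, smul_zero]
      · dsimp only
        rw [map_smul, LinearMap.smul_apply, toEuclideanLin_wedge, hxy, zero_smul, zero_sub,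
          smul_neg, smul_smul, ← neg_smul, ← neg_smul, ← add_smul, real_inner_self_eq_norm_sq, hny,
          hη, Pi.zero_apply]
        have h2 := hβ σ
        rw [amendedGradient] at h2
        by_cases hσ : 2 ≤ m σ
        · have h0 := (hpos ⟨σ, hσ⟩).ne'
          dsimp only at h0
          congr 1
          field_simp at h2 ⊢
          linear_combination -h2
        · rw [extendMomentum_simple _ hσ] at h2 ⊢
          rw [← toLp_sum_of_eq_one (eq_one_of_not_two_le hm hσ) (p.1 σ)]
          simp only [reduction, if_neg hσ] at h2 ⊢
          ext i
          simp only [PiLp.smul_apply, smul_eq_mul]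
          linear_combination -h2

end Equilibria

/-! ### Critical values of the Energy–Casimir mapping -/

section CriticalValues

variable {ℓ : ℕ} {m : Fin (ℓ + 1) → ℕ} {b : Fin (ℓ + 1) → ℝ} {j : Mult m → ℝ}

lemma isCriticalValue_iff (hm : ∀ σ, 1 ≤ m σ) (hj : ∀ τ, 0 < j τ) (h : ℝ) :
    IsCriticalValue m b h j ↔ ∃ ξ, IsAmendedCriticalPoint b j ξ ∧ amendedPotential b j ξ = h := by
  constructor
  · rintro ⟨p, hp, he⟩
    have hpf : p ∈ fibre m b h j := ⟨hp.1, he⟩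
    obtain rfl : totalMomentum p = j := congrArg Prod.snd he
    obtain ⟨hη, hcrit⟩ := (isCriticalPoint_iff_isReducedEquilibrium hm hp.1 hj).1 hp
    refine ⟨_, hcrit, ?_⟩
    have h3 := (reduction_mem_reducedLevel hm hj hpf).2.2
    rw [reducedEnergy, hη] at h3
    simpa using h3
  · rintro ⟨ξ, hξ, hh⟩
    obtain ⟨ν, u, hu⟩ := exists_isFrameFamily j
    have hz : ((ξ, 0) : ReducedPhase ℓ) ∈ reducedLevel b h j :=
      ⟨hξ.1, by simp, by simp [reducedEnergy, hh]⟩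
    have hp := reconstruct_mem_fibre hm hj hz hu
    have hR := reduction_reconstruct hm hz.1.2 hu
    obtain ⟨hp1, hp2⟩ := hp
    have hJ : totalMomentum (reconstruct ((ξ, 0) : ReducedPhase ℓ) ν u) = j :=
      congrArg Prod.snd hp2
    refine ⟨_, (isCriticalPoint_iff_isReducedEquilibrium hm hp1 (by rwa [hJ])).2 ?_, hp2⟩
    rw [IsReducedEquilibrium, hR, hJ]
    exact ⟨rfl, hξ⟩

end CriticalValues

/-- The implicit function theorem parametrises the zero set by the kernel; the curve is the image of
the ray through `v`. -/
lemma IsSubmanifoldAt.exists_curve {E : Type*} [NormedAddCommGroup E] [NormedSpace ℝ E]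
    [CompleteSpace E] {S : Set E} {p : E} {L : Submodule ℝ E} (hS : IsSubmanifoldAt S p L)
    (hp : p ∈ S) {v : E} (hv : v ∈ L) :
    ∃ c : ℝ → E, HasDerivAt c v 0 ∧ c 0 = p ∧ ∀ᶠ t in nhds 0, c t ∈ S := by
  obtain ⟨k, g, U, hU, hpU, hg, hSU, hsurj, rfl⟩ := hS
  have hgp : g p = 0 := by
    have : p ∈ S ∩ U := ⟨hp, hpU⟩
    rw [hSU] at this
    exact this.2
  have hgd : HasStrictFDerivAt g (fderiv ℝ g p) p :=
    (hg.contDiffAt (hU.mem_nhds hpU)).hasStrictFDerivAt (by simp)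
  have hr : (fderiv ℝ g p).range = ⊤ := LinearMap.range_eq_top.2 hsurj
  let φ := hgd.implicitFunction g (fderiv ℝ g p) hr (g p)
  have hφ0 : φ 0 = p := hgd.implicitFunction_apply_image hr
  obtain ⟨v', rfl⟩ : ∃ v' : (fderiv ℝ g p).ker, v'.1 = v := ⟨⟨v, hv⟩, rfl⟩
  have hl : HasDerivAt (fun t : ℝ => t • v') v' 0 := by
    simpa using (hasDerivAt_id (0 : ℝ)).smul_const v'
  have hφ : HasFDerivAt φ (fderiv ℝ g p).ker.subtypeL ((0 : ℝ) • v') := by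
    rw [zero_smul]
    exact (hgd.to_implicitFunction hr).hasFDerivAt
  have hc := hφ.comp_hasDerivAt (0 : ℝ) hl
  have hc0 : φ ((0 : ℝ) • v') = p := by rw [zero_smul, hφ0]
  refine ⟨fun t => φ (t • v'), hc, hc0, ?_⟩
  have h1 : ∀ᶠ t : ℝ in nhds 0, φ (t • v') ∈ U := by
    refine hc.continuousAt.eventually (hU.mem_nhds ?_)
    rwa [Function.comp_apply, hc0]
  have ht : Filter.Tendsto (fun t : ℝ => (g p, t • v')) (nhds 0)
      (nhds (g p, 0)) := by
    refine tendsto_const_nhds.prodMk_nhds ?_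
    simpa using hl.continuousAt.tendsto
  have h2 := ht.eventually (hgd.map_implicitFunction_eq hr)
  filter_upwards [h1, h2] with t ht1 ht2
  have : φ (t • v') ∈ S ∩ U := by
    rw [hSU]
    exact ⟨ht1, ht2.trans hgp⟩
  exact this.1

/-! ### Weak regularity forces positive momenta -/

section Positivity

variable {ℓ : ℕ} {m : Fin (ℓ + 1) → ℕ} {b : Fin (ℓ + 1) → ℝ} {h : ℝ} {j : Mult m → ℝ}

lemma not_differentiableAt_of_line {E : Type*} [NormedAddCommGroup E] [NormedSpace ℝ E]
    {f : E → ℝ} {p w : E} {c : ℝ} (hc : c ≠ 0) (h : ∀ t : ℝ, f (p + t • w) = |t| * c) :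
    ¬ DifferentiableAt ℝ f p := by
  intro hf
  have hl : DifferentiableAt ℝ (fun t : ℝ => p + t • w) 0 := by fun_prop
  have hf' : DifferentiableAt ℝ f (p + (0 : ℝ) • w) := by simpa using hf
  have h1 : DifferentiableAt ℝ (fun t : ℝ => f (p + t • w)) 0 := hf'.comp (0 : ℝ) hl
  have h2 := h1.mul_const c⁻¹
  simp only [h, mul_assoc, mul_inv_cancel₀ hc, mul_one] at h2
  exact not_differentiableAt_abs_zero h2

lemma sqrt_upperSq_smul {k : ℕ} (t : ℝ) (A : Matrix (Fin k) (Fin k) ℝ) :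
    √(upperSq (t • A)) = |t| * √(upperSq A) := by
  rw [upperSq_smul, Real.sqrt_mul (sq_nonneg t), Real.sqrt_sq_eq_abs]

lemma wedge_eq_zero_of_upperSq {k : ℕ} {x y : EuclideanSpace ℝ (Fin k)}
    (h : upperSq (wedge x y) = 0) : wedge x y = 0 := by
  have h1 := two_mul_upperSq (wedge_transpose x y)
  rw [h, mul_zero, ← Matrix.conjTranspose_eq_transpose_of_trivial] at h1
  exact Matrix.trace_conjTranspose_mul_self_eq_zero_iff.1 h1.symm

lemma wedge_swap {k : ℕ} (x y : EuclideanSpace ℝ (Fin k)) : wedge y x = -wedge x y := by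
  ext i l
  simp only [wedge_apply, Matrix.neg_apply]
  ring

lemma upperSq_neg {k : ℕ} (A : Matrix (Fin k) (Fin k) ℝ) : upperSq (-A) = upperSq A := by
  simp [upperSq]

/-- Vanishing of `J_τ` means `x ∧ y = 0`. If one of the two vectors is nonzero, moving the other by
`t v`, with `v` a unit vector orthogonal to the nonzero one, makes `J_τ` a nonzero multiple of
`|t|`. -/
lemma block_eq_zero {p : Phase m} {τ : Mult m} (h0 : totalMomentum p τ = 0)
    (hd : DifferentiableAt ℝ (fun q : Phase m => totalMomentum q τ) p) :
    p.1 τ.1 = 0 ∧ p.2 τ.1 = 0 := by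
  have hw : wedge (p.1 τ.1) (p.2 τ.1) = 0 :=
    wedge_eq_zero_of_upperSq ((totalMomentum_eq_iff le_rfl).1 h0 |>.trans (by norm_num))
  have hpair : ∀ x : EuclideanSpace ℝ (Fin (m τ.1)), x ≠ 0 →
      ∃ v, √(upperSq (wedge x v)) ≠ 0 := fun x hx => by
    obtain ⟨v, hv, hxv⟩ := exists_unit_inner_eq_zero τ.2 x
    refine ⟨v, ?_⟩
    rw [upperSq_wedge, hv, hxv]
    simpa using hx
  constructor
  · by_contra hx
    obtain ⟨v, hv⟩ := hpair _ hx
    refine not_differentiableAt_of_line (w := ((0, Pi.single τ.1 v) : Phase m)) hv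
      (fun t => ?_) hd
    have : momentum (p + t • ((0, Pi.single τ.1 v) : Phase m)) τ = t • wedge (p.1 τ.1) v := by
      have := wedge_add_smul_right (p.1 τ.1) (p.2 τ.1) v t
      rw [hw, zero_add] at this
      rw [momentum_eq_wedge, ← this]
      simp
    rw [← sqrt_upperSq_smul, ← this]
    rfl
  · by_contra hy
    obtain ⟨v, hv⟩ := hpair _ hy
    refine not_differentiableAt_of_line (w := ((Pi.single τ.1 v, 0) : Phase m)) hv
      (fun t => ?_) hd
    have : momentum (p + t • ((Pi.single τ.1 v, 0) : Phase m)) τ =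
        t • -wedge (p.2 τ.1) v := by
      have := wedge_add_smul_left (p.1 τ.1) (p.2 τ.1) v t
      rw [hw, zero_add, wedge_swap (p.2 τ.1) v] at this
      rw [momentum_eq_wedge, ← this]
      simp
    rw [← upperSq_neg, ← sqrt_upperSq_smul, ← this]
    rfl

lemma IsWeaklyRegularValue.pos (hreg : IsWeaklyRegularValue m b h j)
    (hne : (fibre m b h j).Nonempty) (τ : Mult m) : 0 < j τ := by
  obtain ⟨p, hp⟩ := hne
  have hJ : ∀ q ∈ fibre m b h j, totalMomentum q = j := fun q hq => congrArg Prod.snd hq.2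
  by_contra hneg
  have hj0 : j τ = 0 := le_antisymm (not_lt.1 hneg) (by rw [← hJ p hp]; exact totalMomentum_nonneg _ _)
  have hzero : ∀ q ∈ fibre m b h j, q.1 τ.1 = 0 ∧ q.2 τ.1 = 0 := fun q hq =>
    block_eq_zero (by rw [hJ q hq, hj0]) (differentiableAt_pi.1 (hreg q hq).1.snd τ)
  obtain ⟨hx, hy⟩ := hzero p hp
  obtain ⟨v, v', hv⟩ := exists_isPair τ.2
  have hv1 := hv.1
  -- As `x_τ = 0`, moving `y_τ` alone leaves all `J` constant; as `y_τ = 0`, it leaves the energy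
  -- constant to first order.
  let w : Phase m := (0, Pi.single τ.1 v)
  have hinner : ∀ x : Config m, x τ.1 = 0 → ∀ σ, ⟪x σ, w.2 σ⟫ = 0 := fun x hx σ => by
    by_cases hσ : σ = τ.1
    · subst hσ; rw [hx, inner_zero_left]
    · rw [show w.2 σ = 0 by simp [w, hσ], inner_zero_right]
  have hw : w ∈ tangentCotangentSphere p := by
    rw [mem_tangentCotangentSphere]
    simp only [hinner _ hx]
    simp [w]
  have hJw : ∀ t : ℝ, totalMomentum (p + t • w) = totalMomentum p := fun t => by
    funext τ'
    have : momentum (p + t • w) τ' = momentum p τ' := by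
      rw [momentum_eq_wedge, momentum_eq_wedge]
      by_cases hσ : τ' = τ
      · subst hσ
        rw [show (p + t • w).1 τ'.1 = p.1 τ'.1 by simp [w], hx]
        ext i l
        simp [wedge_apply]
      · rw [show (p + t • w).1 τ'.1 = p.1 τ'.1 by simp [w], show (p + t • w).2 τ'.1 = p.2 τ'.1 by
          simp [w, Pi.single_eq_of_ne (fun e => hσ (Subtype.ext e) : τ'.1 ≠ τ.1)]]
    rw [totalMomentum, this]
    rfl
  have hE : energyDeriv b p w = 0 := by
    rw [energyDeriv]
    simp only [hinner _ hy]
    simp [w]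
  have hd : fderiv ℝ (energyCasimir b) p w = 0 := by
    refine fderiv_apply_eq_of_hasDerivAt (hreg p hp).1 ?_
    simp only [energyCasimir, hJw]
    have h1 := hasDerivAt_energy (b := b) p w
    rw [hE] at h1
    exact h1.prodMk (hasDerivAt_const _ _)
  -- So some curve in the fibre has `y_τ`-velocity `v ≠ 0`, although `y_τ` vanishes on the whole
  -- fibre.
  obtain ⟨c, hc, -, hcF⟩ := (hreg p hp).2.exists_curve hp (v := w)
    ⟨hw, LinearMap.mem_ker.2 hd⟩
  have h2 : HasDerivAt (fun t => (c t).2 τ.1) v 0 := by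
    have := hasDerivAt_pi.1 hc.snd τ.1
    simpa [w] using this
  have h3 : HasDerivAt (fun t => (c t).2 τ.1) 0 0 :=
    (hasDerivAt_const (0 : ℝ) (0 : EuclideanSpace ℝ (Fin (m τ.1)))).congr_of_eventuallyEq
      (hcF.mono fun t ht => (hzero _ ht).2)
  have := h2.unique h3
  rw [this, norm_zero] at hv1
  exact zero_ne_one hv1

end Positivity

/-! ### Smoothness of the reduced level set -/

section ReducedLevel

variable {ℓ : ℕ} {m : Fin (ℓ + 1) → ℕ} {b : Fin (ℓ + 1) → ℝ} {h : ℝ} {j : Mult m → ℝ}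

lemma reduction_line (hm : ∀ σ, 1 ≤ m σ) {p : Phase m} (hp : p ∈ regularSet m)
    (a : Fin (ℓ + 1) → ℝ) (t : ℝ) :
    reduction (p + t • ((0, radial p a) : Phase m)) =
      ((reduction p).1, (reduction p).2 + t • a) := by
  have h1 : (p + t • ((0, radial p a) : Phase m)).1 = p.1 := by simp
  have h2 : (p + t • ((0, radial p a) : Phase m)).2 = p.2 + t • radial p a := rfl
  refine Prod.ext (by simp only [reduction, h1]) (funext fun σ => ?_)
  by_cases hσ : 2 ≤ m σ
  · have h0 := norm_ne_zero_iff.2 (hp ⟨σ, hσ⟩)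
    dsimp only at h0
    simp only [reduction, h1, h2, Pi.add_apply, Pi.smul_apply, inner_add_right, inner_smul_right,
      inner_radial hm hp, if_pos hσ, smul_eq_mul]
    field_simp
  · simp only [reduction, h2, Pi.add_apply, Pi.smul_apply, if_neg hσ, radial, PiLp.add_apply,
      PiLp.smul_apply, smul_eq_mul, Finset.sum_add_distrib]
    simp [eq_one_of_not_two_le hm hσ]

/-- The multiplier equation cancels the first-order term, leaving a double zero at `ξ_σ`. In a
multiple block `j² = (b - β) ξ⁴` turns the left side into `(b - β) (x² - ξ²)² / x²`; in a simple one
`(b - β) ξ = 0`. -/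
lemma exists_second_order_factor {ξ : Fin (ℓ + 1) → ℝ} {β : ℝ}
    (hpos : ∀ τ : Mult m, 0 < ξ τ.1) (hβ : ∀ σ, amendedGradient b j ξ σ = β * ξ σ)
    (σ : Fin (ℓ + 1)) : ∃ K : ℝ → ℝ, ContinuousAt K (ξ σ) ∧ ∀ x, (2 ≤ m σ → 0 < x) →
      (b σ * x ^ 2 + extendMomentum j σ ^ 2 / x ^ 2) -
        (b σ * ξ σ ^ 2 + extendMomentum j σ ^ 2 / ξ σ ^ 2) - β * (x ^ 2 - ξ σ ^ 2) =
      (x - ξ σ) ^ 2 * K x := by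
  have hg := hβ σ
  rw [amendedGradient] at hg
  by_cases hσ : 2 ≤ m σ
  · have h0 := (hpos ⟨σ, hσ⟩).ne'
    dsimp only at h0
    refine ⟨fun x => (b σ - β) * (x + ξ σ) ^ 2 / x ^ 2, ContinuousAt.div (by fun_prop)
      (by fun_prop) (pow_ne_zero 2 h0), fun x hx => ?_⟩
    have hx0 := (hx hσ).ne'
    have e : extendMomentum j σ ^ 2 = (b σ - β) * ξ σ ^ 4 := by
      field_simp at hg
      linear_combination -hg
    rw [e]
    field_simp
    ring
  · refine ⟨fun _ => b σ - β, continuousAt_const, fun x _ => ?_⟩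
    rw [extendMomentum_simple j hσ] at hg ⊢
    linear_combination (2 * x - 2 * ξ σ) * hg

/-- On the sphere, subtracting `β ∑ ξ_σ²` does not affect energy differences, so along the curve `∑
η_σ²` plus terms quadratic in the displacement of `ξ` is zero. That displacement is `o(t)`; dividing
by `t²` leaves `∑ a_σ² = 0`. -/
lemma not_critical_of_curve {ξ a : Fin (ℓ + 1) → ℝ}
    (hξ : IsAmendedCriticalPoint b j ξ) (hz : ((ξ, 0) : ReducedPhase ℓ) ∈ reducedLevel b h j)
    {z : ℝ → ReducedPhase ℓ} (hz0 : z 0 = (ξ, 0)) (hd : HasDerivAt z (0, a) 0)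
    (hzN : ∀ᶠ t in nhds 0, z t ∈ reducedLevel b h j) : a = 0 := by
  obtain ⟨hS, β, hβ⟩ := isAmendedCriticalPoint_iff_exists_multiplier.1 hξ
  choose K hK hKe using exists_second_order_factor hS.2 hβ
  have h1 : ∀ σ, HasDerivAt (fun t => (z t).1 σ) 0 0 := fun σ => hasDerivAt_pi.1 hd.fst σ
  have h2 : ∀ σ, HasDerivAt (fun t => (z t).2 σ) (a σ) 0 := fun σ => hasDerivAt_pi.1 hd.snd σ
  have e1 : ∀ σ, (z 0).1 σ = ξ σ := fun σ => by rw [hz0]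
  have e2 : ∀ σ, (z 0).2 σ = 0 := fun σ => by rw [hz0]; rfl
  have l1 : ∀ σ, Filter.Tendsto (fun t : ℝ => t⁻¹ * ((z t).1 σ - ξ σ)) (nhdsWithin 0 {0}ᶜ)
      (nhds 0) := fun σ => by
    simpa only [zero_add, e1, smul_eq_mul] using (h1 σ).tendsto_slope_zero
  have l2 : ∀ σ, Filter.Tendsto (fun t : ℝ => t⁻¹ * (z t).2 σ) (nhdsWithin 0 {0}ᶜ)
      (nhds (a σ)) := fun σ => by
    simpa only [zero_add, e2, sub_zero, smul_eq_mul] using (h2 σ).tendsto_slope_zero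
  have l3 : ∀ σ, Filter.Tendsto (fun t : ℝ => K σ ((z t).1 σ)) (nhdsWithin 0 {0}ᶜ)
      (nhds (K σ (ξ σ))) := fun σ => by
    have hc : Filter.Tendsto (fun t => (z t).1 σ) (nhds 0) (nhds (ξ σ)) := by
      simpa only [e1] using (h1 σ).continuousAt.tendsto
    exact ((hK σ).tendsto.comp hc).mono_left nhdsWithin_le_nhds
  have lim := tendsto_finsetSum Finset.univ fun σ _ =>
    ((l2 σ).pow 2).add (((l1 σ).pow 2).mul (l3 σ))
  have hev : ∀ᶠ t : ℝ in nhdsWithin 0 {0}ᶜ, ∑ σ, ((t⁻¹ * (z t).2 σ) ^ 2 +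
      (t⁻¹ * ((z t).1 σ - ξ σ)) ^ 2 * K σ ((z t).1 σ)) = 0 := by
    filter_upwards [hzN.filter_mono nhdsWithin_le_nhds] with t ht
    have hk : ∀ σ, (t⁻¹ * (z t).2 σ) ^ 2 + (t⁻¹ * ((z t).1 σ - ξ σ)) ^ 2 * K σ ((z t).1 σ) =
        t⁻¹ ^ 2 * ((z t).2 σ ^ 2 + ((b σ * (z t).1 σ ^ 2 + extendMomentum j σ ^ 2 / (z t).1 σ ^ 2) -
        (b σ * ξ σ ^ 2 + extendMomentum j σ ^ 2 / ξ σ ^ 2) -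
          β * ((z t).1 σ ^ 2 - ξ σ ^ 2))) := fun σ => by
      rw [hKe σ _ fun hσ => ht.1.2 ⟨σ, hσ⟩]
      ring
    simp only [hk, ← Finset.mul_sum]
    rw [Finset.sum_add_distrib, Finset.sum_sub_distrib, Finset.sum_sub_distrib, ← Finset.mul_sum,
      Finset.sum_sub_distrib, ht.1.1, hS.1]
    have q1 := ht.2.2
    have q2 := hz.2.2
    simp only [reducedEnergy, amendedPotential] at q1 q2
    simp only [Pi.zero_apply, ne_eq, OfNat.ofNat_ne_zero, not_false_eq_true, zero_pow,
      Finset.sum_const_zero, mul_zero, zero_add] at q2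
    have : ∑ σ, (z t).2 σ ^ 2 + (∑ σ, (b σ * (z t).1 σ ^ 2 +
        extendMomentum j σ ^ 2 / (z t).1 σ ^ 2) -
        ∑ σ, (b σ * ξ σ ^ 2 + extendMomentum j σ ^ 2 / ξ σ ^ 2) - β * (1 - 1)) = 0 := by
      linarith
    rw [this, mul_zero]
  have h0 := tendsto_nhds_unique (lim.congr' (hev.mono fun t ht => ht)) tendsto_const_nhds
  simp only [ne_eq, OfNat.ofNat_ne_zero, not_false_eq_true, zero_pow, zero_mul, add_zero] at h0
  have h5 := (Finset.sum_eq_zero_iff_of_nonneg fun σ _ => sq_nonneg (a σ)).1 h0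
  exact funext fun σ => pow_eq_zero_iff two_ne_zero |>.1 (h5 σ (Finset.mem_univ _))

lemma IsWeaklyRegularValue.not_critical (hm : ∀ σ, 1 ≤ m σ) (hdeg : ∃ σ, 2 ≤ m σ) (hℓ : 0 < ℓ)
    (hreg : IsWeaklyRegularValue m b h j) (hj : ∀ τ, 0 < j τ) {ξ : Fin (ℓ + 1) → ℝ}
    (hz : ((ξ, 0) : ReducedPhase ℓ) ∈ reducedLevel b h j) : ¬ IsAmendedCriticalPoint b j ξ := by
  intro hξ
  obtain ⟨ν, u, hu⟩ := exists_isFrameFamily j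
  have hp := reconstruct_mem_fibre hm hj hz hu
  have hR := reduction_reconstruct hm hz.1.2 hu
  generalize reconstruct ((ξ, 0) : ReducedPhase ℓ) ν u = p at hp hR
  have hreg' := fibre_subset_regularSet hj hp
  have hJ : totalMomentum p = j := congrArg Prod.snd hp.2
  obtain ⟨τ, hτ⟩ := hdeg
  have : Nontrivial (Fin (ℓ + 1)) := Fin.nontrivial_iff_two_le.2 (by omega)
  obtain ⟨σ, hσ⟩ := exists_ne τ
  -- This is tangent to the sphere at `ξ`, and nonzero because `ξ_τ > 0`. A second index exists
  -- since `ℓ > 0`.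
  let a : Fin (ℓ + 1) → ℝ := Pi.single σ (ξ τ) - Pi.single τ (ξ σ)
  have haσ : a σ = ξ τ := by simp [a, hσ]
  have ha : ∑ i, (reduction p).1 i * a i = 0 := by
    rw [hR]
    simp only [a, Pi.sub_apply, mul_sub, Finset.sum_sub_distrib, Pi.single_apply, mul_ite,
      mul_zero, Finset.sum_ite_eq', Finset.mem_univ, if_true]
    ring
  obtain ⟨h1, h2, h3⟩ := radial_momentum_mem_kernel (b := b) hm hreg' ha
  have hd : fderiv ℝ (energyCasimir b) p (0, radial p a) = 0 := by
    rw [fderiv_energyCasimir (by rwa [hJ]), h3, hR]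
    simp only [h2, zero_div, Pi.zero_apply, zero_mul, Finset.sum_const_zero]
    rfl
  obtain ⟨c, hc, hc0, hcF⟩ := (hreg p hp).2.exists_curve hp (v := (0, radial p a))
    ⟨h1, LinearMap.mem_ker.2 hd⟩
  have hRd : DifferentiableAt ℝ (reduction : Phase m → ReducedPhase ℓ) p :=
    (contDiffOn_reduction.contDiffAt (isOpen_regularSet.mem_nhds hreg')).differentiableAt (by simp)
  have hRw : fderiv ℝ (reduction : Phase m → ReducedPhase ℓ) p (0, radial p a) = (0, a) := by
    refine fderiv_apply_eq_of_hasDerivAt hRd ?_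
    simp only [reduction_line hm hreg']
    refine (hasDerivAt_const _ _).prodMk ?_
    simpa using ((hasDerivAt_id (0 : ℝ)).smul_const a).const_add (reduction p).2
  have hRf : HasFDerivAt (reduction : Phase m → ReducedPhase ℓ) (fderiv ℝ reduction p) (c 0) := by
    rw [hc0]; exact hRd.hasFDerivAt
  have hzd := hRf.comp_hasDerivAt (0 : ℝ) hc
  rw [hRw] at hzd
  have h0 := not_critical_of_curve hξ hz (z := fun t => reduction (c t))
    (by rw [hc0, hR]) hzd (hcF.mono fun t ht => reduction_mem_reducedLevel hm hj ht)
  rw [h0] at haσ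
  exact (hz.1.2 ⟨τ, hτ⟩).ne haσ

lemma isSubmanifoldAt_reducedLevel_of_not_critical {z : ReducedPhase ℓ}
    (hz : z ∈ reducedLevel b h j) (hnc : z.2 = 0 → ¬ IsAmendedCriticalPoint b j z.1) :
    ∃ L, IsSubmanifoldAt (reducedLevel b h j) z L := by
  have hne : ∀ q : ReducedPhase ℓ, (∀ τ : Mult m, 0 < q.1 τ.1) → ∀ τ : Mult m, q.1 τ.1 ≠ 0 :=
    fun q hq τ => (hq τ).ne'
  let g : ReducedPhase ℓ → Fin 3 → ℝ := fun q =>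
    ![∑ σ, q.1 σ ^ 2 - 1, ∑ σ, q.1 σ * q.2 σ, reducedEnergy b j q - h]
  let U : Set (ReducedPhase ℓ) := {q | ∀ τ : Mult m, 0 < q.1 τ.1}
  have hU : IsOpen U := by
    simp only [U, Set.ofPred_forall]
    exact isOpen_iInter_of_finite fun τ => isOpen_lt continuous_const (by fun_prop)
  have hgU : ContDiffOn ℝ ∞ g U := by
    refine contDiffOn_pi.2 fun i => ?_
    fin_cases i
    · exact ContDiff.contDiffOn (by simp only [g]; simp; fun_prop)
    · exact ContDiff.contDiffOn (by simp only [g]; simp; fun_prop)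
    · intro q hq
      have hV : ContDiffAt ℝ ∞ (fun q : ReducedPhase ℓ => amendedPotential b j q.1) q :=
        (contDiffAt_amendedPotential (hne q hq)).comp q contDiffAt_fst
      have hT : ContDiffAt ℝ ∞ (fun q : ReducedPhase ℓ => (1 / 2 : ℝ) * ∑ σ, q.2 σ ^ 2) q := by
        fun_prop
      exact ((hT.add hV).sub contDiffAt_const).contDiffWithinAt
  have hzU : z ∈ U := hz.1.2
  have hgd : DifferentiableAt ℝ g z :=
    (hgU.contDiffAt (hU.mem_nhds hzU)).differentiableAt (by simp)
  have hder : ∀ w : ReducedPhase ℓ, fderiv ℝ g z w = ![∑ σ, 2 * (z.1 σ * w.1 σ),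
      ∑ σ, (w.1 σ * z.2 σ + z.1 σ * w.2 σ),
      ∑ σ, z.2 σ * w.2 σ + fderiv ℝ (amendedPotential b j) z.1 w.1] := fun w => by
    refine fderiv_apply_eq_of_hasDerivAt hgd (hasDerivAt_pi.2 fun i => ?_)
    have hl : ∀ x v : ℝ, HasDerivAt (fun t : ℝ => x + t * v) v 0 := fun x v => by
      simpa using ((hasDerivAt_id (0 : ℝ)).mul_const v).const_add x
    have hsq : ∀ x v : ℝ, HasDerivAt (fun t : ℝ => (x + t * v) ^ 2) (2 * (x * v)) 0 := fun x v => by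
      refine ((hl x v).pow 2).congr_deriv ?_
      push_cast
      ring
    fin_cases i
    · exact (HasDerivAt.fun_sum fun σ _ => hsq (z.1 σ) (w.1 σ)).sub_const 1
    · refine (HasDerivAt.fun_sum (u := Finset.univ) fun σ _ =>
        (hl (z.1 σ) (w.1 σ)).mul (hl (z.2 σ) (w.2 σ))).congr_deriv ?_
      simp
    · have hT := (HasDerivAt.fun_sum (u := Finset.univ) fun σ _ =>
        hsq (z.2 σ) (w.2 σ)).const_mul (1 / 2 : ℝ)
      rw [← Finset.mul_sum, ← mul_assoc, one_div_mul_cancel two_ne_zero, one_mul] at hT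
      have hV : HasFDerivAt (amendedPotential b j) (fderiv ℝ (amendedPotential b j) z.1)
          (z.1 + (0 : ℝ) • w.1) := by
        simpa using ((contDiffAt_amendedPotential (hne z hzU)).differentiableAt
          (by simp)).hasFDerivAt
      have hV' := hV.comp_hasDerivAt (0 : ℝ)
        (by simpa using ((hasDerivAt_id (0 : ℝ)).smul_const w.1).const_add z.1 :
          HasDerivAt (fun t : ℝ => z.1 + t • w.1) w.1 0)
      exact (hT.add hV').sub_const h
  refine ⟨_, 3, g, U, hU, hzU, hgU, ?_, ?_, rfl⟩
  · ext q
    simp only [reducedLevel, reducedSphere, g, U, Set.mem_inter_iff, Set.mem_ofPred_eq]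
    rw [funext_iff, Fin.forall_fin_succ, Fin.forall_fin_succ, Fin.forall_fin_one]
    simp [sub_eq_zero]
    tauto
  -- It suffices to find one direction that respects the two constraints and changes the energy:
  -- `(ξ, 0)` and `(0, ξ)` take care of the constraints. If `η ≠ 0`, the direction `(0, η)` works;
  -- otherwise one along which `V_j` is not stationary.
  · obtain ⟨w, hw1, hw2, hw3⟩ : ∃ w : ReducedPhase ℓ, ∑ σ, 2 * (z.1 σ * w.1 σ) = 0 ∧
        ∑ σ, (w.1 σ * z.2 σ + z.1 σ * w.2 σ) = 0 ∧
        ∑ σ, z.2 σ * w.2 σ + fderiv ℝ (amendedPotential b j) z.1 w.1 ≠ 0 := by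
      by_cases hη : z.2 = 0
      · have hn := hnc hη
        rw [IsAmendedCriticalPoint] at hn
        push Not at hn
        obtain ⟨a, ha, ha'⟩ := hn hz.1
        refine ⟨(a, 0), ?_, ?_, ?_⟩
        · rw [← Finset.mul_sum, ha, mul_zero]
        · simp [hη]
        · simpa using ha'
      · refine ⟨(0, z.2), by simp, by simpa using hz.2.1, ?_⟩
        simp only [map_zero, add_zero]
        intro h0
        have h5 := (Finset.sum_eq_zero_iff_of_nonneg fun σ _ => mul_self_nonneg (z.2 σ)).1 h0
        exact hη (funext fun σ => mul_self_eq_zero.1 (h5 σ (Finset.mem_univ _)))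
    intro c
    let s := c 2 - (c 0 / 2) * fderiv ℝ (amendedPotential b j) z.1 z.1
    have hξξ : ∑ σ, z.1 σ * z.1 σ = 1 := by simpa only [sq] using hz.1.1
    have hξη : ∑ σ, z.1 σ * z.2 σ = 0 := hz.2.1
    have hηξ : ∑ σ, z.2 σ * z.1 σ = 0 := by simpa only [mul_comm] using hz.2.1
    refine ⟨(c 0 / 2) • (z.1, 0) + c 1 • (0, z.1) + (s / (∑ σ, z.2 σ * w.2 σ +
      fderiv ℝ (amendedPotential b j) z.1 w.1)) • w, ?_⟩
    rw [map_add, map_add, map_smul, map_smul, map_smul, hder, hder, hder, hw1, hw2]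
    ext i
    fin_cases i
    · simp [← Finset.mul_sum, hξξ]
    · simp [hξη, hξξ]
    · simp [hηξ, s]
      field_simp
      ring

/-- With a single block the constraints alone leave the point `ξ = 1`, `η = 0`. The three defining
equations cannot be independent in dimension two, so two linear ones replace them. -/
lemma isSubmanifoldAt_reducedLevel_zero {m : Fin (0 + 1) → ℕ} (hdeg : ∃ σ, 2 ≤ m σ)
    {b : Fin (0 + 1) → ℝ} {j : Mult m → ℝ} {z : ReducedPhase 0} (hz : z ∈ reducedLevel b h j) :
    ∃ L, IsSubmanifoldAt (reducedLevel b h j) z L := by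
  have hsub : Subsingleton (Fin (0 + 1)) := inferInstanceAs (Subsingleton (Fin 1))
  have h0 : 2 ≤ m 0 := by
    obtain ⟨σ, hσ⟩ := hdeg
    rwa [Subsingleton.elim σ 0] at hσ
  have hval : ∀ q ∈ reducedLevel b h j, q.1 0 = 1 ∧ q.2 0 = 0 := fun q hq => by
    have h1 := hq.1.1
    have h2 := hq.1.2 ⟨0, h0⟩
    have h3 := hq.2.1
    rw [Fintype.sum_subsingleton _ 0] at h1 h3
    dsimp only at h2
    have h4 : q.1 0 = 1 := (pow_eq_one_iff_of_nonneg h2.le two_ne_zero).1 h1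
    rw [h4, one_mul] at h3
    exact ⟨h4, h3⟩
  let g : ReducedPhase 0 → Fin 2 → ℝ := fun q => ![q.1 0 - 1, q.2 0]
  have hg : ContDiff ℝ ∞ g := by
    refine contDiff_pi.2 fun i => ?_
    fin_cases i
    · simp only [g]; simp; fun_prop
    · simp only [g]; simp; fun_prop
  have hder : ∀ w : ReducedPhase 0, fderiv ℝ g z w = ![w.1 0, w.2 0] := fun w => by
    refine fderiv_apply_eq_of_hasDerivAt (hg.differentiable (by simp) z)
      (hasDerivAt_pi.2 fun i => ?_)
    have hl : ∀ x v : ℝ, HasDerivAt (fun t : ℝ => x + t * v) v 0 := fun x v => by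
      simpa using ((hasDerivAt_id (0 : ℝ)).mul_const v).const_add x
    fin_cases i
    · exact (hl (z.1 0) (w.1 0)).sub_const 1
    · exact hl (z.2 0) (w.2 0)
  refine ⟨_, 2, g, Set.univ, isOpen_univ, Set.mem_univ _, hg.contDiffOn, ?_, fun c => ?_, rfl⟩
  · ext q
    simp only [Set.inter_univ, Set.mem_univ, true_and, Set.mem_ofPred_eq]
    constructor
    · intro hq
      obtain ⟨h1, h2⟩ := hval q hq
      ext i
      fin_cases i <;> simp [g, h1, h2]
    · intro hq
      have h1 : q.1 0 = 1 := sub_eq_zero.1 (congrFun hq 0)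
      have h2 : q.2 0 = 0 := congrFun hq 1
      obtain ⟨h3, h4⟩ := hval z hz
      have : q = z := by
        refine Prod.ext (funext fun σ => ?_) (funext fun σ => ?_)
        · rw [Subsingleton.elim σ 0, h1, h3]
        · rw [Subsingleton.elim σ 0, h2, h4]
      rwa [this]
  · refine ⟨(fun _ => c 0, fun _ => c 1), ?_⟩
    rw [hder]
    ext i
    fin_cases i <;> rfl

lemma IsWeaklyRegularValue.isSubmanifold_reducedLevel (hm : ∀ σ, 1 ≤ m σ) (hdeg : ∃ σ, 2 ≤ m σ)
    (hreg : IsWeaklyRegularValue m b h j) (hj : ∀ τ, 0 < j τ) :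
    IsSubmanifold (reducedLevel b h j) := by
  intro z hz
  rcases Nat.eq_zero_or_pos ℓ with rfl | hℓ
  · exact isSubmanifoldAt_reducedLevel_zero hdeg hz
  · refine isSubmanifoldAt_reducedLevel_of_not_critical hz fun hη => ?_
    obtain ⟨ξ, η⟩ := z
    dsimp only at hη
    subst hη
    exact hreg.not_critical hm hdeg hℓ hj hz

end ReducedLevel

end DegenerateNeumann

/-! ### Assembly of the theorem -/

open DegenerateNeumann
theorem mainTheorem7 {ℓ : ℕ} (b : Fin (ℓ + 1) → ℝ) (m : Fin (ℓ + 1) → ℕ)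
    (hb : StrictMono b) (hm : ∀ σ, 1 ≤ m σ) (hdeg : ∃ σ, 2 ≤ m σ) :
    -- the double bundle structure of the weakly regular fibres
    (∀ (h : ℝ) (j : Mult m → ℝ), (fibre m b h j).Nonempty → IsWeaklyRegularValue m b h j →
      (∀ q : Phase m, totalMomentum q = j →
        fibre m b h j = {p ∈ cotangentSphere m |
          energy b p = h ∧ momentum p ∈ coadjointOrbit (momentum q)}) ∧
      Function.Injective (scaledPlucker j) ∧
      momentum '' fibre m b h j = Set.range (scaledPlucker j) ∧
      reduction '' fibre m b h j = reducedLevel b h j ∧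
      IsSubmanifold (reducedLevel b h j) ∧
      (∀ z ∈ reducedLevel b h j,
        IsSmoothFibreBundle (fibre m b h j) reduction (reducedLevel b h j)
          {p ∈ fibre m b h j | reduction p = z} ∧
        IsSmoothFibreBundle {p ∈ fibre m b h j | reduction p = z} momentum
          (Set.range (scaledPlucker j)) (torus (Mult m))) ∧
      (∀ ν ∈ Set.range (scaledPlucker j),
        IsSmoothFibreBundle (fibre m b h j) momentum (Set.range (scaledPlucker j))
          {p ∈ fibre m b h j | momentum p = ν} ∧
        IsSmoothFibreBundle {p ∈ fibre m b h j | momentum p = ν} reduction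
          (reducedLevel b h j) (torus (Mult m)))) ∧
    -- relative equilibria, critical points of the mapping and of the amended potential
    (∀ p ∈ cotangentSphere m, (∀ τ, 0 < totalMomentum p τ) →
      (IsRelativeEquilibrium b p ↔
        (reduction p).2 = 0 ∧ IsAmendedCriticalPoint b (totalMomentum p) (reduction p).1) ∧
      (IsCriticalPoint b p ↔ IsRelativeEquilibrium b p)) ∧
    (∀ j : Mult m → ℝ, (∀ τ, 0 < j τ) →
      -- the critical points of the amended potential
      (∀ ξ : Fin (ℓ + 1) → ℝ, IsAmendedCriticalPoint b j ξ ↔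
        ξ ∈ reducedSphere m ∧ ∃ β : ℝ,
          (∀ τ : Mult m, β < b τ.1 ∧ ξ τ.1 ^ 2 = j τ / omega b β τ.1) ∧
          (∀ σ, m σ = 1 → ξ σ = 0 ∨ b σ = β)) ∧
      (2 ≤ m 0 → ∀ ξ : Fin (ℓ + 1) → ℝ, IsAmendedCriticalPoint b j ξ →
        ∀ σ, m σ = 1 → ξ σ = 0) ∧
      -- the multiplier is determined by the constraint
      (∃! β : ℝ, (∀ τ : Mult m, β < b τ.1) ∧ ∑ τ : Mult m, j τ / omega b β τ.1 = 1) ∧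
      -- the critical values
      (∀ h : ℝ, IsCriticalValue m b h j ↔
        (∃ β : ℝ, (∀ τ : Mult m, β < b τ.1) ∧ ∑ τ : Mult m, j τ / omega b β τ.1 = 1 ∧
          h = criticalEnergy b j β) ∨
        (∃ σ, m σ = 1 ∧ (∀ τ : Mult m, b σ < b τ.1) ∧
          ∑ τ : Mult m, j τ / omega b (b σ) τ.1 < 1 ∧
          h = (1 / 2) * b σ * (1 - ∑ τ : Mult m, j τ / omega b (b σ) τ.1) +
            criticalEnergy b j (b σ))) ∧
      (2 ≤ m 0 → ∀ h : ℝ, IsCriticalValue m b h j ↔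
        ∃ β : ℝ, (∀ τ : Mult m, β < b τ.1) ∧ ∑ τ : Mult m, j τ / omega b β τ.1 = 1 ∧
          h = criticalEnergy b j β)) := by
  refine ⟨fun h j hne hreg => ?_, fun p hp hJ => ?_, fun j hj => ⟨fun ξ => ?_, fun h0 ξ hξ => ?_,
    existsUnique_multiplier hdeg hj, fun h => ?_, fun h0 h => ?_⟩⟩
  · have hj := hreg.pos hne
    exact ⟨fun q hq => fibre_eq hj hq, scaledPlucker_injective hj, momentum_image_fibre hm hj hne,
      reduction_image_fibre hm hj, hreg.isSubmanifold_reducedLevel hm hdeg hj,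
      fun z hz => ⟨reduction_isSmoothFibreBundle hm hj hz,
        momentum_reductionFibre_isSmoothFibreBundle hm hj hz⟩,
      fun ν hν => ⟨momentum_isSmoothFibreBundle hm hj hν,
        reduction_momentumFibre_isSmoothFibreBundle hm hj hν⟩⟩
  · have h1 := isRelativeEquilibrium_iff_isReducedEquilibrium (b := b) hm hp hJ
    exact ⟨h1, (isCriticalPoint_iff_isReducedEquilibrium hm hp hJ).trans h1.symm⟩
  · exact isAmendedCriticalPoint_iff hm hj
  · exact hξ.eq_zero hm hb hj h0
  · rw [isCriticalValue_iff hm hj, exists_isAmendedCriticalPoint_iff hm hb hj]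
  · rw [isCriticalValue_iff hm hj, exists_isAmendedCriticalPoint_iff hm hb hj]
    -- The second family would need a simple `σ` with `b σ < b 0`.
    refine or_iff_left ?_
    rintro ⟨σ, -, hσ, -⟩
    exact (hσ ⟨0, h0⟩).not_ge (hb.monotone (Fin.zero_le σ))
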